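/- **Setting.** Let $H$ be a real Hilbert space with inner product $(\cdot,\cdot)_H$ and norm $\|\cdot\|$, and let $X\subset H$ be a Banach space with norm $\|\cdot\|_X$ which is dense in $H$ and whose inclusion in $H$ is continuous (S). Let $V\subset H$ be open and contain $\{\|u\|>r\}$ for some $r$; $V\cap X$ carries the topology of $X$. A map $f$ on an open set $U$ of a Banach space $E$ is *continuously directional differentiable* if $Df(x)(u)=\lim_{t\to0}(f(x+tu)-f(x))/t$ exists for all $x\in U$, $u\in E$ and is continuous in $(x,u)$. A map $f$ defined on a subset $s$ of a normed space has the *strict Fréchet derivative $S$ at $\infty$* ($S$ bounded linear) if $\|f(x_1)-f(x_2)-S(x_1-x_2)\|/\|x_1-x_2\|\to0$ as $x_1\ne x_2$ in $s$ and $\|x_1\|,\|x_2\|\to\infty$. Assume that $\mathcal L:V\to\mathbb R$, $A:V\cap X\to X$, and $B:(V\cap X)\cup\{\infty\}\to L_s(H)$ (bounded self-adjoint operators) satisfy: - (F1) $\mathcal L$ is continuous and continuously directional differentiable. - (F2) $A$ is continuous and continuously directional differentiable, and $D\mathcal L(x)(u)=(A(x),u)_H$ for $x\in V\cap X$, $u\in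 X$. - (F3) $B(\infty)(X)\subset X$, and $(DA(x)(u),v)_H=(B(x)u,v)_H$ for $x\in V\cap X$, $u,v\in X$. - (C1) $0\notin\sigma(B(\infty))$ or $0$ is an isolated point of $\sigma(B(\infty))$. (C2) If $u\in H$ and $B(\infty)u\in X$, then $u\in X$. - (D) $B(x)=P(x)+Q(x)$ on $(V\cap X)\cup\{\infty\}$ with $P(x)$ positive definite and $Q(x)$ compact; every eigenvector of $B(\infty)$ for a negative eigenvalue lies in $X$; for every sequence $x_k\in V\cap X$ with $\|x_k\|\to\infty$ one has $P(x_k)u\to P(\infty)u$ for every $u\in H$, and there are $C_0>0$, $n_0$ with $(P(x_k)u,u)_H\ge C_0\|u\|^2$ for all $u\in H$, $k\ge n_0$; and $\|Q(x)-Q(\infty)\|\to0$ as $x\in V\cap X$, $\|x\|\to\infty$. Put $H^0=\operatorname{Ker}B(\infty)$ (contained in $X$ by (C2)), $H^\pm=(H^0)^\perp=H^+\oplus H^-$ with $H^+,H^-$ the positive and negative spectral subspaces of $B(\infty)$ ($H^-$ is spanned by the eigenvectors for negative eigenvalues), $X^\pm=H^\pm\cap X$ with norm $\|\cdot\|_X$,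 $P^0$ the orthogonal projection onto $H^0$, $B_{H^0}(\infty,R)=\{z\in H^0:\|z\|>R\}$, $\bar B_{H^0}(\infty,R)=\{z\in H^0:\|z\|\ge R\}$. Let $C_1$ be the norm of the inverse of the isomorphism $B(\infty):X^\pm\to X^\pm$, and $$M(A)=\lim_{R\to\infty}\sup\{\|(I-P^0)A(z)\|_X: z\in H^0,\ \|z\|_X\ge R\}\in[0,\infty].$$ For $z\in H^0$, $x\in X^\pm$ write $r(z,x)=(I-P^0)A(z+x)-B(\infty)x$. For $\rho\in(0,\infty]$ consider the conditions - (E)$_\rho$: there are $R_1>0$, $\kappa>1$ with $\rho=\infty$ or $\rho>\frac{\kappa}{\kappa-1}C_1M(A)$, such that $\|r(z_1,x_1)-r(z_2,x_2)\|_X\le\frac1{\kappa C_1}\|z_1+x_1-z_2-x_2\|_X$ for all $z_i\in H^0$, $\|z_i\|\ge R_1$, $x_i\in X^\pm$, $\|x_i\|_X<\rho$; - (E')$_\rho$: the same with $z_1=z_2$ only; - (SE)$_\rho$: $\rho=\infty$ or $\rho>C_1M(A)$, and $\|r(z_1,x_1)-r(z_2,x_2)\|_X/\|z_1+x_1-z_2-x_2\|_X\to0$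 as $\|z_1\|,\|z_2\|\to\infty$ in $H^0$, uniformly in $x_i\in X^\pm$, $\|x_i\|_X<\rho$. (Points $z_i+x_i$ are taken in $V$, which is automatic for large $\|z_i\|$. When $X^\pm=\{0\}$ we read $C_1=0$, and the inequalities in (E)$_\rho$ and (E')$_\rho$ are trivially satisfied.) **Theorem 1.1.** Assume (S), (F1)–(F3), (C1), (C2), (D), $\nu_\infty=\dim H^0>0$, (E')$_\rho$ for some $\rho\in(0,\infty]$, and $\mathcal L(u)=\frac12(B(\infty)u,u)_H+o(\|u\|^2)$ as $\|u\|\to\infty$. Then $H^0\oplus H^-\subset X$, and there are $R>0$ with $\bar B_{H^0}(\infty,R)\oplus H^\pm\subset V$, a continuous map $h^\infty:\bar B_{H^0}(\infty,R)\to X^\pm$ with $\|h^\infty(z)\|_X\le\rho$ and $$(I-P^0)A(z+h^\infty(z))=0\qquad\forall z\in\bar B_{H^0}(\infty,R),$$ where $h^\infty(z)$ is the unique such element of $\{x\in X^\pm:\|x\|_X\le\rho\}$, and a homeomorphism $\Phi$ of $B_{H^0}(\infty,R)\oplus H^\pm$ onto itself of the form $\Phi(z+u^++u^-)=z+h^\infty(z)+\phi_z(u^++u^-)$,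 $\phi_z(u^++u^-)\in H^\pm$, with $\Phi(B_{H^0}(\infty,R)\oplus X^\pm)\subset X$ and $$\mathcal L(\Phi(z+u^++u^-))=\|u^+\|^2-\|u^-\|^2+\mathcal L(z+h^\infty(z))$$ for all $z\in B_{H^0}(\infty,R)$, $u^+\in H^+$, $u^-\in H^-$. Moreover: (a) $\Phi(z)=z+h^\infty(z)$ for $z\in B_{H^0}(\infty,R)$, and $\phi_z(u^++u^-)\in H^-$ if and only if $u^+=0$. (b) $\Phi$ restricts to a homeomorphism of $B_{H^0}(\infty,R)\oplus H^-\subset X$ onto its image, which lies in $X$, also when both carry the topology of $X$. With $\mathcal L^\infty(z)=\mathcal L(z+h^\infty(z))$ on $B_{H^0}(\infty,R)$: (i) If $M(A)=0$, then $\|h^\infty(z)\|_X\to0$ as $\|z\|_X\to\infty$. (ii) If $A$ is $C^1$, then $h^\infty$ is $C^1$ on $B_{H^0}(\infty,R)$, $(I-P^0)A'(z+h^\infty(z))|_{X^\pm}$ is an isomorphism of $X^\pm$, and $$dh^\infty(z)=-\bigl[(I-P^0)A'(z+h^\infty(z))|_{X^\pm}\bigr]^{-1}(I-P^0)A'(z+h^\infty(z))|_{H^0};$$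 moreover $\mathcal L^\infty$ is $C^2$ and $$d\mathcal L^\infty(z_0)(z)=(A(z_0+h^\infty(z_0)),z)_H\qquad\forall z_0\in B_{H^0}(\infty,R),\ z\in H^0.\qquad(*)$$ (iii) If $\mathcal L$ is $C^2$ on $V$, then $h^\infty$ is $C^1$ on $B_{H^0}(\infty,R)$, as a map to $H^\pm$ and as a map to $X^\pm$. If (E)$_\rho$ holds, then also: (iv) $h^\infty$ is Lipschitz into $X^\pm$, and has strict Fréchet derivative zero at $\infty$ as a map to $H^\pm$ with the norm of $H$; if (SE)$_{\rho'}$ holds for some $\rho'\in(0,\infty]$, then $h^\infty$ has strict Fréchet derivative zero at $\infty$ as a map to $X^\pm$ with the norm of $X$. (v) $\mathcal L^\infty$ is $C^1$ and $(*)$ holds. (vi) If $B(\infty)|_X\in L(X)$ and $A$ has strict Fréchet derivative $B(\infty)|_X$ at $\infty$ (on $V\cap X$, in the norm of $X$), then $\mathcal L^\infty$ is $C^{2-0}$ (that is, $C^1$ with locally Lipschitz differential), $d\mathcal L^\infty$ has strict Fréchet derivative zero at $\infty$, and (E)$_{\rho'}$ holds for $\rho'=\infty$ and for every finite $\rho'>C_1M(A)$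 (so $\rho$ may be replaced by any such $\rho'$, with $R$ depending on it). -/

import Mathlib

open Set Filter Topology
open scoped ENNReal RealInnerProductSpace

noncomputable section

namespace SplitInf

variable {E F : Type*} [NormedAddCommGroup E] [NormedSpace ℝ E]
  [NormedAddCommGroup F] [NormedSpace ℝ F]

/-- `f` is continuous and continuously directional differentiable on the open set `U`: the
directional derivatives `Df(x)(u) = lim_{t → 0} (f (x + t u) - f x) / t` exist for all
`x ∈ U` and all `u`, and `(x, u) ↦ Df(x)(u)` is continuous on `U × E`. -/
def ContDirDiffOn (f : E → F) (U : Set E) : Prop :=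
  ContinuousOn f U ∧ (∀ x ∈ U, ∀ u : E, LineDifferentiableAt ℝ f x u) ∧
    ContinuousOn (fun p : E × E => lineDeriv ℝ f p.1 p.2) (U ×ˢ univ)

/-- `f`, defined on the set `s`, has the strict Fréchet derivative `S` at infinity:
`‖f x₁ - f x₂ - S (x₁ - x₂)‖ / ‖x₁ - x₂‖ → 0` as `x₁ ≠ x₂` in `s` and both norms
tend to infinity. -/
def HasStrictDerivAtInfinity (f : E → F) (S : E →L[ℝ] F) (s : Set E) : Prop :=
  ∀ ε : ℝ, 0 < ε → ∃ R : ℝ, ∀ x₁ ∈ s, ∀ x₂ ∈ s, R ≤ ‖x₁‖ → R ≤ ‖x₂‖ →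
    ‖f x₁ - f x₂ - S (x₁ - x₂)‖ ≤ ε * ‖x₁ - x₂‖

variable {H X : Type*} [NormedAddCommGroup H] [InnerProductSpace ℝ H] [CompleteSpace H]
  [NormedAddCommGroup X] [NormedSpace ℝ X]

/-! ### The subspaces attached to the operator `B(∞)` -/

/-- The kernel `H⁰` of `B(∞)`. -/
def H0 (Binf : H →L[ℝ] H) : Submodule ℝ H := LinearMap.ker (Binf : H →ₗ[ℝ] H)

instance (Binf : H →L[ℝ] H) : CompleteSpace (H0 Binf) :=
  (ContinuousLinearMap.isClosed_ker Binf).completeSpace_coe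

/-- `H^±`, the orthogonal complement of `H⁰`. -/
def Hpm (Binf : H →L[ℝ] H) : Submodule ℝ H := (H0 Binf)ᗮ

/-- `H⁻`, the negative definite subspace of `B(∞)`: the span of the eigenvectors that belong to
negative eigenvalues. (When `B(∞)` is self-adjoint and is the sum of a coercive and a compact
operator, its spectrum in `(-∞, 0]` consists of finitely many eigenvalues of finite multiplicity,
and this is the negative spectral subspace.) -/
def Hminus (Binf : H →L[ℝ] H) : Submodule ℝ H :=
  ⨆ μ : Set.Iio (0 : ℝ), Module.End.eigenspace (Binf : H →ₗ[ℝ] H) (μ : ℝ)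

/-- `H⁺`, the positive definite subspace of `B(∞)`: the orthogonal complement of
`H⁰ ⊕ H⁻`. -/
def Hplus (Binf : H →L[ℝ] H) : Submodule ℝ H := (H0 Binf ⊔ Hminus Binf)ᗮ

/-- The orthogonal projection `P⁰` of `H` onto `H⁰`. -/
def P0 (Binf : H →L[ℝ] H) : H →L[ℝ] H := (H0 Binf).starProjection

/-- `B_{H⁰}(∞, R) ⊕ H^±`, a subset of `H`. -/
def Omega (Binf : H →L[ℝ] H) (R : ℝ) : Set H := {w | R < ‖P0 Binf w‖}

/-! `X` is a second space, with an injective continuous linear map `ι : X → H`, the inclusion. -/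

/-- `H⁰ ∩ X`, as a subspace of `X`. (Under the condition `CondC2` below it is all of `H⁰`.) -/
def X0 (ι : X →L[ℝ] H) (Binf : H →L[ℝ] H) : Submodule ℝ X := (H0 Binf).comap (ι : X →ₗ[ℝ] H)

/-- `X^± = H^± ∩ X`, as a subspace of `X`. -/
def Xpm (ι : X →L[ℝ] H) (Binf : H →L[ℝ] H) : Submodule ℝ X := (Hpm Binf).comap (ι : X →ₗ[ℝ] H)

/-- `B_{H⁰}(∞, R)`. -/
def extBall (ι : X →L[ℝ] H) (Binf : H →L[ℝ] H) (R : ℝ) : Set (X0 ι Binf) :=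
  {z | R < ‖ι (z : X)‖}

/-- The closed version of `B_{H⁰}(∞, R)`. -/
def closedExtBall (ι : X →L[ℝ] H) (Binf : H →L[ℝ] H) (R : ℝ) : Set (X0 ι Binf) :=
  {z | R ≤ ‖ι (z : X)‖}

/-- An element of `H` that lies in `X`, regarded as an element of `X`.
Only used for elements of the range of `ι`. -/
def toX (ι : X →L[ℝ] H) (u : H) : X := Function.invFun ι u

/-- `(I - P⁰) x` for `x ∈ X`, as an element of `X`. -/
def pmPart (ι : X →L[ℝ] H) (Binf : H →L[ℝ] H) (x : X) : X := toX ι (ι x - P0 Binf (ι x))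

/-- `B(∞) x` for `x ∈ X`, as an element of `X`. -/
def BX (ι : X →L[ℝ] H) (Binf : H →L[ℝ] H) (x : X) : X := toX ι (Binf (ι x))

/-! ### The conditions -/

/-- `L` is continuous and continuously directional differentiable. -/
def CondF1 (V : Set H) (L : H → ℝ) : Prop := ContDirDiffOn L V

/-- `A : V ∩ X → X` is a continuous and continuously directional differentiable gradient
of `L`. -/
def CondF2 (ι : X →L[ℝ] H) (V : Set H) (L : H → ℝ) (A : X → X) : Prop :=
  ContDirDiffOn A (ι ⁻¹' V) ∧
    ∀ x : X, ι x ∈ V → ∀ u : X, lineDeriv ℝ L (ι x) (ι u) = ⟪ι (A x), ι u⟫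

/-- `B` takes values in the bounded self-adjoint operators, it represents the derivative of `A`,
and `B(∞)` maps `X` to `X`. The values of `B` are only used on `V ∩ X`. -/
def CondF3 (ι : X →L[ℝ] H) (V : Set H) (A : X → X) (B : X → H →L[ℝ] H) (Binf : H →L[ℝ] H) :
    Prop :=
  (∀ x : X, ι x ∈ V → IsSelfAdjoint (B x)) ∧ IsSelfAdjoint Binf ∧
    (∀ x : X, Binf (ι x) ∈ range ι) ∧
    ∀ x : X, ι x ∈ V → ∀ u v : X, ⟪ι (lineDeriv ℝ A x u), ι v⟫ = ⟪B x (ι u), ι v⟫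

/-- `0` is not in the spectrum of `B(∞)`, or is an isolated point of it. -/
def CondC1 (Binf : H →L[ℝ] H) : Prop :=
  (0 : ℝ) ∉ spectrum ℝ Binf ∨
    ((0 : ℝ) ∈ spectrum ℝ Binf ∧ ∃ ε : ℝ, 0 < ε ∧ ∀ μ ∈ spectrum ℝ Binf, |μ| < ε → μ = 0)

/-- If `B(∞) u ∈ X` then `u ∈ X`. -/
def CondC2 (ι : X →L[ℝ] H) (Binf : H →L[ℝ] H) : Prop :=
  ∀ u : H, Binf u ∈ range ι → u ∈ range ι

/-- The decomposition `B = P + Q` into positive definite and compact operators, on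
`(V ∩ X) ∪ {∞}`. Positive definiteness is used in the weak sense `(P u, u) > 0` for `u ≠ 0`. -/
def CondD (ι : X →L[ℝ] H) (V : Set H) (B : X → H →L[ℝ] H) (Binf : H →L[ℝ] H) : Prop :=
  ∃ (P Q : X → H →L[ℝ] H) (Pinf Qinf : H →L[ℝ] H),
    (∀ x : X, ι x ∈ V → B x = P x + Q x) ∧ Binf = Pinf + Qinf ∧
    (∀ x : X, ι x ∈ V → ∀ u : H, u ≠ 0 → 0 < ⟪P x u, u⟫) ∧
    (∀ u : H, u ≠ 0 → 0 < ⟪Pinf u, u⟫) ∧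
    (∀ x : X, ι x ∈ V → IsCompactOperator (Q x)) ∧ IsCompactOperator Qinf ∧
    (∀ (μ : ℝ) (u : H), μ < 0 → Binf u = μ • u → u ∈ range ι) ∧
    (∀ x : ℕ → X, (∀ k, ι (x k) ∈ V) → Tendsto (fun k => ‖ι (x k)‖) atTop atTop →
      ∀ u : H, Tendsto (fun k => ‖P (x k) u - Pinf u‖) atTop (𝓝 0)) ∧
    (∀ ε : ℝ, 0 < ε → ∃ R : ℝ, ∀ x : X, ι x ∈ V → R ≤ ‖ι x‖ → ‖Q x - Qinf‖ ≤ ε) ∧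
    (∀ x : ℕ → X, (∀ k, ι (x k) ∈ V) → Tendsto (fun k => ‖ι (x k)‖) atTop atTop →
      ∃ C₀ : ℝ, 0 < C₀ ∧ ∃ n₀ : ℕ, ∀ n, n₀ ≤ n → ∀ u : H, C₀ * ‖u‖ ^ 2 ≤ ⟪P (x n) u, u⟫)

/-- `C₁`, the operator norm of the inverse of `B(∞) : X^± → X^±`. -/
def C1 (ι : X →L[ℝ] H) (Binf : H →L[ℝ] H) : ℝ :=
  sInf {c : ℝ | 0 ≤ c ∧ ∀ x ∈ Xpm ι Binf, ∀ y ∈ Xpm ι Binf, Binf (ι x) = ι y → ‖x‖ ≤ c * ‖y‖}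

/-- `M(A) = lim_{R → ∞} sup {‖(I - P⁰) A z‖_X : z ∈ H⁰, ‖z‖_X ≥ R}`, a number in `[0, ∞]`. -/
def MA (ι : X →L[ℝ] H) (Binf : H →L[ℝ] H) (A : X → X) : ℝ≥0∞ :=
  ⨅ R : ℝ, ⨆ z : X0 ι Binf, ⨆ _ : R ≤ ‖z‖, ‖pmPart ι Binf (A (z : X))‖ₑ

/-- `(I - P⁰) A (z + x) - B(∞) x`, as an element of `X`. -/
def rem (ι : X →L[ℝ] H) (Binf : H →L[ℝ] H) (A : X → X) (z : X0 ι Binf) (x : Xpm ι Binf) : X :=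
  pmPart ι Binf (A ((z : X) + (x : X))) - BX ι Binf (x : X)

/-- The condition (E) with the radius `ρ ∈ (0, ∞]`; nothing is required of `M(A)`
when `ρ = ∞`. -/
def CondE (ι : X →L[ℝ] H) (V : Set H) (A : X → X) (Binf : H →L[ℝ] H) (ρ : ℝ≥0∞) : Prop :=
  ∃ R₁ : ℝ, 0 < R₁ ∧ ∃ κ : ℝ, 1 < κ ∧
    (ρ = ∞ ∨ ENNReal.ofReal (κ / (κ - 1) * C1 ι Binf) * MA ι Binf A < ρ) ∧
    ∀ (z₁ z₂ : X0 ι Binf) (x₁ x₂ : Xpm ι Binf), R₁ ≤ ‖ι (z₁ : X)‖ → R₁ ≤ ‖ι (z₂ : X)‖ →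
      ‖x₁‖ₑ < ρ → ‖x₂‖ₑ < ρ → ι ((z₁ : X) + x₁) ∈ V → ι ((z₂ : X) + x₂) ∈ V →
      ‖rem ι Binf A z₁ x₁ - rem ι Binf A z₂ x₂‖ ≤
        1 / (κ * C1 ι Binf) * ‖((z₁ : X) + x₁) - ((z₂ : X) + x₂)‖

/-- The condition (E'), that is (E) restricted to `z₁ = z₂`. -/
def CondE' (ι : X →L[ℝ] H) (V : Set H) (A : X → X) (Binf : H →L[ℝ] H) (ρ : ℝ≥0∞) : Prop :=
  ∃ R₁ : ℝ, 0 < R₁ ∧ ∃ κ : ℝ, 1 < κ ∧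
    (ρ = ∞ ∨ ENNReal.ofReal (κ / (κ - 1) * C1 ι Binf) * MA ι Binf A < ρ) ∧
    ∀ (z : X0 ι Binf) (x₁ x₂ : Xpm ι Binf), R₁ ≤ ‖ι (z : X)‖ →
      ‖x₁‖ₑ < ρ → ‖x₂‖ₑ < ρ → ι ((z : X) + x₁) ∈ V → ι ((z : X) + x₂) ∈ V →
      ‖rem ι Binf A z x₁ - rem ι Binf A z x₂‖ ≤ 1 / (κ * C1 ι Binf) * ‖x₁ - x₂‖

/-- The condition (SE) with the radius `ρ ∈ (0, ∞]`. -/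
def CondSE (ι : X →L[ℝ] H) (V : Set H) (A : X → X) (Binf : H →L[ℝ] H) (ρ : ℝ≥0∞) : Prop :=
  (ρ = ∞ ∨ ENNReal.ofReal (C1 ι Binf) * MA ι Binf A < ρ) ∧
    ∀ ε : ℝ, 0 < ε → ∃ R₁ : ℝ, ∀ (z₁ z₂ : X0 ι Binf) (x₁ x₂ : Xpm ι Binf),
      R₁ ≤ ‖ι (z₁ : X)‖ → R₁ ≤ ‖ι (z₂ : X)‖ →
      ‖x₁‖ₑ < ρ → ‖x₂‖ₑ < ρ → ι ((z₁ : X) + x₁) ∈ V → ι ((z₂ : X) + x₂) ∈ V →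
      ‖rem ι Binf A z₁ x₁ - rem ι Binf A z₂ x₂‖ ≤ ε * ‖((z₁ : X) + x₁) - ((z₂ : X) + x₂)‖

/-- The reduced functional `L^∞(z) = L (z + h z)`. -/
def Lred (ι : X →L[ℝ] H) (Binf : H →L[ℝ] H) (L : H → ℝ) (h : X0 ι Binf → Xpm ι Binf)
    (z : X0 ι Binf) : ℝ := L (ι ((z : X) + h z))

/-- The linear form `z ↦ (a, z)_H` on `H⁰`, for `a ∈ X`. -/
def formH0 (ι : X →L[ℝ] H) (Binf : H →L[ℝ] H) (a : X) : X0 ι Binf →L[ℝ] ℝ :=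
  ((innerSL ℝ (ι a)).comp ι).comp (X0 ι Binf).subtypeL

/-- `B_{H⁰}(∞, R) ⊕ H⁻`, as a subset of `X`. -/
def minusSet (ι : X →L[ℝ] H) (Binf : H →L[ℝ] H) (R : ℝ) : Set X :=
  {x | ∃ z ∈ H0 Binf, ∃ v ∈ Hminus Binf, R < ‖z‖ ∧ ι x = z + v}

/-- The image of `B_{H⁰}(∞, R) ⊕ H⁻` under a self-map `Φ` of `B_{H⁰}(∞, R) ⊕ H^±`, as a subset
of `X`. -/
def minusImage (ι : X →L[ℝ] H) (Binf : H →L[ℝ] H) (R : ℝ) (Φ : Omega Binf R → Omega Binf R) :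
    Set X :=
  {y | ∃ w : Omega Binf R, ∃ x ∈ minusSet ι Binf R, (w : H) = ι x ∧ ι y = Φ w}

/-! ### The elements of `X` used above are what they should be -/

theorem apply_toX (ι : X →L[ℝ] H) {u : H} (hu : u ∈ range ι) : ι (toX ι u) = u :=
  Function.invFun_eq hu

theorem apply_pmPart {ι : X →L[ℝ] H} {Binf : H →L[ℝ] H} (hC2 : CondC2 ι Binf) (x : X) :
    ι (pmPart ι Binf x) = ι x - P0 Binf (ι x) := by
  have h0 : P0 Binf (ι x) ∈ range ι := by
    refine hC2 _ ⟨0, ?_⟩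
    have h : P0 Binf (ι x) ∈ H0 Binf := Submodule.starProjection_apply_mem _ _
    rw [map_zero]
    exact (LinearMap.mem_ker.mp h).symm
  obtain ⟨y, hy⟩ := h0
  exact apply_toX ι ⟨x - y, by rw [map_sub, hy]⟩

theorem apply_BX {ι : X →L[ℝ] H} {Binf : H →L[ℝ] H} (hB : ∀ x : X, Binf (ι x) ∈ range ι)
    (x : X) : ι (BX ι Binf x) = Binf (ι x) :=
  apply_toX ι (hB x)

end SplitInf

end

open SplitInf

set_option linter.unusedSectionVars false

namespace SplitInf

/-! ### Saddle functions and their normal form -/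

section Saddle

/-! The proof is a Lyapunov–Schmidt reduction over the exterior of a ball in `H⁰`, followed by a
Morse lemma with parameters that uses convexity only.

Spectral part. `B(∞)` is coercive plus compact, so `H⁰ ⊕ H⁻` is finite-dimensional, lies in `X`, and
the form of `B(∞)` has gaps on `H⁺` and `H⁻`; with (C2) this makes `B(∞)` an isomorphism of `X^±`.
The gaps persist for `B(x)` with `‖x‖` large. As `P(x)` converges only strongly, this needs a
weak-limit argument on the infinite-dimensional `H⁺` (`exists_gap_Hplus_near_infinity`), while
strong convergence is uniform on `H⁰ ⊕ H⁻`. Integrating the Hessian on `X` and using density, `L`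
becomes strongly convex along `H⁺` and strongly concave along `H⁻` wherever `‖P⁰ p‖` is large
(`exists_monotoneAlong`).

Reduction. By (E'), `x ↦ x - B(∞)⁻¹ (I - P⁰) A (z + x)` is a contraction, and its fixed point is `h
z`. The error estimate `IsReduction.norm_sub_le`, which bounds the distance to `h z` by the
residual, gives uniqueness, continuity and the decay of `h`. It also gives differentiability: on the
finite-dimensional `H⁰` a jointly continuous directional derivative is a strict Fréchet derivative,
so `h` and `z ↦ A (z + h z)` are `C¹` and the reduced functional is `C²`
(`IsReduction.hasStrictFDerivAt`, `IsReduction.hasStrictFDerivAt_A`). Since `B(x)` tends to zero on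
`H⁰` and keeps its gaps on `H^±`, the derivatives of `h` (in the norm of `H`) and of the reduced
differential vanish at infinity.

Normal form. The derivative of `L` at `z + h z` vanishes along `H^±`. Maximizing over the
finite-dimensional `H⁻` leaves a convex function on `H⁺`; this function, and the drop of `L` below
the maximum, become squared norms after rescaling on rays (`exists_saddle_homeomorph`). Only
positive multiples of `u⁺` and elements of `H⁻` and `X^±` enter, so `X` is preserved. -/

/-- A strongly concave function decays at least quadratically away from a maximum. -/
theorem add_le_of_strongConcaveOn_of_isMax {G : Type*} [NormedAddCommGroup G] [NormedSpace ℝ G]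
    {f : G → ℝ} {c : ℝ} (hf : StrongConcaveOn univ (2 * c) f) {x : G} (hx : ∀ y, f y ≤ f x)
    (y : G) : c * ‖y - x‖ ^ 2 ≤ f x - f y := by
  -- Strong concavity is compared with maximality at the point `t • y + (1 - t) • x`; the lost
  -- factor `1 - t` disappears as `t → 0`.
  have key : ∀ t : ℝ, t ∈ Ioo (0 : ℝ) 1 → c * (1 - t) * ‖y - x‖ ^ 2 ≤ f x - f y := by
    intro t ht
    have h := hf.2 (mem_univ y) (mem_univ x) ht.1.le (by linarith [ht.2] : (0 : ℝ) ≤ 1 - t)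
      (by ring)
    have h2 := hx (t • y + (1 - t) • x)
    simp only [smul_eq_mul] at h
    have h3 : t * (c * (1 - t) * ‖y - x‖ ^ 2) ≤ t * (f x - f y) := by nlinarith
    exact le_of_mul_le_mul_left h3 ht.1
  have hlim : Tendsto (fun t : ℝ => c * (1 - t) * ‖y - x‖ ^ 2) (𝓝[>] 0)
      (𝓝 (c * (1 - 0) * ‖y - x‖ ^ 2)) :=
    ((by fun_prop : Continuous fun t : ℝ => c * (1 - t) * ‖y - x‖ ^ 2).tendsto 0).mono_left
      nhdsWithin_le_nhds
  have := le_of_tendsto hlim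
    (by filter_upwards [Ioo_mem_nhdsGT (zero_lt_one' ℝ)] with t ht using key t ht)
  simpa using this

/-- A continuous strongly concave function on a finite-dimensional space has a maximum. -/
theorem exists_isMax_of_strongConcaveOn {G : Type*} [NormedAddCommGroup G] [NormedSpace ℝ G]
    [FiniteDimensional ℝ G] {f : G → ℝ} {c : ℝ} (hc : 0 < c)
    (hf : StrongConcaveOn univ (2 * c) f) (hcont : Continuous f) : ∃ x, ∀ y, f y ≤ f x := by
  obtain ⟨M, hM⟩ := (isCompact_sphere (0 : G) 1).bddAbove_image hcont.continuousOn
  -- For `‖v‖ ≥ 1` the segment from `0` to `v` meets the unit sphere, where `f ≤ M`, at weight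
  -- `‖v‖⁻¹`. The strong concavity term there is `c * (‖v‖ - 1)`, which exceeds `M - f 0` far out.
  have hev : ∀ᶠ v in cocompact G, f v ≤ f 0 := by
    have h1 : ∀ᶠ v in cocompact G, 1 + |M - f 0| / c ≤ ‖v‖ :=
      (tendsto_norm_cocompact_atTop (E := G)).eventually_ge_atTop _
    filter_upwards [h1] with v hv
    have hq : 0 ≤ |M - f 0| / c := by positivity
    have hn : 1 ≤ ‖v‖ := by linarith
    have hpos : 0 < ‖v‖ := by linarith
    have hs : ‖v‖⁻¹ • v ∈ Metric.sphere (0 : G) 1 := by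
      simp [norm_smul, hpos.ne']
    have hM' : f (‖v‖⁻¹ • v) ≤ M := hM (mem_image_of_mem f hs)
    have hi1 : ‖v‖⁻¹ ≤ 1 := inv_le_one_of_one_le₀ hn
    have h := hf.2 (mem_univ v) (mem_univ (0 : G)) (inv_nonneg.2 hpos.le)
      (by linarith : (0 : ℝ) ≤ 1 - ‖v‖⁻¹) (by ring)
    simp only [smul_eq_mul, smul_zero, add_zero, sub_zero] at h
    have h2 : ‖v‖⁻¹ * f v + (1 - ‖v‖⁻¹) * f 0 + ‖v‖⁻¹ * (1 - ‖v‖⁻¹) * (2 * c / 2 * ‖v‖ ^ 2) ≤ M :=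
      h.trans hM'
    have e1 : ‖v‖⁻¹ * (1 - ‖v‖⁻¹) * (2 * c / 2 * ‖v‖ ^ 2) = c * (‖v‖ - 1) := by
      field_simp
    rw [e1] at h2
    have h3 : |M - f 0| ≤ c * (‖v‖ - 1) := by
      have : |M - f 0| / c ≤ ‖v‖ - 1 := by linarith
      rw [div_le_iff₀ hc] at this
      linarith
    have h4 : ‖v‖⁻¹ * (f v - f 0) ≤ 0 := by
      have := le_abs_self (M - f 0)
      nlinarith
    have h5 : f v - f 0 ≤ 0 := by
      by_contra hcon
      push Not at hcon
      have := mul_pos (inv_pos.2 hpos) hcon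
      linarith
    linarith
  exact hcont.exists_forall_ge' 0 hev

/-- The maximum point of a strongly concave function depends continuously on parameters. -/
theorem continuous_argmax_of_strongConcaveOn {W G : Type*} [TopologicalSpace W]
    [NormedAddCommGroup G] [NormedSpace ℝ G] [FiniteDimensional ℝ G] {f : W → G → ℝ} {c : ℝ}
    (hc : 0 < c) (hf : ∀ w, StrongConcaveOn univ (2 * c) (f w))
    (hcont : Continuous fun p : W × G => f p.1 p.2) {ψ : W → G}
    (hψ : ∀ w v, f w v ≤ f w (ψ w)) : Continuous ψ := by
  rw [continuous_iff_continuousAt]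
  intro w₀
  rw [ContinuousAt, Metric.tendsto_nhds]
  intro ε hε
  have hS : IsCompact (Metric.sphere (ψ w₀) ε) := isCompact_sphere _ _
  have hev : ∀ᶠ w in 𝓝 w₀, ∀ v ∈ Metric.sphere (ψ w₀) ε, f w v < f w (ψ w₀) := by
    refine hS.eventually_forall_of_forall_eventually fun v hv => ?_
    have hlt : f w₀ v < f w₀ (ψ w₀) := by
      have h1 := add_le_of_strongConcaveOn_of_isMax (hf w₀) (hψ w₀) v
      have h2 : ‖v - ψ w₀‖ = ε := by simpa [dist_eq_norm] using hv
      rw [h2] at h1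
      have : 0 < c * ε ^ 2 := by positivity
      linarith
    exact (hcont.tendsto (w₀, v)).eventually_lt
      ((hcont.comp (by fun_prop : Continuous fun p : W × G => (p.1, ψ w₀))).tendsto (w₀, v)) hlt
  filter_upwards [hev] with w hw
  by_contra hcon
  push Not at hcon
  set d := dist (ψ w) (ψ w₀) with hd
  have hdpos : 0 < d := hε.trans_le hcon
  -- The segment from `ψ w₀` to a distant maximum `ψ w` crosses the sphere here. Concavity makes the
  -- value at the crossing at least `f w (ψ w₀)`, against `hw`.
  have hv : ψ w₀ + (ε / d) • (ψ w - ψ w₀) ∈ Metric.sphere (ψ w₀) ε := by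
    rw [mem_sphere_iff_norm, add_sub_cancel_left, norm_smul, ← dist_eq_norm, ← hd,
      Real.norm_of_nonneg (by positivity)]
    field_simp
  have h1 := hw _ hv
  have hle : ε / d ≤ 1 := (div_le_one hdpos).2 hcon
  have h2 := ((hf w).mono (by positivity : (0 : ℝ) ≤ 2 * c)).2 (mem_univ (ψ w))
    (mem_univ (ψ w₀)) (by positivity : 0 ≤ ε / d) (by linarith : 0 ≤ 1 - ε / d) (by ring)
  have h3 : (ε / d) • ψ w + (1 - ε / d) • ψ w₀ = ψ w₀ + (ε / d) • (ψ w - ψ w₀) := by module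
  rw [h3] at h2
  simp only [smul_eq_mul, zero_div, zero_mul, mul_zero, add_zero] at h2
  have h4 := hψ w (ψ w₀)
  have h5 : 0 < ε / d := by positivity
  nlinarith

/-- A family of nonnegative convex functions that vanish at the origin and grow at least
quadratically becomes `‖y‖ ^ 2` after rescaling on rays. -/
theorem exists_radial_homeomorph {W E : Type*} [TopologicalSpace W] [NormedAddCommGroup E]
    [NormedSpace ℝ E] {g : W → E → ℝ} {c : ℝ} (hc : 0 < c)
    (hcont : Continuous fun p : W × E => g p.1 p.2) (h0 : ∀ w, g w 0 = 0)
    (hconv : ∀ w, ConvexOn ℝ univ (g w)) (hge : ∀ w v, c * ‖v‖ ^ 2 ≤ g w v) :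
    ∃ Θ : W × E ≃ₜ W × E, ∀ w y, (Θ (w, y)).1 = w ∧
      (∃ t : ℝ, 0 < t ∧ (Θ (w, y)).2 = t • y) ∧ g w (Θ (w, y)).2 = ‖y‖ ^ 2 := by
  have hmono : ∀ w (v : E), v ≠ 0 → ∀ s t : ℝ, 0 ≤ s → s < t → g w (s • v) < g w (t • v) := by
    intro w v hv s t hs hst
    have ht : 0 < t := hs.trans_lt hst
    have hle : s / t < 1 := (div_lt_one ht).2 hst
    have h := (hconv w).2 (mem_univ (t • v)) (mem_univ (0 : E)) (by positivity : 0 ≤ s / t)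
      (by linarith : 0 ≤ 1 - s / t) (by ring)
    have e : (s / t) • t • v + (1 - s / t) • (0 : E) = s • v := by
      rw [smul_zero, add_zero, smul_smul, div_mul_cancel₀ _ ht.ne']
    rw [e, h0] at h
    simp only [smul_eq_mul, mul_zero, add_zero] at h
    have hpos : 0 < g w (t • v) := by
      refine lt_of_lt_of_le ?_ (hge w (t • v))
      have : 0 < ‖t • v‖ := norm_pos_iff.2 (smul_ne_zero ht.ne' hv)
      positivity
    nlinarith
  have hinj : ∀ w (v : E), v ≠ 0 → ∀ s t : ℝ, 0 ≤ s → 0 ≤ t → g w (s • v) = g w (t • v) →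
      s = t := by
    intro w v hv s t hs ht h
    rcases lt_trichotomy s t with h' | h' | h'
    · exact absurd h (hmono w v hv s t hs h').ne
    · exact h'
    · exact absurd h (hmono w v hv t s ht h').ne'
  have hex : ∀ w (y : E), ∃ t : ℝ, 0 < t ∧ g w (t • y) = ‖y‖ ^ 2 := by
    intro w y
    by_cases hy : y = 0
    · exact ⟨1, one_pos, by simp [hy, h0]⟩
    have hypos : 0 < ‖y‖ := norm_pos_iff.2 hy
    have hcy : Continuous fun t : ℝ => g w (t • y) :=
      hcont.comp (by fun_prop : Continuous fun t : ℝ => (w, t • y))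
    -- At `t = (√c)⁻¹` the quadratic lower bound already gives the value `‖y‖ ^ 2`, so the
    -- intermediate value theorem applies on `[0, (√c)⁻¹]`.
    have hT : (0 : ℝ) ≤ (Real.sqrt c)⁻¹ := by positivity
    have hmem : ‖y‖ ^ 2 ∈ Icc (g w ((0 : ℝ) • y)) (g w ((Real.sqrt c)⁻¹ • y)) := by
      constructor
      · rw [zero_smul, h0]; positivity
      · refine le_trans (le_of_eq ?_) (hge w _)
        rw [norm_smul, mul_pow, Real.norm_of_nonneg hT, inv_pow, Real.sq_sqrt hc.le]
        field_simp
    obtain ⟨t, ht, hty⟩ := intermediate_value_Icc hT hcy.continuousOn hmem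
    refine ⟨t, lt_of_le_of_ne ht.1 ?_, hty⟩
    rintro rfl
    simp only [zero_smul, h0] at hty
    have : 0 < ‖y‖ ^ 2 := by positivity
    linarith
  choose σ hσpos hσ using hex
  have hnonneg : ∀ w v, 0 ≤ g w v := fun w v => le_trans (by positivity) (hge w v)
  -- The inverse is explicit: it moves `v` along its ray to norm `√(g w v)`. At `v = 0` the division
  -- by zero is harmless, since the scalar multiplies the zero vector.
  let inv : W × E → W × E := fun p => (p.1, (Real.sqrt (g p.1 p.2) / ‖p.2‖) • p.2)
  have hinvnorm : ∀ p : W × E, ‖(inv p).2‖ = Real.sqrt (g p.1 p.2) := by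
    intro p
    by_cases hp : p.2 = 0
    · simp [inv, hp, h0]
    · have : 0 < ‖p.2‖ := norm_pos_iff.2 hp
      simp only [inv]
      rw [norm_smul, Real.norm_of_nonneg (by positivity)]
      field_simp
  refine ⟨{ toFun := fun p => (p.1, σ p.1 p.2 • p.2)
            invFun := inv
            left_inv := ?_
            right_inv := ?_
            continuous_toFun := ?_
            continuous_invFun := ?_ }, fun w y => ⟨rfl, ⟨σ w y, hσpos w y, rfl⟩, hσ w y⟩⟩
  · rintro ⟨w, y⟩
    by_cases hy : y = 0
    · simp [inv, hy]
    have hypos : 0 < ‖y‖ := norm_pos_iff.2 hy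
    have hp := hσpos w y
    simp only [inv, hσ, Prod.mk.injEq, true_and]
    rw [Real.sqrt_sq hypos.le, norm_smul, Real.norm_of_nonneg hp.le, smul_smul]
    have : ‖y‖ / (σ w y * ‖y‖) * σ w y = 1 := by field_simp
    rw [this, one_smul]
  · rintro ⟨w, v⟩
    by_cases hv : v = 0
    · simp [inv, hv]
    have hvpos : 0 < ‖v‖ := norm_pos_iff.2 hv
    have hgpos : 0 < g w v := lt_of_lt_of_le (by positivity) (hge w v)
    have hspos : 0 < Real.sqrt (g w v) := Real.sqrt_pos.2 hgpos
    simp only [inv, Prod.mk.injEq, true_and]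
    set y : E := (Real.sqrt (g w v) / ‖v‖) • v with hy
    have h1 : ‖y‖ = Real.sqrt (g w v) := hinvnorm (w, v)
    have h2 : g w (σ w y • y) = g w v := by rw [hσ, h1, Real.sq_sqrt hgpos.le]
    have h3 : σ w y • y = (σ w y * (Real.sqrt (g w v) / ‖v‖)) • v := by rw [hy, smul_smul]
    have hp := hσpos w y
    have h4 : σ w y * (Real.sqrt (g w v) / ‖v‖) = 1 :=
      hinj w v hv _ _ (by positivity) zero_le_one (by rw [← h3, h2, one_smul])
    rw [h3, h4, one_smul]
  · refine continuous_fst.prodMk (continuous_iff_continuousAt.2 ?_)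
    rintro ⟨w₀, y₀⟩
    by_cases hy : y₀ = 0
    · subst hy
      have hb : ∀ p : W × E, ‖σ p.1 p.2 • p.2‖ ≤ (Real.sqrt c)⁻¹ * ‖p.2‖ := by
        intro p
        have h := (hge p.1 (σ p.1 p.2 • p.2)).trans_eq (hσ p.1 p.2)
        have hcpos := Real.sqrt_pos.2 hc
        rw [inv_mul_eq_div, le_div_iff₀ hcpos]
        refine le_of_sq_le_sq ?_ (norm_nonneg _)
        rw [mul_pow, Real.sq_sqrt hc.le]
        linarith
      rw [ContinuousAt, smul_zero]
      refine squeeze_zero_norm hb ?_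
      have := ((by fun_prop : Continuous fun p : W × E => (Real.sqrt c)⁻¹ * ‖p.2‖).tendsto
        (w₀, (0 : E)))
      simpa using this
    · have hσc : ContinuousAt (fun p : W × E => σ p.1 p.2) (w₀, y₀) := by
        have hne : ∀ᶠ p : W × E in 𝓝 (w₀, y₀), p.2 ≠ 0 :=
          continuous_snd.continuousAt.eventually_ne hy
        have hcs : ∀ a : ℝ, Continuous fun p : W × E => g p.1 (a • p.2) := fun a =>
          hcont.comp (by fun_prop : Continuous fun p : W × E => (p.1, a • p.2))
        have hcn : Continuous fun p : W × E => ‖p.2‖ ^ 2 := by fun_prop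
        have hp0 := hσpos w₀ y₀
        -- By strict monotonicity on rays, `a < σ w y` amounts to `g w (a • y) < ‖y‖ ^ 2` for
        -- positive `a`, and likewise for `>`; these conditions are open in `(w, y)`.
        refine tendsto_order.2 ⟨fun a ha => ?_, fun a ha => ?_⟩
        · rcases le_or_gt a 0 with h | h
          · exact Eventually.of_forall fun p => h.trans_lt (hσpos _ _)
          · have hlt : g w₀ (a • y₀) < ‖y₀‖ ^ 2 := by
              rw [← hσ w₀ y₀]; exact hmono _ _ hy _ _ h.le ha
            filter_upwards [hne, ((hcs a).tendsto (w₀, y₀)).eventually_lt (hcn.tendsto (w₀, y₀)) hlt]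
              with p hp1 hp2
            by_contra hcon
            push Not at hcon
            rw [← hσ p.1 p.2] at hp2
            rcases hcon.lt_or_eq with h' | h'
            · exact absurd (hmono p.1 p.2 hp1 _ _ (hσpos _ _).le h') hp2.not_gt
            · rw [h'] at hp2; exact lt_irrefl _ hp2
        · have hlt : ‖y₀‖ ^ 2 < g w₀ (a • y₀) := by
            rw [← hσ w₀ y₀]; exact hmono _ _ hy _ _ hp0.le ha
          filter_upwards [hne, (hcn.tendsto (w₀, y₀)).eventually_lt ((hcs a).tendsto (w₀, y₀)) hlt]
            with p hp1 hp2
          by_contra hcon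
          push Not at hcon
          rw [← hσ p.1 p.2] at hp2
          rcases hcon.lt_or_eq with h' | h'
          · exact absurd (hmono p.1 p.2 hp1 _ _ (hp0.trans ha).le h') hp2.not_gt
          · rw [h'] at hp2; exact lt_irrefl _ hp2
      exact hσc.smul continuous_snd.continuousAt
  · refine continuous_fst.prodMk (continuous_iff_continuousAt.2 ?_)
    rintro ⟨w₀, v₀⟩
    by_cases hv : v₀ = 0
    · subst hv
      have h1 : Tendsto (fun p : W × E => Real.sqrt (g p.1 p.2)) (𝓝 (w₀, 0)) (𝓝 0) := by
        have := (Real.continuous_sqrt.comp hcont).tendsto (w₀, (0 : E))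
        simpa [h0, Function.comp_def] using this
      rw [ContinuousAt, smul_zero]
      exact squeeze_zero_norm (fun p => (hinvnorm p).le) h1
    · exact (((Real.continuous_sqrt.comp hcont).continuousAt).div
        continuous_snd.norm.continuousAt (norm_ne_zero_iff.2 hv)).smul continuous_snd.continuousAt

/-- A parametrized function that is convex in the first and strongly concave in the second
variable, with a saddle point at the origin, becomes `‖u‖ ^ 2 - ‖v‖ ^ 2` after a homeomorphic
change of variables. -/
theorem exists_saddle_homeomorph {Z E G : Type*} [TopologicalSpace Z] [NormedAddCommGroup E]
    [NormedSpace ℝ E] [NormedAddCommGroup G] [NormedSpace ℝ G] [FiniteDimensional ℝ G]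
    {J : Z → E → G → ℝ} {c : ℝ} (hc : 0 < c)
    (hcont : Continuous fun p : (Z × E) × G => J p.1.1 p.1.2 p.2)
    (hconv : ∀ z v, ConvexOn ℝ univ fun u => J z u v)
    (hconc : ∀ z u, StrongConcaveOn univ (2 * c) (J z u))
    (h0 : ∀ z, J z 0 0 = 0) (hpos : ∀ z u, c * ‖u‖ ^ 2 ≤ J z u 0) (hneg : ∀ z v, J z 0 v ≤ 0) :
    ∃ Θ : (Z × E) × G ≃ₜ (Z × E) × G, ∀ z u v,
      (Θ ((z, u), v)).1.1 = z ∧ (∃ t : ℝ, 0 < t ∧ (Θ ((z, u), v)).1.2 = t • u) ∧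
      J z (Θ ((z, u), v)).1.2 (Θ ((z, u), v)).2 = ‖u‖ ^ 2 - ‖v‖ ^ 2 ∧
      (u = 0 → v = 0 → (Θ ((z, u), v)).2 = 0) := by
  have hcJ : ∀ z u, Continuous (J z u) := fun z u =>
    hcont.comp (by fun_prop : Continuous fun v : G => ((z, u), v))
  choose ψ hψ using fun w : Z × E =>
    exists_isMax_of_strongConcaveOn hc (hconc w.1 w.2) (hcJ w.1 w.2)
  have hψc : Continuous ψ :=
    continuous_argmax_of_strongConcaveOn hc (fun w : Z × E => hconc w.1 w.2) hcont hψ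
  have hψ0 : ∀ z, ψ (z, 0) = 0 := by
    intro z
    have h1 := add_le_of_strongConcaveOn_of_isMax (hconc z 0) (x := 0)
      (fun y => by rw [h0]; exact hneg z y) (ψ (z, 0))
    have h2 := hψ (z, 0) 0
    simp only [sub_zero] at h1
    have h3 : c * ‖ψ (z, 0)‖ ^ 2 ≤ 0 := by linarith
    have h4 : ‖ψ (z, 0)‖ ^ 2 ≤ 0 := by
      by_contra hcon
      push Not at hcon
      have := mul_pos hc hcon
      linarith
    exact norm_eq_zero.1 (pow_eq_zero_iff two_ne_zero |>.1 (le_antisymm h4 (by positivity)))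
  have hmc : Continuous fun p : Z × E => J p.1 p.2 (ψ p) :=
    hcont.comp (by fun_prop : Continuous fun p : Z × E => (p, ψ p))
  -- The partial maximum `u ↦ J z u (ψ (z, u))` is convex as a supremum of convex functions, and it
  -- dominates `J z u 0`.
  obtain ⟨Θ₁, hΘ₁⟩ := exists_radial_homeomorph (g := fun z u => J z u (ψ (z, u))) hc hmc
    (fun z => by simp only [hψ0, h0])
    (fun z => ⟨convex_univ, fun u _ u' _ a b ha hb hab => by
      have h := (hconv z (ψ (z, a • u + b • u'))).2 (mem_univ u) (mem_univ u') ha hb hab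
      have h1 := mul_le_mul_of_nonneg_left (hψ (z, u) (ψ (z, a • u + b • u'))) ha
      have h2 := mul_le_mul_of_nonneg_left (hψ (z, u') (ψ (z, a • u + b • u'))) hb
      simp only [smul_eq_mul] at h ⊢
      linarith⟩)
    (fun z u => (hpos z u).trans (hψ (z, u) 0))
  -- The drop below the maximum is convex in `v`, with quadratic growth by strong concavity. Here
  -- the pair `(z, u)` serves as the parameter, so the rescaling of `v` may depend on the new `u`.
  obtain ⟨Θ₂, hΘ₂⟩ := exists_radial_homeomorph
    (g := fun (w : Z × E) v => J w.1 w.2 (ψ w) - J w.1 w.2 (ψ w + v)) hc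
    ((hmc.comp continuous_fst).sub
      (hcont.comp (by fun_prop : Continuous fun p : (Z × E) × G => (p.1, ψ p.1 + p.2))))
    (fun w => by simp)
    (fun w => ⟨convex_univ, fun v _ v' _ a b ha hb hab => by
      have h := ((hconc w.1 w.2).mono (by positivity : (0 : ℝ) ≤ 2 * c)).2
        (mem_univ (ψ w + v)) (mem_univ (ψ w + v')) ha hb hab
      have e : a • (ψ w + v) + b • (ψ w + v') = ψ w + (a • v + b • v') := by
        have : b = 1 - a := by linarith
        subst this
        module
      rw [e] at h
      simp only [smul_eq_mul, zero_div, zero_mul, mul_zero, add_zero] at h ⊢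
      have e2 : J w.1 w.2 (ψ w) = a * J w.1 w.2 (ψ w) + b * J w.1 w.2 (ψ w) := by
        rw [← add_mul, hab, one_mul]
      linarith⟩)
    (fun w v => by
      have := add_le_of_strongConcaveOn_of_isMax (hconc w.1 w.2) (hψ w) (ψ w + v)
      rwa [add_sub_cancel_left] at this)
  let Sh : (Z × E) × G ≃ₜ (Z × E) × G :=
    { toFun := fun p => (p.1, ψ p.1 + p.2)
      invFun := fun p => (p.1, p.2 - ψ p.1)
      left_inv := fun p => by simp
      right_inv := fun p => by simp
      continuous_toFun := by fun_prop
      continuous_invFun := by fun_prop }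
  refine ⟨((Θ₁.prodCongr (Homeomorph.refl G)).trans Θ₂).trans Sh, fun z u v => ?_⟩
  obtain ⟨a1, ⟨t, ht, a2⟩, a3⟩ := hΘ₁ z u
  obtain ⟨b1, ⟨s, hs, b2⟩, b3⟩ := hΘ₂ (Θ₁ (z, u)) v
  have e : ((((Θ₁.prodCongr (Homeomorph.refl G)).trans Θ₂).trans Sh) ((z, u), v)) =
      (Θ₁ (z, u), ψ (Θ₁ (z, u)) + (Θ₂ (Θ₁ (z, u), v)).2) := by
    change ((Θ₂ (Θ₁ (z, u), v)).1, ψ (Θ₂ (Θ₁ (z, u), v)).1 + (Θ₂ (Θ₁ (z, u), v)).2) = _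
    rw [b1]
  rw [e]
  have a4 : Θ₁ (z, u) = (z, (Θ₁ (z, u)).2) := Prod.ext a1 rfl
  refine ⟨a1, ⟨t, ht, a2⟩, ?_, ?_⟩
  · simp only [a1] at b3
    rw [← a4] at a3
    simp only
    linarith
  · rintro rfl rfl
    have : Θ₁ (z, 0) = (z, 0) := by rw [a4, a2, smul_zero]
    rw [this, smul_zero] at b2
    simp [b2, this, hψ0]

end Saddle

end SplitInf

namespace SplitInf

/-! ### Calculus -/

section Calculus

/-- A function on the line whose derivative grows at least with the slope `c` is strongly
convex. -/
theorem le_of_deriv_growth {f f' : ℝ → ℝ} {c : ℝ} (hf : ∀ t, HasDerivAt f (f' t) t)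
    (hmono : ∀ s t, s ≤ t → c * (t - s) ≤ f' t - f' s) {a b : ℝ} (ha : 0 ≤ a) (hb : 0 ≤ b)
    (hab : a + b = 1) : f b ≤ a * f 0 + b * f 1 - a * b * (c / 2) := by
  -- Subtracting `c / 2 * t ^ 2` leaves a monotone derivative, hence a convex function.
  have hg : ∀ t, HasDerivAt (fun t => f t - c / 2 * t ^ 2) (f' t - c * t) t := by
    intro t
    have := (hf t).sub (((hasDerivAt_id t).pow 2).const_mul (c / 2))
    refine this.congr_deriv ?_
    simp
    ring
  have hconv : ConvexOn ℝ univ (fun t => f t - c / 2 * t ^ 2) := by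
    refine MonotoneOn.convexOn_of_deriv convex_univ
      (fun t _ => (hg t).continuousAt.continuousWithinAt)
      (fun t _ => (hg t).differentiableAt.differentiableWithinAt) ?_
    intro s _ t _ hst
    rw [(hg s).deriv, (hg t).deriv]
    have := hmono s t hst
    linarith
  have h := hconv.2 (mem_univ 0) (mem_univ 1) ha hb hab
  simp only [smul_eq_mul] at h
  have e : a * 0 + b * 1 = b := by ring
  rw [e] at h
  have : a = 1 - b := by linarith
  subst this
  nlinarith

theorem add_le_of_deriv_growth {f f' : ℝ → ℝ} {c : ℝ} (hf : ∀ t, HasDerivAt f (f' t) t)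
    (hmono : ∀ s t, s ≤ t → c * (t - s) ≤ f' t - f' s) (h0 : f' 0 = 0) : f 0 + c / 2 ≤ f 1 := by
  have hg : ∀ t, HasDerivAt (fun t => f t - c / 2 * t ^ 2) (f' t - c * t) t := by
    intro t
    have := (hf t).sub (((hasDerivAt_id t).pow 2).const_mul (c / 2))
    refine this.congr_deriv ?_
    simp
    ring
  have hm : MonotoneOn (fun t => f t - c / 2 * t ^ 2) (Icc 0 1) := by
    refine monotoneOn_of_deriv_nonneg (convex_Icc 0 1)
      (fun t _ => (hg t).continuousAt.continuousWithinAt)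
      (fun t _ => (hg t).differentiableAt.differentiableWithinAt) ?_
    intro t ht
    rw [interior_Icc] at ht
    rw [(hg t).deriv]
    have := hmono 0 t ht.1.le
    rw [h0] at this
    linarith
  have := hm (left_mem_Icc.2 zero_le_one) (right_mem_Icc.2 zero_le_one) zero_le_one
  simp only at this
  linarith

variable {E F : Type*} [NormedAddCommGroup E] [NormedSpace ℝ E]
  [NormedAddCommGroup F] [NormedSpace ℝ F]

theorem hasDerivAt_line {f : E → F} {x u : E} {t : ℝ}
    (h : LineDifferentiableAt ℝ f (x + t • u) u) :
    HasDerivAt (fun s : ℝ => f (x + s • u)) (lineDeriv ℝ f (x + t • u) u) t := by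
  have h1 := h.hasLineDerivAt
  unfold HasLineDerivAt at h1
  have h2 : HasDerivAt (fun s : ℝ => s - t) 1 t := (hasDerivAt_id t).sub_const t
  have h3 := HasDerivAt.scomp (h := fun s : ℝ => s - t) t (by simpa using h1) h2
  rw [one_smul] at h3
  refine h3.congr_of_eventuallyEq (Eventually.of_forall fun s => ?_)
  simp only [Function.comp]
  congr 1
  module

/-- The mean value inequality for `t ↦ f (x + t • u) - t • y` on `[0, 1]`. It needs the derivative
in the single direction `u` only, so it suits directional differentiability. -/
theorem norm_add_sub_sub_le {f : E → F} {x u : E} {y : F} {C : ℝ}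
    (hf : ∀ t ∈ Icc (0 : ℝ) 1, LineDifferentiableAt ℝ f (x + t • u) u)
    (hC : ∀ t ∈ Icc (0 : ℝ) 1, ‖lineDeriv ℝ f (x + t • u) u - y‖ ≤ C) :
    ‖f (x + u) - f x - y‖ ≤ C := by
  have h := norm_image_sub_le_of_norm_deriv_le_segment_01' (f := fun t : ℝ => f (x + t • u) - t • y)
    (f' := fun t => lineDeriv ℝ f (x + t • u) u - y) (C := C)
    (fun t ht => by
      have := (hasDerivAt_line (hf t ht)).sub ((hasDerivAt_id t).smul_const y)
      rw [one_smul] at this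
      exact this.hasDerivWithinAt)
    (fun t ht => hC t (Ico_subset_Icc_self ht))
  simp only [one_smul, zero_smul, add_zero, sub_zero] at h
  rwa [sub_right_comm] at h

/-- Compactness of `[0, 1]` lets a whole short segment stay in the neighborhood, uniformly in its
starting point near `x₀`. -/
theorem eventually_segment_mem {W : Type*} [NormedAddCommGroup W] [NormedSpace ℝ W]
    (ℓ : W →L[ℝ] E) {N : Set E} {x₀ : E} (hN : N ∈ 𝓝 x₀) :
    ∀ᶠ p : E × W in 𝓝 (x₀, 0), ∀ t ∈ Icc (0 : ℝ) 1, p.1 + t • ℓ p.2 ∈ N := by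
  refine isCompact_Icc.eventually_forall_of_forall_eventually fun t _ => ?_
  have hc : Continuous fun q : (E × W) × ℝ => q.1.1 + q.2 • ℓ q.1.2 := by fun_prop
  refine hc.continuousAt.eventually ?_
  simpa using hN

/-- On finite-dimensional subspaces a continuously directional differentiable map is strictly
Fréchet differentiable. -/
theorem ContDirDiffOn.eventually_norm_le {f : E → F} {U : Set E} (hf : ContDirDiffOn f U)
    (hU : IsOpen U) {W : Type*} [NormedAddCommGroup W] [NormedSpace ℝ W] [FiniteDimensional ℝ W]
    (ℓ : W →L[ℝ] E) {x₀ : E} (hx₀ : x₀ ∈ U) {ε : ℝ} (hε : 0 < ε) :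
    ∀ᶠ p : E × W in 𝓝 (x₀, 0),
      ‖f (p.1 + ℓ p.2) - f p.1 - lineDeriv ℝ f x₀ (ℓ p.2)‖ ≤ ε * ‖p.2‖ := by
  have hcont : ∀ u, ContinuousAt (fun p : E × E => lineDeriv ℝ f p.1 p.2) (x₀, u) := fun u =>
    hf.2.2.continuousAt ((hU.prod isOpen_univ).mem_nhds ⟨hx₀, mem_univ _⟩)
  have hS : IsCompact (Metric.sphere (0 : W) 1) := isCompact_sphere _ _
  -- Joint continuity becomes uniform over the compact unit sphere of `W`, the only place where
  -- finite dimension enters. Homogeneity of the directional derivative then gives the bound for all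
  -- directions.
  have h1 : ∀ᶠ x in 𝓝 x₀, ∀ s ∈ Metric.sphere (0 : W) 1,
      ‖lineDeriv ℝ f x (ℓ s) - lineDeriv ℝ f x₀ (ℓ s)‖ < ε := by
    refine hS.eventually_forall_of_forall_eventually fun s _ => ?_
    have a1 : ContinuousAt (fun q : E × W => lineDeriv ℝ f q.1 (ℓ q.2)) (x₀, s) :=
      ContinuousAt.comp (g := fun p : E × E => lineDeriv ℝ f p.1 p.2)
        (f := fun q : E × W => (q.1, ℓ q.2)) (hcont (ℓ s)) (by fun_prop)
    have a2 : ContinuousAt (fun q : E × W => lineDeriv ℝ f x₀ (ℓ q.2)) (x₀, s) :=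
      ContinuousAt.comp (g := fun p : E × E => lineDeriv ℝ f p.1 p.2)
        (f := fun q : E × W => (x₀, ℓ q.2)) (hcont (ℓ s)) (by fun_prop)
    have a3 := (a1.sub a2).norm
    refine a3.eventually_lt continuousAt_const ?_
    simpa using hε
  filter_upwards [eventually_segment_mem ℓ (inter_mem (hU.mem_nhds hx₀) h1)] with p hp
  refine norm_add_sub_sub_le (fun t ht => hf.2.1 _ (hp t ht).1 _) fun t ht => ?_
  by_cases h0 : p.2 = 0
  · simp [h0, lineDeriv_zero]
  have hn : 0 < ‖p.2‖ := norm_pos_iff.2 h0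
  have h2 := (hp t ht).2 (‖p.2‖⁻¹ • p.2) (by simp [norm_smul, hn.ne'])
  rw [map_smul, lineDeriv_smul, lineDeriv_smul, ← smul_sub, norm_smul, norm_inv, norm_norm,
    inv_mul_lt_iff₀ hn] at h2
  linarith [mul_comm ε ‖p.2‖]

/-- A continuously directional differentiable map is locally Lipschitz. -/
theorem ContDirDiffOn.eventually_lipschitz {f : E → F} {U : Set E} (hf : ContDirDiffOn f U)
    (hU : IsOpen U) {x₀ : E} (hx₀ : x₀ ∈ U) :
    ∃ K : ℝ, 0 < K ∧ ∀ᶠ p : E × E in 𝓝 (x₀, x₀), ‖f p.1 - f p.2‖ ≤ K * ‖p.1 - p.2‖ := by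
  have hcont : ContinuousAt (fun p : E × E => lineDeriv ℝ f p.1 p.2) (x₀, 0) :=
    hf.2.2.continuousAt ((hU.prod isOpen_univ).mem_nhds ⟨hx₀, mem_univ _⟩)
  have h1 : ∀ᶠ p : E × E in 𝓝 (x₀, 0), ‖lineDeriv ℝ f p.1 p.2‖ < 1 :=
    hcont.norm.eventually_lt continuousAt_const (by simp [lineDeriv_zero])
  rw [nhds_prod_eq] at h1
  obtain ⟨N, hN, M, hM, hNM⟩ := Filter.eventually_prod_iff.1 h1
  obtain ⟨δ, hδ, hball⟩ := Metric.eventually_nhds_iff.1 hM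
  -- Continuity at `(x₀, 0)` bounds the directional derivative by `1` for directions shorter than
  -- `δ`; scaling by homogeneity turns this into the constant `2 / δ`.
  have hbound : ∀ x, N x → ∀ u, ‖lineDeriv ℝ f x u‖ ≤ 2 / δ * ‖u‖ := by
    intro x hx u
    by_cases hu : u = 0
    · simp [hu, lineDeriv_zero]
    have hn : 0 < ‖u‖ := norm_pos_iff.2 hu
    have hs : M ((δ / 2 / ‖u‖) • u) := hball (by
      rw [dist_zero_right, norm_smul, Real.norm_of_nonneg (by positivity)]
      field_simp
      norm_num)
    have h2 := (hNM hx hs).le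
    simp only at h2
    rw [lineDeriv_smul, norm_smul, Real.norm_of_nonneg (by positivity)] at h2
    have h3 : ‖lineDeriv ℝ f x u‖ = 2 / δ * ‖u‖ * (δ / 2 / ‖u‖ * ‖lineDeriv ℝ f x u‖) := by
      field_simp
    rw [h3]
    exact mul_le_of_le_one_right (by positivity) h2
  refine ⟨2 / δ, by positivity, ?_⟩
  have hseg := eventually_segment_mem (ContinuousLinearMap.id ℝ E)
    (inter_mem (hU.mem_nhds hx₀) hN)
  have hmap : Tendsto (fun p : E × E => (p.2, p.1 - p.2)) (𝓝 (x₀, x₀)) (𝓝 (x₀, 0)) := by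
    have : Continuous fun p : E × E => (p.2, p.1 - p.2) := by fun_prop
    simpa using this.tendsto (x₀, x₀)
  filter_upwards [hmap.eventually hseg] with p hp
  have h := norm_add_sub_sub_le (f := f) (x := p.2) (u := p.1 - p.2) (y := 0)
    (C := 2 / δ * ‖p.1 - p.2‖) (fun t ht => hf.2.1 _ (hp t ht).1 _)
    (fun t ht => by rw [sub_zero]; exact hbound _ (hp t ht).2 _)
  simpa using h

/-- A function with a continuous Gateaux differential is Fréchet differentiable. -/
theorem hasFDerivAt_of_hasLineDerivAt {f : E → F} {g : E → E →L[ℝ] F} {U : Set E}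
    (hU : IsOpen U) (hg : ContinuousOn g U) (hf : ∀ x ∈ U, ∀ u, HasLineDerivAt ℝ f (g x u) x u)
    {x₀ : E} (hx₀ : x₀ ∈ U) : HasFDerivAt f (g x₀) x₀ := by
  rw [hasFDerivAt_iff_isLittleO_nhds_zero, Asymptotics.isLittleO_iff]
  intro ε hε
  have h1 : ∀ᶠ x in 𝓝 x₀, ‖g x - g x₀‖ < ε :=
    ((hg.continuousAt (hU.mem_nhds hx₀)).sub continuousAt_const).norm.eventually_lt
      continuousAt_const (by simpa using hε)
  have hseg := eventually_segment_mem (ContinuousLinearMap.id ℝ E)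
    (inter_mem (hU.mem_nhds hx₀) h1)
  have hmap : Tendsto (fun u : E => (x₀, u)) (𝓝 0) (𝓝 (x₀, 0)) :=
    (by fun_prop : Continuous fun u : E => (x₀, u)).tendsto 0
  filter_upwards [hmap.eventually hseg] with u hu
  refine norm_add_sub_sub_le (fun t ht => (hf _ (hu t ht).1 _).lineDifferentiableAt)
    fun t ht => ?_
  have h2 := (hf _ (hu t ht).1 u).lineDeriv
  simp only [ContinuousLinearMap.coe_id', id_eq] at h2
  rw [h2, ← sub_apply]
  exact (ContinuousLinearMap.le_opNorm _ _).trans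
    (mul_le_mul_of_nonneg_right (hu t ht).2.le (norm_nonneg _))

/-- Strict differentiability on an open set is continuous differentiability. -/
theorem contDiffOn_one_of_hasStrictFDerivAt {f : E → F} {f' : E → E →L[ℝ] F} {U : Set E}
    (hU : IsOpen U) (hf : ∀ x ∈ U, HasStrictFDerivAt f (f' x) x) : ContDiffOn ℝ 1 f U := by
  have hcont : ContinuousOn f' U := by
    intro x hx
    refine ContinuousAt.continuousWithinAt ?_
    rw [ContinuousAt, Metric.tendsto_nhds]
    intro ε hε
    obtain ⟨s, hs, hlip⟩ := (hf x hx).approximates_deriv_on_nhds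
      (c := (ε / 2).toNNReal) (Or.inr (by simpa using hε))
    have h2 : ∀ᶠ y in 𝓝 x, s ∈ 𝓝 y := eventually_mem_nhds_iff.2 hs
    filter_upwards [h2, hU.mem_nhds hx] with y hy hyU
    have h3 : HasFDerivAt (f - ⇑(f' x)) (f' y - f' x) y :=
      (hf y hyU).hasFDerivAt.sub (f' x).hasFDerivAt
    have h4 := h3.le_of_lipschitzOn hy hlip.lipschitzOnWith
    rw [dist_eq_norm]
    rw [Real.coe_toNNReal _ (by positivity)] at h4
    linarith
  rw [← zero_add (1 : WithTop ℕ∞), contDiffOn_succ_iff_fderiv_of_isOpen hU]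
  exact ⟨fun x hx => (hf x hx).hasFDerivAt.differentiableAt.differentiableWithinAt, by simp,
    contDiffOn_zero.2 (hcont.congr fun x hx => (hf x hx).hasFDerivAt.fderiv)⟩

/-- A map whose derivative tends to zero at infinity has the strict Fréchet derivative zero at
infinity. -/
theorem hasStrictDerivAtInfinity_zero [FiniteDimensional ℝ E] {f : E → F} {f' : E → E →L[ℝ] F}
    {R₀ : ℝ} (hf : ∀ z, R₀ ≤ ‖z‖ → HasFDerivAt f (f' z) z)
    (hlim : ∀ ε : ℝ, 0 < ε → ∃ R : ℝ, ∀ z, R ≤ ‖z‖ → R₀ ≤ ‖z‖ → ‖f' z‖ ≤ ε) (s : Set E) :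
    HasStrictDerivAtInfinity f 0 s := by
  intro ε hε
  obtain ⟨R, hR⟩ := hlim (ε / 4) (by positivity)
  set R₁ : ℝ := max 1 (max R₀ R)
  have h1 : 1 ≤ R₁ := le_max_left _ _
  have h0R : R₀ ≤ R₁ := (le_max_left _ _).trans (le_max_right _ _)
  have hRR : R ≤ R₁ := (le_max_right _ _).trans (le_max_right _ _)
  have hseg : ∀ z₁ z₂ : E, (∀ p ∈ segment ℝ z₁ z₂, R₁ ≤ ‖p‖) →
      ‖f z₁ - f z₂‖ ≤ ε / 4 * ‖z₁ - z₂‖ := by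
    intro z₁ z₂ hp
    exact (convex_segment z₁ z₂).norm_image_sub_le_of_norm_hasFDerivWithin_le
      (fun p hp' => (hf p (h0R.trans (hp p hp'))).hasFDerivWithinAt)
      (fun p hp' => hR p (hRR.trans (hp p hp')) (h0R.trans (hp p hp')))
      (right_mem_segment ℝ z₁ z₂) (left_mem_segment ℝ z₁ z₂)
  obtain ⟨C, hC⟩ := (isCompact_sphere (0 : E) R₁).exists_bound_of_continuousOn
    (f := f) (fun z hz => (hf z (by
      rw [mem_sphere_zero_iff_norm] at hz; rw [hz]; exact h0R)).continuousAt.continuousWithinAt)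
  -- Moving radially to the sphere of radius `R₁` stays in the exterior, so `f` grows at most like
  -- `ε / 4 * ‖z‖` plus its bound on that sphere.
  have hray : ∀ z : E, R₁ ≤ ‖z‖ → ‖f z‖ ≤ ε / 4 * ‖z‖ + C := by
    intro z hz
    have hzpos : 0 < ‖z‖ := by linarith
    have hq : R₁ / ‖z‖ ≤ 1 := (div_le_one hzpos).2 hz
    have hw : ‖(R₁ / ‖z‖) • z‖ = R₁ := by
      rw [norm_smul, Real.norm_of_nonneg (by positivity)]; field_simp
    have a1 := hseg z ((R₁ / ‖z‖) • z) (by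
      rintro p ⟨a, b, ha, hb, hab, rfl⟩
      rw [smul_smul, ← add_smul, norm_smul, Real.norm_of_nonneg (by positivity), add_mul, mul_assoc,
        div_mul_cancel₀ _ hzpos.ne']
      calc R₁ = a * R₁ + b * R₁ := by rw [← add_mul, hab, one_mul]
        _ ≤ a * ‖z‖ + b * R₁ := by gcongr)
    have a2 := hC ((R₁ / ‖z‖) • z) (by simpa using hw)
    have a3 : ‖z - (R₁ / ‖z‖) • z‖ ≤ ‖z‖ := by
      have : z - (R₁ / ‖z‖) • z = (1 - R₁ / ‖z‖) • z := by module
      rw [this, norm_smul, Real.norm_of_nonneg (by linarith)]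
      have : 0 ≤ R₁ / ‖z‖ := by positivity
      nlinarith
    have a4 : ‖f z‖ ≤ ‖f z - f ((R₁ / ‖z‖) • z)‖ + ‖f ((R₁ / ‖z‖) • z)‖ := by
      simpa using norm_add_le (f z - f ((R₁ / ‖z‖) • z)) (f ((R₁ / ‖z‖) • z))
    have a5 : ε / 4 * ‖z - (R₁ / ‖z‖) • z‖ ≤ ε / 4 * ‖z‖ := by gcongr
    linarith
  refine ⟨max (4 * R₁) (4 * C / ε), fun z₁ _ z₂ _ hz₁ hz₂ => ?_⟩
  have b1 : 4 * R₁ ≤ ‖z₁‖ := (le_max_left _ _).trans hz₁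
  have b2 : 4 * R₁ ≤ ‖z₂‖ := (le_max_left _ _).trans hz₂
  have c1 : 4 * C / ε ≤ ‖z₁‖ := (le_max_right _ _).trans hz₁
  have c2 : 4 * C / ε ≤ ‖z₂‖ := (le_max_right _ _).trans hz₂
  rw [zero_apply, sub_zero]
  by_cases hcase : ∀ p ∈ segment ℝ z₁ z₂, R₁ ≤ ‖p‖
  · refine (hseg z₁ z₂ hcase).trans ?_
    gcongr
    linarith
  -- A segment that enters the small ball joins points whose distance is at least the mean of their
  -- norms, so the growth bound suffices. This also covers dimension one, where the exterior is
  -- disconnected.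
  · push Not at hcase
    obtain ⟨p, hp, hpR⟩ := hcase
    have d1 := dist_add_dist_of_mem_segment hp
    rw [dist_eq_norm, dist_eq_norm, dist_eq_norm] at d1
    have d2 : ‖z₁‖ ≤ ‖z₁ - p‖ + ‖p‖ := by simpa using norm_add_le (z₁ - p) p
    have d3 : ‖z₂‖ ≤ ‖p - z₂‖ + ‖p‖ := by
      rw [norm_sub_rev p z₂]
      simpa using norm_add_le (z₂ - p) p
    have d4 : (‖z₁‖ + ‖z₂‖) / 2 ≤ ‖z₁ - z₂‖ := by linarith
    have e1 := hray z₁ (by linarith)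
    have e2 := hray z₂ (by linarith)
    have e3 := norm_sub_le (f z₁) (f z₂)
    rw [div_le_iff₀ hε] at c1 c2
    nlinarith

end Calculus

end SplitInf

namespace SplitInf

/-! ### Self-adjoint operators that are the sum of a coercive and a compact operator -/

section Fredholm

variable {H : Type*} [NormedAddCommGroup H] [InnerProductSpace ℝ H] [CompleteSpace H]

/-- Bounded families in a Hilbert space converge weakly along ultrafilters. -/
theorem exists_weak_limit {α : Type*} (𝒰 : Ultrafilter α) {u : α → H} {C : ℝ}
    (hu : ∀ a, ‖u a‖ ≤ C) :
    ∃ w : H, ∀ v, Tendsto (fun a => ⟪u a, v⟫) 𝒰 (𝓝 ⟪w, v⟫) := by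
  let f : α → WeakDual ℝ H := fun a => StrongDual.toWeakDual (InnerProductSpace.toDual ℝ H (u a))
  have hK := WeakDual.isCompact_closedBall (𝕜 := ℝ) (0 : StrongDual ℝ H) C
  have hmem : ∀ᶠ a in (𝒰 : Filter α), f a ∈ WeakDual.toStrongDual ⁻¹' Metric.closedBall 0 C := by
    refine Eventually.of_forall fun a => ?_
    simp only [mem_preimage, mem_closedBall_zero_iff]
    exact (LinearIsometryEquiv.norm_map (InnerProductSpace.toDual ℝ H) (u a)).trans_le (hu a)
  obtain ⟨x, -, hx⟩ := hK.ultrafilter_le_nhds' (𝒰.map f) hmem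
  refine ⟨(InnerProductSpace.toDual ℝ H).symm (WeakDual.toStrongDual x), fun v => ?_⟩
  have h1 : Tendsto f 𝒰 (𝓝 x) := hx
  have h2 := ((WeakDual.eval_continuous v).tendsto x).comp h1
  rw [InnerProductSpace.toDual_symm_apply]
  exact h2

/-- A compact operator maps weakly convergent bounded families to convergent ones. -/
theorem tendsto_compact_of_weak {α : Type*} {𝒰 : Ultrafilter α} {u : α → H} {C : ℝ}
    (hu : ∀ a, ‖u a‖ ≤ C) {w : H} (hw : ∀ v, Tendsto (fun a => ⟪u a, v⟫) 𝒰 (𝓝 ⟪w, v⟫))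
    {Q : H →L[ℝ] H} (hQ : IsCompactOperator Q) :
    Tendsto (fun a => Q (u a)) 𝒰 (𝓝 (Q w)) := by
  have hK : IsCompact (closure (Q '' Metric.closedBall 0 C)) :=
    IsCompactOperator.isCompact_closure_image_closedBall (f := (Q : H →ₗ[ℝ] H)) hQ C
  have hmem : ∀ᶠ a in (𝒰 : Filter α), Q (u a) ∈ closure (Q '' Metric.closedBall 0 C) :=
    Eventually.of_forall fun a => subset_closure ⟨u a, by simpa using hu a, rfl⟩
  obtain ⟨y, -, hy⟩ := hK.ultrafilter_le_nhds' (𝒰.map fun a => Q (u a)) hmem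
  have hy' : Tendsto (fun a => Q (u a)) 𝒰 (𝓝 y) := hy
  have : y = Q w := by
    refine ext_inner_right ℝ fun v => ?_
    have h1 : Tendsto (fun a => ⟪Q (u a), v⟫) 𝒰 (𝓝 ⟪y, v⟫) := hy'.inner tendsto_const_nhds
    have h2 := hw (ContinuousLinearMap.adjoint Q v)
    simp only [ContinuousLinearMap.adjoint_inner_right] at h2
    exact tendsto_nhds_unique h1 h2
  exact this ▸ hy'

/-- `T` is the sum of a coercive and a compact operator. -/
def IsCoerciveAddCompact (T : H →L[ℝ] H) : Prop :=
  ∃ (P Q : H →L[ℝ] H) (c : ℝ), 0 < c ∧ (∀ u, c * ‖u‖ ^ 2 ≤ ⟪P u, u⟫) ∧ IsCompactOperator Q ∧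
    T = P + Q

variable {T : H →L[ℝ] H}

theorem inner_apply_comm (hT : IsSelfAdjoint T) (u v : H) : ⟪T u, v⟫ = ⟪u, T v⟫ :=
  hT.isSymmetric u v

theorem inner_self_apply_le (S : H →L[ℝ] H) (u : H) : |⟪S u, u⟫| ≤ ‖S‖ * ‖u‖ ^ 2 := by
  refine (abs_real_inner_le_norm _ _).trans ?_
  rw [pow_two, ← mul_assoc]
  exact mul_le_mul_of_nonneg_right (S.le_opNorm u) (norm_nonneg _)

theorem exists_subseq_tendsto_of_compact {Q : H →L[ℝ] H} (hQ : IsCompactOperator Q) {u : ℕ → H}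
    {C : ℝ} (hu : ∀ n, ‖u n‖ ≤ C) :
    ∃ y, ∃ φ : ℕ → ℕ, StrictMono φ ∧ Tendsto (fun n => Q (u (φ n))) atTop (𝓝 y) := by
  have hK : IsCompact (closure (Q '' Metric.closedBall 0 C)) :=
    IsCompactOperator.isCompact_closure_image_closedBall (f := (Q : H →ₗ[ℝ] H)) hQ C
  obtain ⟨y, -, φ, hφ, h⟩ := hK.tendsto_subseq (x := fun n => Q (u n))
    fun n => subset_closure ⟨u n, by simpa using hu n, rfl⟩
  exact ⟨y, φ, hφ, h⟩

/-- Approximate eigenvectors for a number `m ≤ 0` have a convergent subsequence. -/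
theorem IsCoerciveAddCompact.exists_subseq_tendsto (h : IsCoerciveAddCompact T) {m : ℝ}
    (hm : m ≤ 0) {u : ℕ → H} {C : ℝ} (hu : ∀ n, ‖u n‖ ≤ C)
    (hlim : Tendsto (fun n => T (u n) - m • u n) atTop (𝓝 0)) :
    ∃ w, ∃ φ : ℕ → ℕ, StrictMono φ ∧ Tendsto (u ∘ φ) atTop (𝓝 w) := by
  obtain ⟨P, Q, c, hc, hP, hQ, rfl⟩ := h
  obtain ⟨y, φ, hφ, hy⟩ := exists_subseq_tendsto_of_compact hQ hu
  set g : ℕ → H := fun n => P (u (φ n)) - m • u (φ n) with hg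
  have hgl : Tendsto g atTop (𝓝 (0 - y)) := by
    refine ((hlim.comp hφ.tendsto_atTop).sub hy).congr fun n => ?_
    simp only [hg, Function.comp, add_apply]
    abel
  have hcg := hgl.cauchySeq
  -- Along the subsequence `Q u` converges, hence so does `P u - m • u`. As `m ≤ 0`, the operator `P
  -- - m` is still coercive with constant `c`, which makes `u` Cauchy.
  have hle : ∀ j k, c * ‖u (φ j) - u (φ k)‖ ≤ ‖g j - g k‖ := by
    intro j k
    set d := u (φ j) - u (φ k) with hd
    have e : g j - g k = P d - m • d := by
      simp only [hg, hd, map_sub, smul_sub]; abel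
    have h1 : c * ‖d‖ ^ 2 ≤ ⟪g j - g k, d⟫ := by
      rw [e, inner_sub_left, real_inner_smul_left, real_inner_self_eq_norm_sq]
      have := hP d
      have : 0 ≤ ‖d‖ ^ 2 := by positivity
      nlinarith [hP d]
    have h2 := h1.trans (real_inner_le_norm _ _)
    rcases (norm_nonneg d).eq_or_lt with h0 | h0
    · rw [← h0, mul_zero]; positivity
    · rw [pow_two, ← mul_assoc] at h2
      exact le_of_mul_le_mul_right h2 h0
  have hcu : CauchySeq (u ∘ φ) := by
    rw [Metric.cauchySeq_iff'] at hcg ⊢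
    intro ε hε
    obtain ⟨N, hN⟩ := hcg (c * ε) (by positivity)
    refine ⟨N, fun n hn => ?_⟩
    have h1 := hN n hn
    rw [dist_eq_norm] at h1 ⊢
    have h2 := (hle n N).trans_lt h1
    exact lt_of_mul_lt_mul_left h2 hc.le
  obtain ⟨w, hw⟩ := cauchySeq_tendsto_of_complete hcu
  exact ⟨w, φ, hφ, hw⟩

theorem apply_of_mem_H0 {z : H} (hz : z ∈ H0 T) : T z = 0 := LinearMap.mem_ker.1 hz

/-- Eigenspaces of a self-adjoint operator for distinct eigenvalues are orthogonal, so the quadratic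
form diagonalizes over any finite sum of eigenvectors. -/
theorem exists_sum_of_mem_Hminus (hT : IsSelfAdjoint T) {u : H} (hu : u ∈ Hminus T) :
    ∃ f : Set.Iio (0 : ℝ) →₀ H, u = ∑ i ∈ f.support, f i ∧
      ⟪T u, u⟫ = ∑ i ∈ f.support, (i : ℝ) * ‖f i‖ ^ 2 ∧ (∀ i, T (f i) = (i : ℝ) • f i) := by
  obtain ⟨f, hf, hsum⟩ := (Submodule.mem_iSup_iff_exists_finsupp _ _).1 hu
  have hTf : ∀ i, T (f i) = (i : ℝ) • f i := fun i => Module.End.mem_eigenspace_iff.1 (hf i)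
  have horth : ∀ i j, i ≠ j → ⟪f i, f j⟫ = 0 := by
    intro i j hij
    exact (hT.isSymmetric).orthogonalFamily_eigenspaces
      (fun h => hij (Subtype.ext h) : (i : ℝ) ≠ j) ⟨f i, hf i⟩ ⟨f j, hf j⟩
  have hsum' : ∑ i ∈ f.support, f i = u := hsum
  refine ⟨f, hsum'.symm, ?_, hTf⟩
  have h1 : T u = ∑ i ∈ f.support, (i : ℝ) • f i := by
    rw [← hsum', map_sum]
    exact Finset.sum_congr rfl fun i _ => hTf i
  rw [h1, sum_inner]
  refine Finset.sum_congr rfl fun i hi => ?_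
  rw [real_inner_smul_left, ← hsum', inner_sum, Finset.sum_eq_single i, real_inner_self_eq_norm_sq]
  · exact fun j _ hji => horth i j hji.symm
  · exact fun h => absurd hi h

theorem inner_nonpos_of_mem_Hminus (hT : IsSelfAdjoint T) {u : H} (hu : u ∈ Hminus T) :
    ⟪T u, u⟫ ≤ 0 := by
  obtain ⟨f, -, h, -⟩ := exists_sum_of_mem_Hminus hT hu
  rw [h]
  exact Finset.sum_nonpos fun i _ => mul_nonpos_of_nonpos_of_nonneg (le_of_lt i.2) (by positivity)

theorem inner_neg_of_mem_Hminus (hT : IsSelfAdjoint T) {u : H} (hu : u ∈ Hminus T) (h0 : u ≠ 0) :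
    ⟪T u, u⟫ < 0 := by
  obtain ⟨f, hfu, h, -⟩ := exists_sum_of_mem_Hminus hT hu
  rw [h]
  refine Finset.sum_neg (fun i hi => ?_) ?_
  · have : 0 < ‖f i‖ := norm_pos_iff.2 (Finsupp.mem_support_iff.1 hi)
    exact mul_neg_of_neg_of_pos i.2 (by positivity)
  · rw [Finset.nonempty_iff_ne_empty]
    intro he
    rw [he, Finset.sum_empty] at hfu
    exact h0 hfu

theorem apply_mem_Hminus {u : H} (hu : u ∈ Hminus T) : T u ∈ Hminus T := by
  refine Submodule.iSup_induction _ (motive := fun u => T u ∈ Hminus T) hu ?_ ?_ ?_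
  · intro μ x hx
    have : T x = (μ : ℝ) • x := Module.End.mem_eigenspace_iff.1 hx
    rw [this]
    exact Submodule.smul_mem _ _ (Submodule.mem_iSup_of_mem μ hx)
  · simp
  · intro x y hx hy
    rw [map_add]
    exact Submodule.add_mem _ hx hy

theorem inner_H0_Hminus (hT : IsSelfAdjoint T) {z v : H} (hz : z ∈ H0 T) (hv : v ∈ Hminus T) :
    ⟪z, v⟫ = 0 := by
  refine Submodule.iSup_induction _ (motive := fun v => ⟪z, v⟫ = 0) hv ?_ ?_ ?_
  · intro μ x hx
    have h1 : T x = (μ : ℝ) • x := Module.End.mem_eigenspace_iff.1 hx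
    have h2 := inner_apply_comm hT z x
    rw [apply_of_mem_H0 hz, inner_zero_left, h1, real_inner_smul_right] at h2
    exact (mul_eq_zero.1 h2.symm).resolve_left (ne_of_lt μ.2)
  · simp
  · intro x y hx hy
    rw [inner_add_right, hx, hy, add_zero]

theorem Hminus_le_Hpm (hT : IsSelfAdjoint T) : Hminus T ≤ Hpm T := fun _ hv =>
  (Submodule.mem_orthogonal _ _).2 fun _ hz => inner_H0_Hminus hT hz hv

theorem Hplus_le_Hpm : Hplus T ≤ Hpm T := Submodule.orthogonal_le le_sup_left

theorem inner_Hminus_Hplus {u v : H} (hu : u ∈ Hminus T) (hv : v ∈ Hplus T) : ⟪u, v⟫ = 0 :=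
  (Submodule.mem_orthogonal _ _).1 hv u (Submodule.mem_sup_right hu)

theorem inner_H0_Hpm {z v : H} (hz : z ∈ H0 T) (hv : v ∈ Hpm T) : ⟪z, v⟫ = 0 :=
  (Submodule.mem_orthogonal _ _).1 hv z hz

theorem apply_mem_Hpm (hT : IsSelfAdjoint T) (u : H) : T u ∈ Hpm T :=
  (Submodule.mem_orthogonal _ _).2 fun z hz => by
    rw [← inner_apply_comm hT, apply_of_mem_H0 hz, inner_zero_left]

theorem apply_mem_Hplus (hT : IsSelfAdjoint T) {u : H} (hu : u ∈ Hplus T) : T u ∈ Hplus T := by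
  refine (Submodule.mem_orthogonal _ _).2 fun w hw => ?_
  obtain ⟨z, hz, v, hv, rfl⟩ := Submodule.mem_sup.1 hw
  rw [← inner_apply_comm hT, map_add, apply_of_mem_H0 hz, zero_add]
  exact inner_Hminus_Hplus (apply_mem_Hminus hv) hu

theorem inner_nonpos_of_mem_sup (hT : IsSelfAdjoint T) {u : H} (hu : u ∈ H0 T ⊔ Hminus T) :
    ⟪T u, u⟫ ≤ 0 := by
  obtain ⟨z, hz, v, hv, rfl⟩ := Submodule.mem_sup.1 hu
  rw [map_add, apply_of_mem_H0 hz, zero_add, inner_add_right, inner_apply_comm hT v z,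
    apply_of_mem_H0 hz, inner_zero_right, zero_add]
  exact inner_nonpos_of_mem_Hminus hT hv

/-- The form of `T` is nonpositive on `H⁰ ⊕ H⁻`, so coercivity of `P` forces `c * ‖w‖ ≤ ‖Q w‖`
there. A compact operator is not bounded below on an infinite-dimensional space: a bounded separated
sequence would have images without Cauchy subsequence. -/
theorem IsCoerciveAddCompact.finiteDimensional_sup (h : IsCoerciveAddCompact T)
    (hT : IsSelfAdjoint T) : FiniteDimensional ℝ (H0 T ⊔ Hminus T : Submodule ℝ H) := by
  by_contra hcon
  obtain ⟨P, Q, c, hc, hP, hQ, hPQ⟩ := h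
  obtain ⟨R, f, -, hf, hsep⟩ := exists_seq_norm_le_one_le_norm_sub (𝕜 := ℝ) hcon
  obtain ⟨y, φ, hφ, hy⟩ := exists_subseq_tendsto_of_compact hQ (u := fun n => (f n : H)) hf
  have hbound : ∀ w : (H0 T ⊔ Hminus T : Submodule ℝ H), c * ‖w‖ ≤ ‖Q w‖ := by
    intro w
    have h1 := inner_nonpos_of_mem_sup hT w.2
    have h6 : T (w : H) = P w + Q w := by simpa using congrArg (fun S : H →L[ℝ] H => S w) hPQ
    rw [h6, inner_add_left] at h1
    have h2 := hP (w : H)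
    have h3 := abs_real_inner_le_norm (Q w) (w : H)
    have h4 := neg_abs_le ⟪Q w, (w : H)⟫
    have h5 : c * ‖(w : H)‖ ^ 2 ≤ ‖Q w‖ * ‖(w : H)‖ := by linarith
    rcases (norm_nonneg (w : H)).eq_or_lt with h0 | h0
    · rw [Submodule.coe_norm, ← h0, mul_zero]; positivity
    · rw [pow_two, ← mul_assoc] at h5
      exact le_of_mul_le_mul_right h5 h0
  obtain ⟨N, hN⟩ := (Metric.cauchySeq_iff'.1 hy.cauchySeq) c hc
  have h1 := hN (N + 1) (Nat.le_succ N)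
  rw [dist_eq_norm, ← map_sub] at h1
  have h2 := hbound (f (φ (N + 1)) - f (φ N))
  have h3 := hsep (hφ (Nat.lt_succ_self N)).ne'
  rw [Submodule.coe_sub] at h2
  have h4 : c * 1 ≤ c * ‖f (φ (N + 1)) - f (φ N)‖ := by gcongr
  linarith

theorem finiteDimensional_Hminus [FiniteDimensional ℝ (H0 T ⊔ Hminus T : Submodule ℝ H)] :
    FiniteDimensional ℝ (Hminus T) :=
  Submodule.finiteDimensional_of_le (le_sup_right : Hminus T ≤ H0 T ⊔ Hminus T)

theorem exists_gap_Hminus (hT : IsSelfAdjoint T) [FiniteDimensional ℝ (Hminus T)] :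
    ∃ a : ℝ, 0 < a ∧ ∀ u ∈ Hminus T, ⟪T u, u⟫ ≤ -(a * ‖u‖ ^ 2) := by
  have hK : IsCompact (Metric.sphere (0 : Hminus T) 1) := isCompact_sphere _ _
  have hscale : ∀ a : ℝ, (∀ u ∈ Metric.sphere (0 : Hminus T) 1, ⟪T u, (u : H)⟫ ≤ -a) →
      ∀ u ∈ Hminus T, ⟪T u, u⟫ ≤ -(a * ‖u‖ ^ 2) := by
    intro a ha u hu
    by_cases h0 : u = 0
    · simp [h0]
    have hn : 0 < ‖u‖ := norm_pos_iff.2 h0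
    have h1 := ha (‖u‖⁻¹ • (⟨u, hu⟩ : Hminus T)) (by
      rw [mem_sphere_zero_iff_norm, norm_smul, norm_inv, norm_norm, Submodule.coe_norm]
      exact inv_mul_cancel₀ hn.ne')
    rw [Submodule.coe_smul, map_smul, real_inner_smul_left, real_inner_smul_right] at h1
    have h2 : ⟪T u, u⟫ = ‖u‖ ^ 2 * (‖u‖⁻¹ * (‖u‖⁻¹ * ⟪T u, u⟫)) := by field_simp
    rw [h2]
    have : 0 ≤ ‖u‖ ^ 2 := by positivity
    nlinarith
  rcases (Metric.sphere (0 : Hminus T) 1).eq_empty_or_nonempty with he | hne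
  · exact ⟨1, one_pos, hscale 1 fun u hu => by rw [he] at hu; exact hu.elim⟩
  obtain ⟨u₀, hu₀, hmax⟩ := hK.exists_isMaxOn hne
    (f := fun u : Hminus T => ⟪T u, (u : H)⟫) (by fun_prop)
  refine ⟨-⟪T u₀, (u₀ : H)⟫, ?_, hscale _ fun u hu => by rw [neg_neg]; exact hmax hu⟩
  have h0 : (u₀ : H) ≠ 0 := by
    intro h
    have h1 : ‖u₀‖ = 1 := by simpa using hu₀
    rw [Submodule.coe_norm, h, norm_zero] at h1
    exact zero_ne_one h1
  have := inner_neg_of_mem_Hminus hT u₀.2 h0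
  linarith

/-- The nonnegative form is tested at `x - k⁻¹ • N x`. Its purpose: for a nonnegative form, a small
Rayleigh quotient makes `N x` itself small, so minimizing sequences are approximate eigenvectors. -/
theorem norm_sq_le_of_nonneg_form {N : H →L[ℝ] H} {S : Submodule ℝ H}
    (hsymm : ∀ u v, ⟪N u, v⟫ = ⟪u, N v⟫) (hS : ∀ u ∈ S, N u ∈ S) (hN : ∀ u ∈ S, 0 ≤ ⟪N u, u⟫)
    {x : H} (hx : x ∈ S) : ‖N x‖ ^ 2 ≤ (‖N‖ + 1) * ⟪N x, x⟫ := by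
  set k := ‖N‖ + 1 with hk
  have hkpos : 0 < k := by positivity
  have h1 := hN (x - k⁻¹ • N x) (S.sub_mem hx (S.smul_mem _ (hS x hx)))
  have h2 : ⟪N (N x), N x⟫ ≤ k * ‖N x‖ ^ 2 := by
    refine (le_abs_self _).trans ((inner_self_apply_le N (N x)).trans ?_)
    gcongr
    linarith
  have e : ⟪N (x - k⁻¹ • N x), x - k⁻¹ • N x⟫ =
      ⟪N x, x⟫ - 2 * k⁻¹ * ‖N x‖ ^ 2 + k⁻¹ * (k⁻¹ * ⟪N (N x), N x⟫) := by
    simp only [map_sub, map_smul, inner_sub_left, inner_sub_right, real_inner_smul_left,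
      real_inner_smul_right]
    rw [hsymm (N x) x, real_inner_self_eq_norm_sq]
    ring
  rw [e] at h1
  have h3 : k⁻¹ * (k⁻¹ * ⟪N (N x), N x⟫) ≤ k⁻¹ * (k⁻¹ * (k * ‖N x‖ ^ 2)) := by gcongr
  have h4 : k⁻¹ * (k⁻¹ * (k * ‖N x‖ ^ 2)) = k⁻¹ * ‖N x‖ ^ 2 := by field_simp
  have h5 : k⁻¹ * ‖N x‖ ^ 2 ≤ ⟪N x, x⟫ := by linarith
  rwa [inv_mul_le_iff₀ hkpos] at h5

/-- The quadratic form is coercive on the positive subspace. -/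
theorem IsCoerciveAddCompact.exists_gap_Hplus (h : IsCoerciveAddCompact T)
    (hT : IsSelfAdjoint T) : ∃ a : ℝ, 0 < a ∧ ∀ u ∈ Hplus T, a * ‖u‖ ^ 2 ≤ ⟪T u, u⟫ := by
  set A : Set ℝ := (fun u => ⟪T u, u⟫) '' {u | u ∈ Hplus T ∧ ‖u‖ = 1} with hA
  have hbdd : BddBelow A := by
    refine ⟨-‖T‖, ?_⟩
    rintro _ ⟨u, ⟨-, hu⟩, rfl⟩
    have := inner_self_apply_le T u
    rw [hu] at this
    have h2 := neg_abs_le ⟪T u, u⟫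
    simp only
    linarith
  have hscale : ∀ a : ℝ, (∀ t ∈ A, a ≤ t) → ∀ u ∈ Hplus T, a * ‖u‖ ^ 2 ≤ ⟪T u, u⟫ := by
    intro a ha u hu
    by_cases h0 : u = 0
    · simp [h0]
    have hn : 0 < ‖u‖ := norm_pos_iff.2 h0
    have h1 := ha _ ⟨‖u‖⁻¹ • u, ⟨Submodule.smul_mem _ _ hu, by
      rw [norm_smul, norm_inv, norm_norm]; exact inv_mul_cancel₀ hn.ne'⟩, rfl⟩
    simp only [map_smul, real_inner_smul_left, real_inner_smul_right] at h1
    have h2 : ⟪T u, u⟫ = ‖u‖ ^ 2 * (‖u‖⁻¹ * (‖u‖⁻¹ * ⟪T u, u⟫)) := by field_simp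
    rw [h2, mul_comm]
    gcongr
  rcases A.eq_empty_or_nonempty with he | hne
  · exact ⟨1, one_pos, hscale 1 fun t ht => by rw [he] at ht; exact ht.elim⟩
  by_cases hpos : 0 < sInf A
  · exact ⟨sInf A, hpos, hscale _ fun t ht => csInf_le hbdd ht⟩
  exfalso
  push Not at hpos
  set m := sInf A with hm
  obtain ⟨t, -, htlim, htA⟩ := exists_seq_tendsto_sInf hne hbdd
  choose u hu hut using htA
  -- If the infimum `m` of the Rayleigh quotient on `H⁺` were nonpositive, `N = T - m` would have a
  -- nonnegative form there, and a minimizing sequence would converge, along a subsequence, to an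
  -- eigenvector for `m`.
  set N : H →L[ℝ] H := T - m • ContinuousLinearMap.id ℝ H with hN
  have hNa : ∀ w, N w = T w - m • w := fun w => by simp [hN]
  have hsymm : ∀ w v, ⟪N w, v⟫ = ⟪w, N v⟫ := by
    intro w v
    rw [hNa, hNa, inner_sub_left, inner_sub_right, inner_apply_comm hT, real_inner_smul_left,
      real_inner_smul_right]
  have hNin : ∀ w, ⟪N w, w⟫ = ⟪T w, w⟫ - m * ‖w‖ ^ 2 := by
    intro w
    rw [hNa, inner_sub_left, real_inner_smul_left, real_inner_self_eq_norm_sq]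
  have hlim0 : Tendsto (fun n => (‖N‖ + 1) * ⟪N (u n), u n⟫) atTop (𝓝 0) := by
    have h1 : Tendsto (fun n => (‖N‖ + 1) * (t n - m)) atTop (𝓝 ((‖N‖ + 1) * (m - m))) :=
      (htlim.sub_const m).const_mul _
    rw [sub_self, mul_zero] at h1
    refine h1.congr fun n => ?_
    rw [hNin, (hu n).2, ← hut n]
    ring
  have hlim1 : Tendsto (fun n => ‖N (u n)‖ ^ 2) atTop (𝓝 0) := by
    refine squeeze_zero (fun n => by positivity) (fun n => ?_) hlim0
    refine norm_sq_le_of_nonneg_form (S := Hplus T) hsymm (fun w hw => ?_) (fun w hw => ?_)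
      (hu n).1
    · rw [hNa]
      exact Submodule.sub_mem _ (apply_mem_Hplus hT hw) (Submodule.smul_mem _ _ hw)
    · rw [hNin]
      have := hscale m (fun t ht => csInf_le hbdd ht) w hw
      linarith
  have hlim2 : Tendsto (fun n => T (u n) - m • u n) atTop (𝓝 0) := by
    rw [tendsto_zero_iff_norm_tendsto_zero]
    have := (Real.continuous_sqrt.tendsto 0).comp hlim1
    rw [Real.sqrt_zero] at this
    refine this.congr fun n => ?_
    simp only [Function.comp]
    rw [Real.sqrt_sq (norm_nonneg _), hNa]
  obtain ⟨w, φ, hφ, hw⟩ := h.exists_subseq_tendsto hpos (fun n => (hu n).2.le) hlim2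
  have hwnorm : ‖w‖ = 1 := by
    refine tendsto_nhds_unique hw.norm ?_
    simp only [Function.comp, (hu _).2]
    exact tendsto_const_nhds
  have hwp : w ∈ Hplus T :=
    (Submodule.isClosed_orthogonal _).mem_of_tendsto hw (Eventually.of_forall fun n => (hu _).1)
  have hTw : T w = m • w := by
    have h1 : Tendsto (fun n => T ((u ∘ φ) n) - m • (u ∘ φ) n) atTop (𝓝 (T w - m • w)) :=
      ((T.continuous.tendsto w).comp hw).sub (hw.const_smul m)
    exact sub_eq_zero.1 (tendsto_nhds_unique h1 (hlim2.comp hφ.tendsto_atTop))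
  -- An eigenvector for `m ≤ 0` lies in `H⁰ ⊕ H⁻`, yet `w` is a unit vector orthogonal to that
  -- space.
  have hws : w ∈ H0 T ⊔ Hminus T := by
    rcases hpos.lt_or_eq with h0 | h0
    · exact Submodule.mem_sup_right
        (Submodule.mem_iSup_of_mem (⟨m, h0⟩ : Set.Iio (0 : ℝ)) (Module.End.mem_eigenspace_iff.2 hTw))
    · refine Submodule.mem_sup_left (LinearMap.mem_ker.2 ?_)
      rw [h0, zero_smul] at hTw
      exact hTw
  have h1 : ⟪w, w⟫ = 0 := (Submodule.mem_orthogonal _ _).1 hwp w hws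
  rw [inner_self_eq_zero.1 h1, norm_zero] at hwnorm
  exact zero_ne_one hwnorm

end Fredholm

end SplitInf

namespace SplitInf

/-! ### Orthogonal projections onto `H⁰`, `H⁺`, `H⁻`, and solvability on `H^±` -/

section Projections

variable {H : Type*} [NormedAddCommGroup H] [InnerProductSpace ℝ H] [CompleteSpace H]
  {T : H →L[ℝ] H}

theorem P0_mem (u : H) : P0 T u ∈ H0 T := Submodule.starProjection_apply_mem _ _

theorem P0_of_mem_H0 {z : H} (hz : z ∈ H0 T) : P0 T z = z :=
  Submodule.starProjection_eq_self_iff.2 hz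

theorem P0_eq_zero_iff {u : H} : P0 T u = 0 ↔ u ∈ Hpm T :=
  Submodule.starProjection_apply_eq_zero_iff _

theorem sub_P0_mem (u : H) : u - P0 T u ∈ Hpm T := Submodule.sub_starProjection_mem_orthogonal u

theorem norm_P0_le (u : H) : ‖P0 T u‖ ≤ ‖u‖ := Submodule.norm_starProjection_apply_le _ u

theorem P0_add_of_mem {z u : H} (hz : z ∈ H0 T) (hu : u ∈ Hpm T) : P0 T (z + u) = z := by
  rw [map_add, P0_of_mem_H0 hz, P0_eq_zero_iff.2 hu, add_zero]

theorem P0_add_of_mem_right {w u : H} (hu : u ∈ Hpm T) : P0 T (w + u) = P0 T w := by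
  rw [map_add, P0_eq_zero_iff.2 hu, add_zero]

variable (T) in
/-- The orthogonal projection onto `H⁻`. -/
noncomputable def Pminus [FiniteDimensional ℝ (Hminus T)] : H →L[ℝ] H := (Hminus T).starProjection

variable (T) in
/-- The orthogonal projection onto `H⁺`. -/
noncomputable def Pplus [FiniteDimensional ℝ (Hminus T)] : H →L[ℝ] H :=
  ContinuousLinearMap.id ℝ H - P0 T - Pminus T

variable [FiniteDimensional ℝ (Hminus T)]

theorem Pplus_apply (u : H) : Pplus T u = u - P0 T u - Pminus T u := rfl

theorem Pminus_mem (u : H) : Pminus T u ∈ Hminus T := Submodule.starProjection_apply_mem _ _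

theorem Pminus_of_mem {u : H} (hu : u ∈ Hminus T) : Pminus T u = u :=
  Submodule.starProjection_eq_self_iff.2 hu

theorem Pminus_of_mem_H0 (hT : IsSelfAdjoint T) {z : H} (hz : z ∈ H0 T) : Pminus T z = 0 :=
  (Submodule.starProjection_apply_eq_zero_iff _).2 ((Submodule.mem_orthogonal _ _).2 fun v hv => by
    rw [real_inner_comm]; exact inner_H0_Hminus hT hz hv)

theorem Pminus_of_mem_Hplus {u : H} (hu : u ∈ Hplus T) : Pminus T u = 0 :=
  (Submodule.starProjection_apply_eq_zero_iff _).2 ((Submodule.mem_orthogonal _ _).2 fun _ hv =>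
    inner_Hminus_Hplus hv hu)

theorem Pplus_mem (hT : IsSelfAdjoint T) (u : H) : Pplus T u ∈ Hplus T := by
  refine (Submodule.mem_orthogonal _ _).2 fun w hw => ?_
  obtain ⟨z, hz, v, hv, rfl⟩ := Submodule.mem_sup.1 hw
  have h1 : ⟪z, u - P0 T u⟫ = 0 := inner_H0_Hpm hz (sub_P0_mem u)
  have h2 : ⟪z, Pminus T u⟫ = 0 := inner_H0_Hminus hT hz (Pminus_mem u)
  have h3 : ⟪v, u - Pminus T u⟫ = 0 := (Submodule.mem_orthogonal _ _).1
    (Submodule.sub_starProjection_mem_orthogonal (K := Hminus T) u) v hv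
  have h4 : ⟪v, P0 T u⟫ = 0 := by
    rw [real_inner_comm]; exact inner_H0_Hminus hT (P0_mem u) hv
  rw [inner_add_left, Pplus_apply, inner_sub_right z, h1, h2, sub_right_comm, inner_sub_right v,
    h3, h4]
  ring

theorem Pplus_of_mem {u : H} (hu : u ∈ Hplus T) : Pplus T u = u := by
  rw [Pplus_apply, P0_eq_zero_iff.2 (Hplus_le_Hpm hu), Pminus_of_mem_Hplus hu, sub_zero, sub_zero]

theorem P0_add_Pplus_add_Pminus (u : H) : P0 T u + (Pplus T u + Pminus T u) = u := by
  rw [Pplus_apply]; abel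

theorem Pplus_add_Pminus_of_mem {u : H} (hu : u ∈ Hpm T) : Pplus T u + Pminus T u = u := by
  rw [Pplus_apply, P0_eq_zero_iff.2 hu]; abel

theorem add_mem_Hpm (hT : IsSelfAdjoint T) {u v : H} (hu : u ∈ Hplus T) (hv : v ∈ Hminus T) :
    u + v ∈ Hpm T := Submodule.add_mem _ (Hplus_le_Hpm hu) (Hminus_le_Hpm hT hv)

theorem Pminus_add (hT : IsSelfAdjoint T) {z u v : H} (hz : z ∈ H0 T) (hu : u ∈ Hplus T)
    (hv : v ∈ Hminus T) : Pminus T (z + (u + v)) = v := by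
  rw [map_add, map_add, Pminus_of_mem_H0 hT hz, Pminus_of_mem_Hplus hu, Pminus_of_mem hv]; simp

theorem Pplus_add (hT : IsSelfAdjoint T) {z u v : H} (hz : z ∈ H0 T) (hu : u ∈ Hplus T)
    (hv : v ∈ Hminus T) : Pplus T (z + (u + v)) = u := by
  rw [Pplus_apply, Pminus_add hT hz hu hv, P0_add_of_mem hz (add_mem_Hpm hT hu hv)]; abel

theorem norm_Pplus_sub_Pminus {u : H} (hT : IsSelfAdjoint T) (hu : u ∈ Hpm T) :
    ‖Pplus T u - Pminus T u‖ = ‖u‖ := by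
  have h : ⟪Pplus T u, Pminus T u⟫ = 0 := by
    rw [real_inner_comm]; exact inner_Hminus_Hplus (Pminus_mem u) (Pplus_mem hT u)
  have h1 := norm_add_sq_eq_norm_sq_add_norm_sq_real h
  have h2 := norm_sub_sq_eq_norm_sq_add_norm_sq_real h
  rw [Pplus_add_Pminus_of_mem hu] at h1
  have h3 := h2.trans h1.symm
  nlinarith [norm_nonneg u, norm_nonneg (Pplus T u - Pminus T u)]

/-- A self-adjoint operator with gaps on `H⁺` and `H⁻` is coercive when it is tested with the
reflected vector. -/
theorem mul_norm_sq_le_inner_reflection {S : H →L[ℝ] H} (hS : IsSelfAdjoint S)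
    (hT : IsSelfAdjoint T) {a : ℝ}
    (hp : ∀ u ∈ Hplus T, a * ‖u‖ ^ 2 ≤ ⟪S u, u⟫) (hm : ∀ u ∈ Hminus T, ⟪S u, u⟫ ≤ -(a * ‖u‖ ^ 2))
    {u : H} (hu : u ∈ Hpm T) : a * ‖u‖ ^ 2 ≤ ⟪S u, Pplus T u - Pminus T u⟫ := by
  have h : ⟪Pplus T u, Pminus T u⟫ = 0 := by
    rw [real_inner_comm]; exact inner_Hminus_Hplus (Pminus_mem u) (Pplus_mem hT u)
  have h1 := norm_add_sq_eq_norm_sq_add_norm_sq_real h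
  rw [Pplus_add_Pminus_of_mem hu] at h1
  have h2 := hp _ (Pplus_mem hT u)
  have h3 := hm _ (Pminus_mem u)
  have e : ⟪S u, Pplus T u - Pminus T u⟫ =
      ⟪S (Pplus T u), Pplus T u⟫ - ⟪S (Pminus T u), Pminus T u⟫ := by
    have hSu : S u = S (Pplus T u) + S (Pminus T u) := by
      rw [← map_add, Pplus_add_Pminus_of_mem hu]
    rw [hSu]
    simp only [inner_add_left, inner_sub_right]
    rw [inner_apply_comm hS (Pplus T u) (Pminus T u), real_inner_comm (S (Pminus T u))]
    ring
  have h4 : a * ‖u‖ ^ 2 = a * ‖Pplus T u‖ ^ 2 + a * ‖Pminus T u‖ ^ 2 := by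
    rw [pow_two ‖u‖, h1]; ring
  rw [e]
  linarith

/-- `T` maps `H^±` onto itself. -/
theorem IsCoerciveAddCompact.exists_apply_eq (h : IsCoerciveAddCompact T) (hT : IsSelfAdjoint T)
    {y : H} (hy : y ∈ Hpm T) : ∃ u ∈ Hpm T, T u = y := by
  obtain ⟨a₁, ha₁, hp⟩ := h.exists_gap_Hplus hT
  obtain ⟨a₂, ha₂, hm⟩ := exists_gap_Hminus hT
  set a := min a₁ a₂
  have ha : 0 < a := lt_min ha₁ ha₂
  -- The reflection in `H⁻` makes the indefinite form of `T` coercive on `H^±`, and adding `P⁰`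
  -- takes care of the kernel. Lax–Milgram then solves the equation.
  set Rf : H →L[ℝ] H := ContinuousLinearMap.id ℝ H - (2 : ℝ) • Pminus T with hRf
  have hRa : ∀ u, Rf u = u - (2 : ℝ) • Pminus T u := fun u => by simp [hRf]
  have hRR : ∀ u, Rf (Rf u) = u := by
    intro u
    rw [hRa, hRa, map_sub, map_smul, Pminus_of_mem (Pminus_mem u)]
    module
  have hRs : ∀ u v, ⟪Rf u, v⟫ = ⟪u, Rf v⟫ := by
    intro u v
    rw [hRa, hRa, inner_sub_left, inner_sub_right, real_inner_smul_left, real_inner_smul_right]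
    have : ⟪Pminus T u, v⟫ = ⟪u, Pminus T v⟫ :=
      Submodule.inner_starProjection_left_eq_right (Hminus T) u v
    rw [this]
  set b : H →L[ℝ] H →L[ℝ] ℝ := (innerSL ℝ).comp (Rf.comp (T + P0 T)) with hb
  have hba : ∀ u v, b u v = ⟪Rf (T u + P0 T u), v⟫ := fun u v => by
    simp [hb, inner_add_left]
  have hcoer : IsCoercive b := by
    refine ⟨min 1 a, lt_min one_pos ha, fun u => ?_⟩
    set w := u - P0 T u with hw
    have hwm : w ∈ Hpm T := sub_P0_mem u
    have hu : u = P0 T u + w := by rw [hw]; abel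
    have h1 := mul_norm_sq_le_inner_reflection hT hT (a := a)
      (fun v hv => le_trans (by gcongr; exact min_le_left _ _) (hp v hv))
      (fun v hv => (hm v hv).trans (by gcongr; exact min_le_right _ _)) hwm
    have hTu : T u = T w := by
      conv_lhs => rw [hu]
      rw [map_add, apply_of_mem_H0 (P0_mem u), zero_add]
    have hRu : Rf u = P0 T u + (Pplus T w - Pminus T w) := by
      conv_lhs => rw [hu]
      rw [map_add, hRa, hRa, Pminus_of_mem_H0 hT (P0_mem u)]
      rw [eq_sub_of_add_eq (Pplus_add_Pminus_of_mem hwm)]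
      module
    have h2 : b u u = ‖P0 T u‖ ^ 2 + ⟪T w, Pplus T w - Pminus T w⟫ := by
      have c1 : ⟪T w, P0 T u⟫ = 0 := by
        rw [real_inner_comm]; exact inner_H0_Hpm (P0_mem u) (apply_mem_Hpm hT w)
      have c2 : ⟪P0 T u, Pplus T w - Pminus T w⟫ = 0 :=
        inner_H0_Hpm (P0_mem u) (Submodule.sub_mem _ (Hplus_le_Hpm (Pplus_mem hT w))
          (Hminus_le_Hpm hT (Pminus_mem w)))
      rw [hba, hRs, hTu, hRu, inner_add_left, inner_add_right, inner_add_right, c1, c2,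
        real_inner_self_eq_norm_sq]
      ring
    have h3 : ‖u‖ * ‖u‖ = ‖P0 T u‖ * ‖P0 T u‖ + ‖w‖ * ‖w‖ := by
      conv_lhs => rw [hu]
      exact norm_add_sq_eq_norm_sq_add_norm_sq_real (inner_H0_Hpm (P0_mem u) hwm)
    rw [h2, mul_assoc, h3, mul_add]
    have c1 : min 1 a ≤ 1 := min_le_left _ _
    have c2 : min 1 a ≤ a := min_le_right _ _
    have d1 : 0 ≤ ‖P0 T u‖ * ‖P0 T u‖ := by positivity
    have d2 : 0 ≤ ‖w‖ * ‖w‖ := by positivity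
    nlinarith
  obtain ⟨u, hu⟩ := (hcoer.continuousLinearEquivOfBilin).surjective (Rf y)
  have h1 : Rf (T u + P0 T u) = Rf y := by
    rw [← hu]
    refine ext_inner_right ℝ fun v => ?_
    rw [IsCoercive.continuousLinearEquivOfBilin_apply, hba]
  have h2 : T u + P0 T u = y := by rw [← hRR (T u + P0 T u), h1, hRR]
  -- Both `T u` and `y` lie in `H^±`, so the auxiliary term `P⁰ u` must vanish.
  have h3 : P0 T u = 0 := by
    have := congrArg (P0 T) h2
    rwa [map_add, P0_eq_zero_iff.2 (apply_mem_Hpm hT u), P0_eq_zero_iff.2 hy, zero_add,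
      P0_of_mem_H0 (P0_mem u)] at this
  exact ⟨u, P0_eq_zero_iff.1 h3, by rwa [h3, add_zero] at h2⟩

end Projections

/-! ### The Hessian near infinity -/

section Setting

variable {H X : Type*} [NormedAddCommGroup H] [InnerProductSpace ℝ H] [CompleteSpace H]
  [NormedAddCommGroup X] [NormedSpace ℝ X]

/-- The standing assumptions. -/
structure Setting (ι : X →L[ℝ] H) (V : Set H) (L : H → ℝ) (A : X → X) (B : X → H →L[ℝ] H)
    (Binf : H →L[ℝ] H) : Prop where
  injective : Function.Injective ι
  denseRange : DenseRange ι
  isOpen : IsOpen V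
  exterior_subset : ∃ r : ℝ, {u : H | r < ‖u‖} ⊆ V
  condF1 : CondF1 V L
  condF2 : CondF2 ι V L A
  condF3 : CondF3 ι V A B Binf
  condC2 : CondC2 ι Binf
  condD : CondD ι V B Binf
  rank_pos : 0 < Module.rank ℝ (H0 Binf)

variable {ι : X →L[ℝ] H} {V : Set H} {L : H → ℝ} {A : X → X} {B : X → H →L[ℝ] H}
  {Binf : H →L[ℝ] H}

namespace Setting

variable (hS : Setting ι V L A B Binf)
include hS

theorem selfAdjoint : IsSelfAdjoint Binf := hS.condF3.2.1

theorem mem_range_of_mem_H0 {z : H} (hz : z ∈ H0 Binf) : z ∈ range ι :=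
  hS.condC2 z ⟨0, by rw [map_zero, apply_of_mem_H0 hz]⟩

theorem mem_range_of_mem_Hminus {v : H} (hv : v ∈ Hminus Binf) : v ∈ range ι := by
  obtain ⟨P, Q, Pinf, Qinf, -, -, -, -, -, -, h, -⟩ := hS.condD
  refine Submodule.iSup_induction _ (motive := fun v => v ∈ range ι) hv ?_ ?_ ?_
  · exact fun μ x hx => h μ x μ.2 (Module.End.mem_eigenspace_iff.1 hx)
  · exact ⟨0, map_zero _⟩
  · rintro x y ⟨a, rfl⟩ ⟨b, rfl⟩
    exact ⟨a + b, map_add _ _ _⟩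

theorem mem_range_of_mem_sup {w : H} (hw : w ∈ H0 Binf ⊔ Hminus Binf) : w ∈ range ι := by
  obtain ⟨z, hz, v, hv, rfl⟩ := Submodule.mem_sup.1 hw
  obtain ⟨a, ha⟩ := hS.mem_range_of_mem_H0 hz
  obtain ⟨b, hb⟩ := hS.mem_range_of_mem_Hminus hv
  exact ⟨a + b, by rw [map_add, ha, hb]⟩

/-- Two clauses of `CondD` speak of sequences tending to infinity and say nothing unless one exists.
Multiples of a nonzero vector of `H⁰`, which lies in `X`, provide one. -/
theorem exists_seq_atTop :
    ∃ x : ℕ → X, (∀ k, ι (x k) ∈ V) ∧ Tendsto (fun k => ‖ι (x k)‖) atTop atTop := by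
  obtain ⟨r, hr⟩ := hS.exterior_subset
  obtain ⟨z, hz⟩ := rank_pos_iff_exists_ne_zero.1 hS.rank_pos
  obtain ⟨x, hx⟩ := hS.mem_range_of_mem_H0 z.2
  have hn : 0 < ‖ι x‖ := by
    rw [hx]; exact norm_pos_iff.2 fun h => hz (Subtype.ext h)
  have hnorm : ∀ k : ℕ, ‖ι (((|r| + 1 + k) / ‖ι x‖) • x)‖ = |r| + 1 + k := by
    intro k
    rw [map_smul, norm_smul, Real.norm_of_nonneg (by positivity)]
    field_simp
  refine ⟨fun k => ((|r| + 1 + k) / ‖ι x‖) • x, fun k => hr ?_, ?_⟩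
  · rw [mem_ofPred_eq, hnorm]
    have := le_abs_self r
    have : (0 : ℝ) ≤ k := k.cast_nonneg
    linarith
  · simp only [hnorm]
    exact tendsto_atTop_add_const_left _ _ tendsto_natCast_atTop_atTop

/-- Positivity of `P(∞)` is assumed pointwise only; a uniform constant is inherited in the limit
from the lower bounds for `P (x k)`. -/
theorem isCoerciveAddCompact : IsCoerciveAddCompact Binf := by
  obtain ⟨x, hxV, hx⟩ := hS.exists_seq_atTop
  obtain ⟨P, Q, Pinf, Qinf, -, hinf, -, -, -, hQ, -, hP, -, hC⟩ := hS.condD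
  obtain ⟨c, hc, n₀, hn⟩ := hC x hxV hx
  refine ⟨Pinf, Qinf, c, hc, fun u => ?_, hQ, hinf⟩
  have h1 : Tendsto (fun k => P (x k) u) atTop (𝓝 (Pinf u)) :=
    tendsto_iff_norm_sub_tendsto_zero.2 (hP x hxV hx u)
  exact ge_of_tendsto (h1.inner tendsto_const_nhds)
    (eventually_atTop.2 ⟨n₀, fun n h => hn n h u⟩)

theorem finiteDimensional_sup : FiniteDimensional ℝ (H0 Binf ⊔ Hminus Binf : Submodule ℝ H) :=
  hS.isCoerciveAddCompact.finiteDimensional_sup hS.selfAdjoint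

theorem tendsto_apply {x : ℕ → X} (hxV : ∀ k, ι (x k) ∈ V)
    (hx : Tendsto (fun k => ‖ι (x k)‖) atTop atTop) (u : H) :
    Tendsto (fun k => B (x k) u) atTop (𝓝 (Binf u)) := by
  obtain ⟨P, Q, Pinf, Qinf, hB, hinf, -, -, -, -, -, hP, hQ, -⟩ := hS.condD
  have h1 : Tendsto (fun k => P (x k) u) atTop (𝓝 (Pinf u)) :=
    tendsto_iff_norm_sub_tendsto_zero.2 (hP x hxV hx u)
  have h2 : Tendsto (fun k => Q (x k)) atTop (𝓝 Qinf) := by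
    rw [Metric.tendsto_nhds]
    intro ε hε
    obtain ⟨R, hR⟩ := hQ (ε / 2) (by positivity)
    filter_upwards [hx.eventually_ge_atTop R] with k hk
    rw [dist_eq_norm]
    have := hR (x k) (hxV k) hk
    linarith
  have h3 : Tendsto (fun k => Q (x k) u) atTop (𝓝 (Qinf u)) :=
    ((ContinuousLinearMap.apply ℝ H u).continuous.tendsto Qinf).comp h2
  rw [hinf]
  refine (h1.add h3).congr fun k => ?_
  rw [hB _ (hxV k), add_apply]

/-- A property of the points of `V ∩ X` that holds along all sequences which tend to infinity
holds near infinity. -/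
theorem exists_radius_of_seq {p : X → Prop}
    (h : ∀ x : ℕ → X, (∀ k, ι (x k) ∈ V) → Tendsto (fun k => ‖ι (x k)‖) atTop atTop →
      ∃ k, p (x k)) : ∃ R : ℝ, ∀ x : X, ι x ∈ V → R ≤ ‖ι x‖ → p x := by
  by_contra hcon
  push Not at hcon
  choose x hxV hx hp using fun n : ℕ => hcon n
  obtain ⟨k, hk⟩ := h x hxV (tendsto_atTop_mono hx tendsto_natCast_atTop_atTop)
  exact hp k hk

/-- `B(x) → B(∞)` uniformly on the unit ball of `H⁰ ⊕ H⁻`. -/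
theorem exists_radius_norm_sub_le {ε : ℝ} (hε : 0 < ε) :
    ∃ R : ℝ, ∀ x : X, ι x ∈ V → R ≤ ‖ι x‖ → ∀ u ∈ H0 Binf ⊔ Hminus Binf,
      ‖B x u - Binf u‖ ≤ ε * ‖u‖ := by
  have := hS.finiteDimensional_sup
  let W : Submodule ℝ H := H0 Binf ⊔ Hminus Binf
  let b := Module.finBasis ℝ W
  obtain ⟨C, hC, hop⟩ := b.exists_opNorm_le (F := H)
  refine hS.exists_radius_of_seq fun x hxV hx => ?_
  have hev : ∀ᶠ k in atTop, ∀ i, ‖B (x k) (b i) - Binf (b i)‖ ≤ ε / C := by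
    refine eventually_all.2 fun i => ?_
    have h1 := tendsto_iff_norm_sub_tendsto_zero.1 (hS.tendsto_apply hxV hx (b i))
    exact (h1.eventually_lt_const (by positivity : 0 < ε / C)).mono fun k hk => hk.le
  obtain ⟨k, hk⟩ := hev.exists
  refine ⟨k, fun u hu => ?_⟩
  have h1 := hop (u := (B (x k) - Binf).comp W.subtypeL) (by positivity : 0 ≤ ε / C)
    (fun i => by simpa using hk i)
  have h2 := ((B (x k) - Binf).comp W.subtypeL).le_opNorm ⟨u, hu⟩
  rw [mul_div_cancel₀ _ hC.ne'] at h1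
  exact h2.trans (mul_le_mul_of_nonneg_right h1 (norm_nonneg _))

/-- Otherwise there are `x n → ∞` and unit vectors `v n ∈ H⁺` whose forms have nonpositive limit.
With a weak limit `w` and `d n = v n - w`, the cross terms and the `Q` terms vanish in the limit,
leaving `c * (1 - ‖w‖ ^ 2) + ⟪Binf w, w⟫ ≤ 0`. The gap of `B(∞)` at `w ∈ H⁺` contradicts this,
whether mass is lost in the limit or not. -/
theorem exists_gap_Hplus_near_infinity :
    ∃ a : ℝ, 0 < a ∧ ∃ R : ℝ, ∀ x : X, ι x ∈ V → R ≤ ‖ι x‖ →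
      ∀ u ∈ Hplus Binf, a * ‖u‖ ^ 2 ≤ ⟪B x u, u⟫ := by
  by_contra hcon
  push Not at hcon
  choose x hxV hx u hu hlt using fun n : ℕ => hcon (1 / ((n : ℝ) + 1)) (by positivity) n
  have hxt : Tendsto (fun k => ‖ι (x k)‖) atTop atTop :=
    tendsto_atTop_mono hx tendsto_natCast_atTop_atTop
  have hun : ∀ n, 0 < ‖u n‖ := by
    intro n
    refine norm_pos_iff.2 fun h0 => ?_
    have := hlt n
    simp [h0] at this
  set v : ℕ → H := fun n => ‖u n‖⁻¹ • u n with hv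
  have hvn : ∀ n, ‖v n‖ = 1 := fun n => by
    rw [hv, norm_smul, norm_inv, norm_norm]; exact inv_mul_cancel₀ (hun n).ne'
  have hvp : ∀ n, v n ∈ Hplus Binf := fun n => Submodule.smul_mem _ _ (hu n)
  have hvlt : ∀ n : ℕ, ⟪B (x n) (v n), v n⟫ ≤ 1 / ((n : ℝ) + 1) := by
    intro n
    rw [hv]
    simp only [map_smul, real_inner_smul_left, real_inner_smul_right]
    have h1 := (hlt n).le
    have h2 : 1 / ((n : ℝ) + 1) = ‖u n‖⁻¹ * (‖u n‖⁻¹ * (1 / ((n : ℝ) + 1) * ‖u n‖ ^ 2)) := by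
      have := (hun n).ne'
      field_simp
    rw [h2]
    gcongr
  set 𝒰 : Ultrafilter ℕ := hyperfilter ℕ
  have h𝒰 : (𝒰 : Filter ℕ) ≤ atTop := Nat.hyperfilter_le_atTop
  obtain ⟨w, hw⟩ := exists_weak_limit 𝒰 (fun n => (hvn n).le)
  obtain ⟨P, Q, Pinf, Qinf, hB, hinf, -, -, -, hQc, -, hP, hQ, hC⟩ := hS.condD
  obtain ⟨c, hc, n₀, hcn⟩ := hC x hxV hxt
  obtain ⟨a, ha, hgap⟩ := hS.isCoerciveAddCompact.exists_gap_Hplus hS.selfAdjoint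
  have hwp : w ∈ Hplus Binf := by
    refine (Submodule.mem_orthogonal _ _).2 fun y hy => ?_
    have h1 : Tendsto (fun n => ⟪v n, y⟫) 𝒰 (𝓝 0) := by
      refine tendsto_const_nhds.congr fun n => ?_
      rw [real_inner_comm]
      exact ((Submodule.mem_orthogonal _ _).1 (hvp n) y hy).symm
    rw [real_inner_comm]
    exact tendsto_nhds_unique (hw y) h1
  set d : ℕ → H := fun n => v n - w with hd
  have hdn : ∀ n, ‖d n‖ ≤ 1 + ‖w‖ := fun n => by
    rw [← hvn n]; exact norm_sub_le _ _
  have hdw : ∀ y, Tendsto (fun n => ⟪d n, y⟫) 𝒰 (𝓝 ⟪(0 : H), y⟫) := by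
    intro y
    have := (hw y).sub_const ⟪w, y⟫
    rw [sub_self] at this
    rw [inner_zero_left]
    refine this.congr fun n => ?_
    rw [hd, inner_sub_left]
  have hBw : Tendsto (fun n => B (x n) w) 𝒰 (𝓝 (Binf w)) := (hS.tendsto_apply hxV hxt w).mono_left h𝒰
  have t1 : Tendsto (fun n => ‖d n‖ ^ 2) 𝒰 (𝓝 (1 - ‖w‖ ^ 2)) := by
    have := ((hw w).const_mul 2).const_sub 1 |>.add_const (‖w‖ ^ 2)
    have e : 1 - 2 * ⟪w, w⟫ + ‖w‖ ^ 2 = 1 - ‖w‖ ^ 2 := by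
      rw [real_inner_self_eq_norm_sq]; ring
    rw [e] at this
    refine this.congr fun n => ?_
    rw [hd]
    simp only
    rw [norm_sub_sq_real, hvn]
    ring
  have t2 : Tendsto (fun n => ⟪(Q (x n) - Qinf) (d n), d n⟫) 𝒰 (𝓝 0) := by
    have hQt : Tendsto (fun n => ‖Q (x n) - Qinf‖) atTop (𝓝 0) := by
      rw [Metric.tendsto_nhds]
      intro ε hε
      obtain ⟨R, hR⟩ := hQ (ε / 2) (by positivity)
      filter_upwards [hxt.eventually_ge_atTop R] with k hk
      rw [dist_zero_right, norm_norm]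
      have := hR (x k) (hxV k) hk
      linarith
    have h1 := (hQt.mono_left h𝒰).mul_const ((1 + ‖w‖) ^ 2)
    rw [zero_mul] at h1
    refine squeeze_zero_norm (fun n => ?_) h1
    rw [Real.norm_eq_abs]
    refine (inner_self_apply_le _ _).trans ?_
    gcongr
    exact hdn n
  have t3 : Tendsto (fun n => ⟪Qinf (d n), d n⟫) 𝒰 (𝓝 0) := by
    have h1 := tendsto_compact_of_weak hdn hdw hQc
    rw [map_zero, tendsto_zero_iff_norm_tendsto_zero] at h1
    have h2 := h1.mul_const (1 + ‖w‖)
    rw [zero_mul] at h2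
    refine squeeze_zero_norm (fun n => ?_) h2
    refine (abs_real_inner_le_norm _ _).trans ?_
    gcongr
    exact hdn n
  have t4 : Tendsto (fun n => ⟪B (x n) w, d n⟫) 𝒰 (𝓝 0) := by
    have h1 := (tendsto_iff_norm_sub_tendsto_zero.1 hBw).mul_const (1 + ‖w‖)
    rw [zero_mul] at h1
    have h2 : Tendsto (fun n => ⟪B (x n) w - Binf w, d n⟫) 𝒰 (𝓝 0) := by
      refine squeeze_zero_norm (fun n => ?_) h1
      refine (abs_real_inner_le_norm _ _).trans ?_
      gcongr
      exact hdn n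
    have h3 := h2.add (hdw (Binf w))
    rw [inner_zero_left, add_zero] at h3
    refine h3.congr fun n => ?_
    rw [inner_sub_left, real_inner_comm (Binf w) (d n)]
    ring
  have t5 : Tendsto (fun n => ⟪B (x n) w, w⟫) 𝒰 (𝓝 ⟪Binf w, w⟫) := hBw.inner tendsto_const_nhds
  have t6 : Tendsto (fun n : ℕ => 1 / ((n : ℝ) + 1)) 𝒰 (𝓝 0) :=
    tendsto_one_div_add_atTop_nhds_zero_nat.mono_left h𝒰
  -- The form is expanded at `v n = d n + w`. Coercivity of `P (x n)` is used on `d n`; on the fixed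
  -- vector `w` the strong convergence of `B (x n)` is enough.
  have hle : ∀ᶠ n in (𝒰 : Filter ℕ), c * ‖d n‖ ^ 2 + ⟪(Q (x n) - Qinf) (d n), d n⟫ +
      ⟪Qinf (d n), d n⟫ + 2 * ⟪B (x n) w, d n⟫ + ⟪B (x n) w, w⟫ ≤ 1 / ((n : ℝ) + 1) := by
    have : ∀ᶠ n in (𝒰 : Filter ℕ), n₀ ≤ n := h𝒰 (eventually_ge_atTop n₀)
    filter_upwards [this] with n hn
    refine le_trans ?_ (hvlt n)
    have e1 : v n = d n + w := by rw [hd]; simp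
    have e2 : ⟪B (x n) (d n), w⟫ = ⟪B (x n) w, d n⟫ := by
      rw [inner_apply_comm (hS.condF3.1 _ (hxV n)), real_inner_comm]
    have e3 : ⟪B (x n) (d n), d n⟫ = ⟪P (x n) (d n), d n⟫ + ⟪Q (x n) (d n), d n⟫ := by
      rw [hB _ (hxV n), add_apply, inner_add_left]
    rw [e1, map_add, inner_add_left, inner_add_right, inner_add_right, e2, e3, sub_apply,
      inner_sub_left]
    have := hcn n hn (d n)
    linarith
  have hfin := le_of_tendsto_of_tendsto
    (((((t1.const_mul c).add t2).add t3).add (t4.const_mul 2)).add t5) t6 hle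
  have hw1 := hgap w hwp
  have hw2 : ‖w‖ ^ 2 ≤ 1 := by
    have := ge_of_tendsto t1 (Eventually.of_forall fun n => by positivity)
    linarith
  have hm1 : min a c ≤ a := min_le_left _ _
  have hm2 : min a c ≤ c := min_le_right _ _
  have hm : 0 < min a c := lt_min ha hc
  nlinarith [sq_nonneg ‖w‖]

/-- Near infinity `B(x)` is uniformly positive on `H⁺` and uniformly negative on `H⁻`. -/
theorem exists_gaps_near_infinity :
    ∃ a : ℝ, 0 < a ∧ ∃ R : ℝ, ∀ x : X, ι x ∈ V → R ≤ ‖ι x‖ →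
      (∀ u ∈ Hplus Binf, a * ‖u‖ ^ 2 ≤ ⟪B x u, u⟫) ∧
      ∀ u ∈ Hminus Binf, ⟪B x u, u⟫ ≤ -(a * ‖u‖ ^ 2) := by
  have := hS.finiteDimensional_sup
  have : FiniteDimensional ℝ (Hminus Binf) := finiteDimensional_Hminus
  obtain ⟨a₁, ha₁, R₁, h₁⟩ := hS.exists_gap_Hplus_near_infinity
  obtain ⟨a₂, ha₂, h₂⟩ := exists_gap_Hminus hS.selfAdjoint
  obtain ⟨R₂, hR₂⟩ := hS.exists_radius_norm_sub_le (by positivity : 0 < a₂ / 2)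
  refine ⟨min a₁ (a₂ / 2), lt_min ha₁ (by positivity), max R₁ R₂, fun x hxV hx =>
    ⟨fun u hu => ?_, fun u hu => ?_⟩⟩
  · refine le_trans ?_ (h₁ x hxV ((le_max_left _ _).trans hx) u hu)
    gcongr
    exact min_le_left _ _
  · have k1 := hR₂ x hxV ((le_max_right _ _).trans hx) u (Submodule.mem_sup_right hu)
    have k2 := h₂ u hu
    have k3 := (le_abs_self _).trans (abs_real_inner_le_norm (B x u - Binf u) u)
    rw [inner_sub_left] at k3
    have k4 : ‖B x u - Binf u‖ * ‖u‖ ≤ a₂ / 2 * ‖u‖ ^ 2 := by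
      rw [pow_two, ← mul_assoc]; gcongr
    have k5 : min a₁ (a₂ / 2) * ‖u‖ ^ 2 ≤ a₂ / 2 * ‖u‖ ^ 2 := by
      gcongr; exact min_le_right _ _
    linarith

end Setting

end Setting

end SplitInf

namespace SplitInf

/-! ### The reduction to the kernel -/

section Reduction

variable {H X : Type*} [NormedAddCommGroup H] [InnerProductSpace ℝ H] [CompleteSpace H]
  [NormedAddCommGroup X] [NormedSpace ℝ X]
  {ι : X →L[ℝ] H} {V : Set H} {L : H → ℝ} {A : X → X} {B : X → H →L[ℝ] H} {Binf : H →L[ℝ] H}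

theorem isClosed_Xpm : IsClosed (Xpm ι Binf : Set X) :=
  (Submodule.isClosed_orthogonal (H0 Binf)).preimage ι.continuous

instance [CompleteSpace X] : CompleteSpace (Xpm ι Binf) := isClosed_Xpm.completeSpace_coe

theorem mem_H0 (z : X0 ι Binf) : ι (z : X) ∈ H0 Binf := z.2

theorem mem_Hpm (x : Xpm ι Binf) : ι (x : X) ∈ Hpm Binf := x.2

theorem norm_le_norm_add (z : X0 ι Binf) (x : Xpm ι Binf) :
    ‖ι (z : X)‖ ≤ ‖ι ((z : X) + x)‖ := by
  have h := norm_P0_le (T := Binf) (ι ((z : X) + x))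
  rwa [map_add, P0_add_of_mem (mem_H0 z) (mem_Hpm x), ← map_add] at h

namespace Setting

variable (hS : Setting ι V L A B Binf)
include hS

/-- On the finite-dimensional space `H⁰ ⊕ H⁻`, which lies in `X`, the inverse of `ι` is
automatically continuous; this is how its `H`- and `X`-topologies are identified. -/
theorem exists_lift : ∃ σ : (H0 Binf ⊔ Hminus Binf : Submodule ℝ H) →L[ℝ] X,
    ∀ w, ι (σ w) = w := by
  have := hS.finiteDimensional_sup
  choose f hf using fun w : (H0 Binf ⊔ Hminus Binf : Submodule ℝ H) => hS.mem_range_of_mem_sup w.2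
  let g : (H0 Binf ⊔ Hminus Binf : Submodule ℝ H) →ₗ[ℝ] X :=
    { toFun := f
      map_add' := fun a b => hS.injective (by rw [map_add, hf, hf, hf]; rfl)
      map_smul' := fun c a => hS.injective (by rw [map_smul, hf, hf]; rfl) }
  exact ⟨LinearMap.toContinuousLinearMap g, hf⟩

/-- The inverse of the inclusion on `H⁰ ⊕ H⁻`. -/
noncomputable def lift : (H0 Binf ⊔ Hminus Binf : Submodule ℝ H) →L[ℝ] X := hS.exists_lift.choose

theorem apply_lift (w : (H0 Binf ⊔ Hminus Binf : Submodule ℝ H)) : ι (hS.lift w) = w :=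
  hS.exists_lift.choose_spec w

theorem lift_eq {w : (H0 Binf ⊔ Hminus Binf : Submodule ℝ H)} {x : X} (h : ι x = w) :
    hS.lift w = x := hS.injective (by rw [hS.apply_lift, h])

/-- The projection of `X` onto `H⁰`. -/
noncomputable def pr : X →L[ℝ] X0 ι Binf :=
  (hS.lift.comp (((P0 Binf).comp ι).codRestrict _
    fun x => Submodule.mem_sup_left (P0_mem (ι x)))).codRestrict _ fun x => by
      change ι (hS.lift _) ∈ H0 Binf
      rw [hS.apply_lift]
      exact P0_mem (ι x)

theorem apply_pr (x : X) : ι (hS.pr x : X) = P0 Binf (ι x) := hS.apply_lift _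

/-- The projection `I - P⁰` of `X` onto `X^±`. -/
noncomputable def pm : X →L[ℝ] Xpm ι Binf :=
  (ContinuousLinearMap.id ℝ X - (X0 ι Binf).subtypeL.comp hS.pr).codRestrict _ fun x => by
    change ι (x - (hS.pr x : X)) ∈ Hpm Binf
    rw [map_sub, hS.apply_pr]
    exact sub_P0_mem (ι x)

theorem coe_pm (x : X) : (hS.pm x : X) = x - hS.pr x := rfl

theorem apply_pm (x : X) : ι (hS.pm x : X) = ι x - P0 Binf (ι x) := by
  rw [hS.coe_pm, map_sub, hS.apply_pr]

theorem pmPart_eq (x : X) : pmPart ι Binf x = hS.pm x :=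
  hS.injective (by rw [apply_pmPart hS.condC2, hS.apply_pm])

theorem pm_of_mem (x : Xpm ι Binf) : hS.pm (x : X) = x := by
  refine Subtype.ext (hS.injective ?_)
  rw [hS.apply_pm, P0_eq_zero_iff.2 (mem_Hpm x), sub_zero]

theorem pm_eq_zero_iff {x : X} : hS.pm x = 0 ↔ ι x ∈ H0 Binf := by
  rw [← Submodule.coe_eq_zero, ← map_eq_zero_iff ι hS.injective, hS.apply_pm]
  constructor
  · intro h
    rw [sub_eq_zero.1 h]
    exact P0_mem _
  · intro h
    rw [P0_of_mem_H0 h, sub_self]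

theorem finiteDimensional_X0 : FiniteDimensional ℝ (X0 ι Binf) := by
  have := hS.finiteDimensional_sup
  refine LinearMap.finiteDimensional_of_surjective
    ((hS.pr.comp hS.lift : _ →L[ℝ] _) : (H0 Binf ⊔ Hminus Binf : Submodule ℝ H) →ₗ[ℝ] X0 ι Binf)
    (LinearMap.range_eq_top.2 fun z => ?_)
  refine ⟨⟨ι z, Submodule.mem_sup_left (mem_H0 z)⟩, Subtype.ext (hS.injective ?_)⟩
  change ι (hS.pr (hS.lift _) : X) = ι z
  rw [hS.apply_pr, hS.apply_lift]
  exact P0_of_mem_H0 (mem_H0 z)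

theorem exists_norm_le : ∃ c : ℝ, 0 < c ∧ ∀ z : X0 ι Binf, ‖z‖ ≤ c * ‖ι (z : X)‖ := by
  refine ⟨‖hS.lift‖ + 1, by positivity, fun z => ?_⟩
  have h1 := hS.lift.le_opNorm ⟨ι z, Submodule.mem_sup_left (mem_H0 z)⟩
  rw [hS.lift_eq rfl] at h1
  refine h1.trans ?_
  rw [Submodule.coe_norm]
  gcongr
  linarith

theorem BX_mem (x : Xpm ι Binf) : BX ι Binf (x : X) ∈ Xpm ι Binf := by
  change ι (BX ι Binf (x : X)) ∈ Hpm Binf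
  rw [apply_BX hS.condF3.2.2.1]
  exact apply_mem_Hpm hS.selfAdjoint _

/-- The operator `B(∞)` on `X^±`. -/
noncomputable def BpmLinear : Xpm ι Binf →ₗ[ℝ] Xpm ι Binf where
  toFun x := ⟨BX ι Binf (x : X), hS.BX_mem x⟩
  map_add' x y := Subtype.ext (hS.injective (by
    simp [apply_BX hS.condF3.2.2.1]))
  map_smul' c x := Subtype.ext (hS.injective (by
    simp [apply_BX hS.condF3.2.2.1]))

theorem apply_BpmLinear (x : Xpm ι Binf) : ι (hS.BpmLinear x : X) = Binf (ι (x : X)) :=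
  apply_BX hS.condF3.2.2.1 _

theorem eq_zero_of_apply_eq_zero {x : Xpm ι Binf} (h : Binf (ι (x : X)) = 0) : x = 0 := by
  have h1 : ι (x : X) ∈ H0 Binf := LinearMap.mem_ker.2 h
  have h2 : P0 Binf (ι (x : X)) = 0 := P0_eq_zero_iff.2 (mem_Hpm x)
  rw [P0_of_mem_H0 h1] at h2
  exact Subtype.ext (hS.injective (by rw [h2]; simp))

/-- A preimage exists in `H^±` by Lax–Milgram, and (C2) places it in `X`. Injectivity holds since
`H⁰ ∩ H^± = 0`. -/
theorem bijective_BpmLinear : Function.Bijective hS.BpmLinear := by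
  have := hS.finiteDimensional_sup
  have : FiniteDimensional ℝ (Hminus Binf) := finiteDimensional_Hminus
  constructor
  · refine (injective_iff_map_eq_zero _).2 fun x hx => hS.eq_zero_of_apply_eq_zero ?_
    rw [← hS.apply_BpmLinear, hx]; simp
  · intro y
    obtain ⟨u, hu, huy⟩ := hS.isCoerciveAddCompact.exists_apply_eq hS.selfAdjoint y.2
    obtain ⟨x, rfl⟩ := hS.condC2 u ⟨y, huy.symm⟩
    exact ⟨⟨x, hu⟩, Subtype.ext (hS.injective (by rw [hS.apply_BpmLinear, huy]; rfl))⟩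

/-- Testing against the dense subspace `X` identifies the two vectors of `H`. Consequently the
directional derivative of `A` is linear in the direction. -/
theorem lineDeriv_apply {x : X} (hx : ι x ∈ V) (u : X) : ι (lineDeriv ℝ A x u) = B x (ι u) := by
  refine hS.denseRange.eq_of_inner_right ℝ ?_
  intro w
  rw [real_inner_comm, real_inner_comm (B x (ι u))]
  exact hS.condF3.2.2.2 x hx u w

theorem isOpen_preimage : IsOpen (ι ⁻¹' V) := hS.isOpen.preimage ι.continuous

/-- The derivative of `A`. -/
theorem exists_dA {x : X} (hx : ι x ∈ V) : ∃ D : X →L[ℝ] X, ∀ u, D u = lineDeriv ℝ A x u := by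
  refine ⟨⟨{ toFun := fun u => lineDeriv ℝ A x u
             map_add' := fun u v => hS.injective ?_
             map_smul' := fun c u => lineDeriv_smul }, ?_⟩, fun u => rfl⟩
  · simp only [map_add, hS.lineDeriv_apply hx]
  · have h1 := hS.condF2.1.2.2
    exact h1.comp_continuous (by fun_prop : Continuous fun u : X => (x, u))
      fun u => ⟨hx, mem_univ _⟩

theorem continuousOn_A : ContinuousOn A (ι ⁻¹' V) := hS.condF2.1.1

variable [CompleteSpace X]

/-- Closed graph theorem: limits in `X` are also limits in `H`, where `B(∞)` is continuous. -/
theorem continuous_BpmLinear : Continuous hS.BpmLinear := by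
  refine LinearMap.continuous_of_seq_closed_graph _ fun u x y hu hy => ?_
  refine Subtype.ext (hS.injective ?_)
  rw [hS.apply_BpmLinear]
  have hc : Continuous fun x : Xpm ι Binf => ι (x : X) := by fun_prop
  have h1 : Tendsto (fun n => ι (hS.BpmLinear (u n) : X)) atTop (𝓝 (ι (y : X))) :=
    (hc.tendsto y).comp hy
  have h2 : Tendsto (fun n => Binf (ι (u n : X))) atTop (𝓝 (Binf (ι (x : X)))) :=
    ((Binf.continuous.comp hc).tendsto x).comp hu
  simp only [hS.apply_BpmLinear] at h1
  exact tendsto_nhds_unique h1 h2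

/-- The isomorphism `B(∞)` of `X^±`. -/
noncomputable def Bpm : Xpm ι Binf ≃L[ℝ] Xpm ι Binf :=
  ContinuousLinearEquiv.ofBijective ⟨hS.BpmLinear, hS.continuous_BpmLinear⟩
    (LinearMap.ker_eq_bot.2 hS.bijective_BpmLinear.1)
    (LinearMap.range_eq_top.2 hS.bijective_BpmLinear.2)

theorem coe_Bpm (x : Xpm ι Binf) : (hS.Bpm x : X) = BX ι Binf (x : X) := rfl

theorem apply_Bpm (x : Xpm ι Binf) : ι (hS.Bpm x : X) = Binf (ι (x : X)) :=
  apply_BX hS.condF3.2.2.1 _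

omit [CompleteSpace X] hS in
theorem C1_nonneg : 0 ≤ C1 ι Binf := Real.sInf_nonneg fun _ h => h.1

/-- The infimum defining `C1` is attained: the set of admissible constants contains the norm of the
bounded inverse, and the inequality for a fixed `y` is closed in the constant. -/
theorem norm_symm_le (y : Xpm ι Binf) : ‖hS.Bpm.symm y‖ ≤ C1 ι Binf * ‖y‖ := by
  set S := {c : ℝ | 0 ≤ c ∧
    ∀ x ∈ Xpm ι Binf, ∀ y ∈ Xpm ι Binf, Binf (ι x) = ι y → ‖x‖ ≤ c * ‖y‖} with hSdef
  have hne : S.Nonempty := by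
    refine ⟨‖(hS.Bpm.symm : Xpm ι Binf →L[ℝ] Xpm ι Binf)‖,
      ContinuousLinearMap.opNorm_nonneg _, fun x hx y hy h => ?_⟩
    have h1 := (hS.Bpm.symm : Xpm ι Binf →L[ℝ] Xpm ι Binf).le_opNorm ⟨y, hy⟩
    have h2 : hS.Bpm.symm ⟨y, hy⟩ = ⟨x, hx⟩ := by
      rw [ContinuousLinearEquiv.symm_apply_eq]
      exact Subtype.ext (hS.injective (by rw [hS.apply_Bpm, h]))
    rw [ContinuousLinearEquiv.coe_coe, h2] at h1
    exact h1
  have hall : ∀ c ∈ S, ‖hS.Bpm.symm y‖ ≤ c * ‖y‖ := fun c hc =>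
    hc.2 _ (hS.Bpm.symm y).2 (y : X) y.2 (by
      rw [← hS.apply_Bpm, ContinuousLinearEquiv.apply_symm_apply])
  rcases (norm_nonneg y).eq_or_lt with h0 | h0
  · obtain ⟨c, hc⟩ := hne
    have := hall c hc
    rw [← h0, mul_zero] at this ⊢
    exact this
  · rw [← div_le_iff₀ h0]
    exact le_csInf hne fun c hc => (div_le_iff₀ h0).2 (hall c hc)

theorem rem_eq (z : X0 ι Binf) (x : Xpm ι Binf) :
    rem ι Binf A z x = ((hS.pm (A ((z : X) + x)) - hS.Bpm x : Xpm ι Binf) : X) := by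
  rw [rem, hS.pmPart_eq, ← hS.coe_Bpm]; rfl

end Setting

/-- `h` solves the equation `(I - P⁰) A (z + h z) = 0` for `z ∈ H⁰` outside of the ball of radius
`R`, and the solution is stable. -/
structure IsReduction (hS : Setting ι V L A B Binf) [CompleteSpace X] (ρ : ℝ≥0∞) (R q : ℝ)
    (h : X0 ι Binf → Xpm ι Binf) : Prop where
  nonneg : 0 ≤ q
  lt_one : q < 1
  pos : 0 < R
  mem : ∀ z : X0 ι Binf, R ≤ ‖ι (z : X)‖ → ∀ x : Xpm ι Binf, ι ((z : X) + x) ∈ V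
  norm_lt : ∀ z : X0 ι Binf, R ≤ ‖ι (z : X)‖ → ‖h z‖ₑ < ρ
  eq_zero : ∀ z : X0 ι Binf, R ≤ ‖ι (z : X)‖ → hS.pm (A ((z : X) + h z)) = 0
  contraction : ∀ z : X0 ι Binf, R ≤ ‖ι (z : X)‖ → ∀ x₁ x₂ : Xpm ι Binf, ‖x₁‖ₑ ≤ ρ → ‖x₂‖ₑ ≤ ρ →
    ‖x₁ - x₂ - hS.Bpm.symm (hS.pm (A ((z : X) + x₁)) - hS.pm (A ((z : X) + x₂)))‖ ≤ q * ‖x₁ - x₂‖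

/-- The contraction principle on a ball. -/
theorem exists_fixedPoint {E : Type*} [NormedAddCommGroup E] [CompleteSpace E]
    {G : E → E} {q m : ℝ} {ρ : ℝ≥0∞} (hq0 : 0 ≤ q) (hq : q < 1)
    (hG : ∀ x₁ x₂, ‖x₁‖ₑ ≤ ρ → ‖x₂‖ₑ ≤ ρ → ‖G x₁ - G x₂‖ ≤ q * ‖x₁ - x₂‖) (hm : ‖G 0‖ ≤ m)
    (hρ : ENNReal.ofReal (m / (1 - q)) < ρ) : ∃ x, ‖x‖ₑ < ρ ∧ G x = x := by
  set s := m / (1 - q) with hs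
  have h1q : 0 < 1 - q := by linarith
  have hm0 : 0 ≤ m := (norm_nonneg _).trans hm
  have hs0 : 0 ≤ s := by positivity
  have hball : ∀ x ∈ Metric.closedBall (0 : E) s, ‖x‖ₑ < ρ := by
    intro x hx
    rw [mem_closedBall_zero_iff] at hx
    rw [← ofReal_norm]
    exact (ENNReal.ofReal_le_ofReal hx).trans_lt hρ
  have h0 : (0 : E) ∈ Metric.closedBall (0 : E) s := by simpa using hs0
  have hmaps : MapsTo G (Metric.closedBall 0 s) (Metric.closedBall 0 s) := by
    intro x hx
    have h1 := hG x 0 (hball x hx).le (hball 0 h0).le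
    rw [mem_closedBall_zero_iff] at hx ⊢
    rw [sub_zero] at h1
    have h2 : ‖G x‖ ≤ ‖G x - G 0‖ + ‖G 0‖ := by simpa using norm_add_le (G x - G 0) (G 0)
    have h3 : q * ‖x‖ ≤ q * s := by gcongr
    have h4 : m = s * (1 - q) := by rw [hs]; field_simp
    linarith
  have hcontr : ContractingWith q.toNNReal (hmaps.restrict G _ _) := by
    refine ⟨by rw [← Real.toNNReal_one]; exact (Real.toNNReal_lt_toNNReal_iff one_pos).2 hq,
      LipschitzWith.of_dist_le_mul fun x y => ?_⟩
    rw [Real.coe_toNNReal q hq0, Subtype.dist_eq, Subtype.dist_eq, dist_eq_norm, dist_eq_norm]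
    exact hG x y (hball x x.2).le (hball y y.2).le
  obtain ⟨x, hx, hfix, -⟩ := hcontr.exists_fixedPoint' (Metric.isClosed_closedBall.isComplete)
    hmaps h0 (edist_ne_top _ _)
  exact ⟨x, hball x hx, hfix⟩

theorem exists_radius_of_MA_lt (hS : Setting ι V L A B Binf) {c : ℝ} (hc : 0 ≤ c) {ρ : ℝ≥0∞}
    (h : ρ = ∞ ∨ ENNReal.ofReal c * MA ι Binf A < ρ) :
    ∃ R : ℝ, ∀ z : X0 ι Binf, R ≤ ‖z‖ → ENNReal.ofReal (c * ‖hS.pm (A (z : X))‖) < ρ := by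
  rcases h with rfl | h
  · exact ⟨0, fun z _ => ENNReal.ofReal_lt_top⟩
  rcases hc.eq_or_lt with rfl | hc
  · refine ⟨0, fun z _ => ?_⟩
    simpa using h
  have hc' : ENNReal.ofReal c ≠ 0 := by simpa using hc
  rw [mul_comm, ← ENNReal.lt_div_iff_mul_lt (Or.inl hc') (Or.inl ENNReal.ofReal_ne_top), MA,
    iInf_lt_iff] at h
  obtain ⟨R, hR⟩ := h
  refine ⟨R, fun z hz => ?_⟩
  have h1 : ‖pmPart ι Binf (A (z : X))‖ₑ < ρ / ENNReal.ofReal c :=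
    (le_iSup₂_of_le z hz le_rfl).trans_lt hR
  rw [ENNReal.lt_div_iff_mul_lt (Or.inl hc') (Or.inl ENNReal.ofReal_ne_top), hS.pmPart_eq,
    ← ofReal_norm, mul_comm, ← ENNReal.ofReal_mul hc.le] at h1
  exact h1

theorem CondE.condE' {ρ : ℝ≥0∞} (h : CondE ι V A Binf ρ) : CondE' ι V A Binf ρ := by
  obtain ⟨R, hR, κ, hκ, hρ, h⟩ := h
  refine ⟨R, hR, κ, hκ, hρ, fun z x₁ x₂ hz h₁ h₂ hm₁ hm₂ => ?_⟩
  have := h z z x₁ x₂ hz hz h₁ h₂ hm₁ hm₂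
  rwa [add_sub_add_left_eq_sub] at this

/-- An inequality because of `c = 0`, where `1 / 0 = 0`; this lets the case `X^± = 0` run along with
the others. -/
theorem mul_one_div_le {c κ : ℝ} (hc : 0 ≤ c) (hκ : 1 < κ) : c * (1 / (κ * c)) ≤ 1 / κ := by
  rcases hc.eq_or_lt with rfl | hc
  · simp; positivity
  · refine le_of_eq ?_; field_simp

namespace Setting

variable (hS : Setting ι V L A B Binf) [CompleteSpace X]
include hS

theorem sub_symm_pm_eq (z : X0 ι Binf) (x₁ x₂ : Xpm ι Binf) :
    x₁ - x₂ - hS.Bpm.symm (hS.pm (A ((z : X) + x₁)) - hS.pm (A ((z : X) + x₂))) =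
      - hS.Bpm.symm ((hS.pm (A ((z : X) + x₁)) - hS.Bpm x₁) -
        (hS.pm (A ((z : X) + x₂)) - hS.Bpm x₂)) := by
  simp only [map_sub, ContinuousLinearEquiv.symm_apply_apply]; abel

/-- The bound of (E') on the closed ball. -/
theorem contraction_of_condE' {ρ : ℝ≥0∞} {R₁ κ : ℝ} (hκ : 1 < κ) (hρ : 0 < ρ)
    (h : ∀ (z : X0 ι Binf) (x₁ x₂ : Xpm ι Binf), R₁ ≤ ‖ι (z : X)‖ →
      ‖x₁‖ₑ < ρ → ‖x₂‖ₑ < ρ → ι ((z : X) + x₁) ∈ V → ι ((z : X) + x₂) ∈ V →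
      ‖rem ι Binf A z x₁ - rem ι Binf A z x₂‖ ≤ 1 / (κ * C1 ι Binf) * ‖x₁ - x₂‖)
    {z : X0 ι Binf} (hz : R₁ ≤ ‖ι (z : X)‖) (hV : ∀ x : Xpm ι Binf, ι ((z : X) + x) ∈ V)
    (x₁ x₂ : Xpm ι Binf) (h₁ : ‖x₁‖ₑ ≤ ρ) (h₂ : ‖x₂‖ₑ ≤ ρ) :
    ‖x₁ - x₂ - hS.Bpm.symm (hS.pm (A ((z : X) + x₁)) - hS.pm (A ((z : X) + x₂)))‖ ≤
      1 / κ * ‖x₁ - x₂‖ := by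
  have hopen : ∀ x₁ x₂ : Xpm ι Binf, ‖x₁‖ₑ < ρ → ‖x₂‖ₑ < ρ →
      ‖x₁ - x₂ - hS.Bpm.symm (hS.pm (A ((z : X) + x₁)) - hS.pm (A ((z : X) + x₂)))‖ ≤
      1 / κ * ‖x₁ - x₂‖ := by
    intro x₁ x₂ h₁ h₂
    rw [hS.sub_symm_pm_eq, norm_neg]
    refine (hS.norm_symm_le _).trans ?_
    have h3 := h z x₁ x₂ hz h₁ h₂ (hV x₁) (hV x₂)
    rw [hS.rem_eq, hS.rem_eq, ← Submodule.coe_sub, ← Submodule.coe_norm] at h3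
    refine (mul_le_mul_of_nonneg_left h3 C1_nonneg).trans ?_
    rw [← mul_assoc]
    gcongr
    exact mul_one_div_le C1_nonneg hκ
  have hcont : Continuous fun x : Xpm ι Binf => hS.pm (A ((z : X) + x)) :=
    hS.pm.continuous.comp (hS.continuousOn_A.comp_continuous (by fun_prop) hV)
  -- Points of the closed ball are approximated by `t • x` with `t < 1`, which lie in the open ball.
  have hc2 : ∀ x : Xpm ι Binf, Tendsto (fun t : ℝ => t • x) (𝓝[<] 1) (𝓝 x) := by
    intro x
    have : Continuous fun t : ℝ => t • x := by fun_prop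
    have := this.tendsto 1
    rw [one_smul] at this
    exact this.mono_left nhdsWithin_le_nhds
  have hlt : ∀ x : Xpm ι Binf, ‖x‖ₑ ≤ ρ → ∀ t ∈ Ioo (0 : ℝ) 1, ‖t • x‖ₑ < ρ := by
    intro x hx t ht
    rcases eq_or_ne x 0 with rfl | h0
    · simpa using hρ
    refine lt_of_lt_of_le ?_ hx
    rw [← ofReal_norm, ← ofReal_norm, norm_smul, Real.norm_of_nonneg ht.1.le]
    have hn : 0 < ‖x‖ := norm_pos_iff.2 h0
    exact (ENNReal.ofReal_lt_ofReal_iff hn).2 (by nlinarith [ht.2])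
  have hc3 : Continuous fun p : Xpm ι Binf × Xpm ι Binf =>
      ‖p.1 - p.2 - hS.Bpm.symm (hS.pm (A ((z : X) + p.1)) - hS.pm (A ((z : X) + p.2)))‖ := by
    have a1 := hcont.comp (continuous_fst (X := Xpm ι Binf) (Y := Xpm ι Binf))
    have a2 := hcont.comp (continuous_snd (X := Xpm ι Binf) (Y := Xpm ι Binf))
    exact ((continuous_fst.sub continuous_snd).sub
      (hS.Bpm.symm.continuous.comp (a1.sub a2))).norm
  have hc4 : Continuous fun p : Xpm ι Binf × Xpm ι Binf => 1 / κ * ‖p.1 - p.2‖ := by fun_prop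
  have hpt : Tendsto (fun t : ℝ => (t • x₁, t • x₂)) (𝓝[<] 1) (𝓝 (x₁, x₂)) :=
    (hc2 x₁).prodMk_nhds (hc2 x₂)
  refine le_of_tendsto_of_tendsto ((hc3.tendsto _).comp hpt) ((hc4.tendsto _).comp hpt) ?_
  filter_upwards [Ioo_mem_nhdsLT (zero_lt_one' ℝ)] with t ht
  exact hopen _ _ (hlt x₁ h₁ t ht) (hlt x₂ h₂ t ht)

/-- The map `x ↦ x - B(∞)⁻¹ (I - P⁰) A (z + x)` contracts with constant `1 / κ` and sends `0` to a
point of norm at most `C₁ ‖(I - P⁰) A z‖`. Its fixed point therefore has norm at most `κ / (κ - 1)`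
times this, which is below `ρ` for large `z` by the condition on `M(A)`. -/
theorem exists_isReduction {ρ : ℝ≥0∞} (hE : CondE' ι V A Binf ρ) :
    ∃ (R₀ q : ℝ) (h : X0 ι Binf → Xpm ι Binf), IsReduction hS ρ R₀ q h := by
  obtain ⟨R₁, hR₁, κ, hκ, hM, hE⟩ := hE
  obtain ⟨r, hr⟩ := hS.exterior_subset
  have hκ1 : 0 < κ - 1 := by linarith
  have hκ0 : 0 < κ := by linarith
  have hC1 : 0 ≤ C1 ι Binf := C1_nonneg
  have hρ : 0 < ρ := by
    rcases hM with rfl | h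
    · exact ENNReal.coe_lt_top
    · exact pos_of_gt h
  obtain ⟨R₂, hR₂⟩ := exists_radius_of_MA_lt hS (by positivity : 0 ≤ κ / (κ - 1) * C1 ι Binf) hM
  -- The term `r + 1` keeps the points in `V`. The term `‖ι‖ * |R₂|` turns largeness in the norm of
  -- `H` into `R₂ ≤ ‖z‖` in the norm of `X`, as required by `M(A)`.
  set R₀ : ℝ := max R₁ (max (r + 1) (‖ι‖ * |R₂|)) + 1
  have hV : ∀ z : X0 ι Binf, R₀ ≤ ‖ι (z : X)‖ → ∀ x : Xpm ι Binf, ι ((z : X) + x) ∈ V := by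
    intro z hz x
    refine hr ?_
    have h1 := norm_le_norm_add z x
    have h2 : r + 1 ≤ R₀ := by
      have := (le_max_left (r + 1) (‖ι‖ * |R₂|)).trans (le_max_right R₁ _)
      linarith
    rw [mem_ofPred_eq]
    linarith
  have hR01 : R₁ ≤ R₀ := by
    have := le_max_left R₁ (max (r + 1) (‖ι‖ * |R₂|))
    linarith
  have hR02 : ∀ z : X0 ι Binf, R₀ ≤ ‖ι (z : X)‖ → R₂ ≤ ‖z‖ := by
    intro z hz
    have h1 := (le_max_right (r + 1) (‖ι‖ * |R₂|)).trans (le_max_right R₁ _)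
    have h2 := ι.le_opNorm (z : X)
    have h3 : ‖ι‖ * |R₂| < ‖ι‖ * ‖(z : X)‖ := by linarith
    exact (le_abs_self R₂).trans (lt_of_mul_lt_mul_left h3 (norm_nonneg _)).le
  have hcon := fun (z : X0 ι Binf) (hz : R₀ ≤ ‖ι (z : X)‖) =>
    hS.contraction_of_condE' hκ hρ hE (hR01.trans hz) (hV z hz)
  have hex : ∀ z : X0 ι Binf, ∃ x : Xpm ι Binf, R₀ ≤ ‖ι (z : X)‖ →
      ‖x‖ₑ < ρ ∧ hS.pm (A ((z : X) + x)) = 0 := by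
    intro z
    by_cases hz : R₀ ≤ ‖ι (z : X)‖
    · obtain ⟨x, hx, hfix⟩ := exists_fixedPoint (q := 1 / κ) (ρ := ρ)
        (m := C1 ι Binf * ‖hS.pm (A (z : X))‖)
        (G := fun x : Xpm ι Binf => x - hS.Bpm.symm (hS.pm (A ((z : X) + x)))) (by positivity)
        ((div_lt_one hκ0).2 hκ)
        (fun x₁ x₂ h₁ h₂ => by
          have := hcon z hz x₁ x₂ h₁ h₂
          rwa [map_sub, sub_sub_sub_comm] at this)
        (by simpa using hS.norm_symm_le (hS.pm (A (z : X))))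
        (by
          have h1 := hR₂ z (hR02 z hz)
          convert h1 using 2
          field_simp)
      refine ⟨x, fun _ => ⟨hx, ?_⟩⟩
      have h1 : hS.Bpm.symm (hS.pm (A ((z : X) + x))) = 0 := by simpa using hfix
      simpa using h1
    · exact ⟨0, fun h => absurd h hz⟩
  choose h hh using hex
  exact ⟨R₀, 1 / κ, h, ⟨by positivity, (div_lt_one hκ0).2 hκ, by
    have := (hR₁.le).trans (le_max_left R₁ (max (r + 1) (‖ι‖ * |R₂|)))
    linarith, hV, fun z hz => (hh z hz).1, fun z hz => (hh z hz).2, hcon⟩⟩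

end Setting

namespace IsReduction

variable {hS : Setting ι V L A B Binf} [CompleteSpace X] {ρ : ℝ≥0∞} {R q : ℝ}
  {h : X0 ι Binf → Xpm ι Binf} (hh : IsReduction hS ρ R q h)
include hh

theorem mono {R' : ℝ} (hR : R ≤ R') : IsReduction hS ρ R' q h where
  nonneg := hh.nonneg
  lt_one := hh.lt_one
  pos := hh.pos.trans_le hR
  mem z hz := hh.mem z (hR.trans hz)
  norm_lt z hz := hh.norm_lt z (hR.trans hz)
  eq_zero z hz := hh.eq_zero z (hR.trans hz)
  contraction z hz := hh.contraction z (hR.trans hz)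

/-- A posteriori estimate of the contraction principle: any `x` in the closed ball is within a
constant times its residual of the solution. Good guesses for `h z` thus become estimates for `h`.
-/
theorem norm_sub_le {z : X0 ι Binf} (hz : R ≤ ‖ι (z : X)‖) {x : Xpm ι Binf} (hx : ‖x‖ₑ ≤ ρ) :
    ‖x - h z‖ ≤ C1 ι Binf / (1 - q) * ‖hS.pm (A ((z : X) + x))‖ := by
  have h1 := hh.contraction z hz x (h z) hx (hh.norm_lt z hz).le
  rw [hh.eq_zero z hz, sub_zero] at h1
  have h2 := hS.norm_symm_le (hS.pm (A ((z : X) + x)))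
  have h3 : ‖x - h z‖ ≤ ‖x - h z - hS.Bpm.symm (hS.pm (A ((z : X) + x)))‖ +
      ‖hS.Bpm.symm (hS.pm (A ((z : X) + x)))‖ := by
    simpa using norm_add_le (x - h z - hS.Bpm.symm (hS.pm (A ((z : X) + x))))
      (hS.Bpm.symm (hS.pm (A ((z : X) + x))))
  have hq : 0 < 1 - q := by linarith [hh.lt_one]
  rw [div_mul_eq_mul_div, le_div_iff₀ hq]
  linarith

theorem unique {z : X0 ι Binf} (hz : R ≤ ‖ι (z : X)‖) {x : Xpm ι Binf} (hx : ‖x‖ₑ ≤ ρ)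
    (h0 : hS.pm (A ((z : X) + x)) = 0) : x = h z := by
  have := hh.norm_sub_le hz hx
  rw [h0, norm_zero, mul_zero] at this
  exact sub_eq_zero.1 (norm_le_zero_iff.1 this)

theorem norm_le {z : X0 ι Binf} (hz : R ≤ ‖ι (z : X)‖) :
    ‖h z‖ ≤ C1 ι Binf / (1 - q) * ‖hS.pm (A (z : X))‖ := by
  have := hh.norm_sub_le hz (x := 0) (by simp)
  simpa using this

/-- The frozen value `h z₀` is a guess for `h z`; its residual at `z` tends to zero as `z → z₀` by
continuity of `A`. -/
theorem continuousOn : ContinuousOn h (closedExtBall ι Binf R) := by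
  intro z₀ hz₀
  rw [ContinuousWithinAt, tendsto_iff_norm_sub_tendsto_zero]
  have hc : ContinuousAt (fun z : X0 ι Binf => hS.pm (A ((z : X) + h z₀))) z₀ := by
    refine hS.pm.continuous.continuousAt.comp ?_
    exact ContinuousAt.comp (g := A) (f := fun z : X0 ι Binf => (z : X) + h z₀)
      (hS.continuousOn_A.continuousAt
        (hS.isOpen_preimage.mem_nhds (hh.mem z₀ hz₀ (h z₀)))) (by fun_prop)
  have h1 : Tendsto (fun z : X0 ι Binf =>
      C1 ι Binf / (1 - q) * ‖hS.pm (A ((z : X) + h z₀))‖) (𝓝 z₀) (𝓝 0) := by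
    have := (hc.norm.const_mul (C1 ι Binf / (1 - q))).tendsto
    simpa [hh.eq_zero z₀ hz₀] using this
  refine squeeze_zero' (Eventually.of_forall fun z => norm_nonneg _) ?_
    (h1.mono_left nhdsWithin_le_nhds)
  filter_upwards [self_mem_nhdsWithin] with z hz
  rw [norm_sub_rev]
  exact hh.norm_sub_le hz (hh.norm_lt z₀ hz₀).le

theorem tendsto_zero (hM : MA ι Binf A = 0) :
    Tendsto h (Bornology.cobounded (X0 ι Binf)) (𝓝 0) := by
  obtain ⟨c, hc, hcn⟩ := hS.exists_norm_le
  have hq : 0 < 1 - q := by linarith [hh.lt_one]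
  have hC : 0 ≤ C1 ι Binf / (1 - q) := div_nonneg Setting.C1_nonneg hq.le
  rw [Metric.tendsto_nhds]
  intro ε hε
  obtain ⟨R₂, hR₂⟩ := exists_radius_of_MA_lt hS hC (ρ := ENNReal.ofReal ε)
    (Or.inr (by rw [hM, mul_zero]; simpa using hε))
  filter_upwards [tendsto_norm_cobounded_atTop.eventually_ge_atTop (max R₂ (c * R))] with z hz
  have h1 : R ≤ ‖ι (z : X)‖ :=
    le_of_mul_le_mul_left (((le_max_right _ _).trans hz).trans (hcn z)) hc
  have h2 := hR₂ z ((le_max_left _ _).trans hz)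
  rw [dist_zero_right]
  exact (hh.norm_le h1).trans_lt ((ENNReal.ofReal_lt_ofReal_iff hε).1 h2)

end IsReduction

end Reduction

end SplitInf

namespace SplitInf

/-! ### Regularity of the reduction -/

section Regularity

variable {H X : Type*} [NormedAddCommGroup H] [InnerProductSpace ℝ H] [CompleteSpace H]
  [NormedAddCommGroup X] [NormedSpace ℝ X]
  {ι : X →L[ℝ] H} {V : Set H} {L : H → ℝ} {A : X → X} {B : X → H →L[ℝ] H} {Binf : H →L[ℝ] H}

variable (ι Binf) in
/-- The form `formH0`, as a linear map. -/
noncomputable def formL : X →L[ℝ] X0 ι Binf →L[ℝ] ℝ :=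
  ((ContinuousLinearMap.compL ℝ (X0 ι Binf) H ℝ).flip (ι.comp (X0 ι Binf).subtypeL)).comp
    ((innerSL ℝ).comp ι)

theorem formH0_apply (a : X) (z : X0 ι Binf) : formH0 ι Binf a z = ⟪ι a, ι (z : X)⟫ := rfl

theorem isOpen_extBall (R : ℝ) : IsOpen (extBall ι Binf R) :=
  isOpen_lt continuous_const (by fun_prop : Continuous fun z : X0 ι Binf => ‖ι (z : X)‖)

namespace Setting

open Classical in
/-- The derivative of `A` at the points of `V ∩ X`. -/
noncomputable def dA (hS : Setting ι V L A B Binf) (x : X) : X →L[ℝ] X :=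
  if hx : ι x ∈ V then (hS.exists_dA hx).choose else 0

variable (hS : Setting ι V L A B Binf)
include hS

theorem dA_apply {x : X} (hx : ι x ∈ V) (u : X) : hS.dA x u = lineDeriv ℝ A x u := by
  rw [dA, dif_pos hx]
  exact (hS.exists_dA hx).choose_spec u

theorem apply_dA {x : X} (hx : ι x ∈ V) (u : X) : ι (hS.dA x u) = B x (ι u) := by
  rw [hS.dA_apply hx, hS.lineDeriv_apply hx]

theorem fderiv_A (hA : ContDiffOn ℝ 1 A (ι ⁻¹' V)) {x : X} (hx : ι x ∈ V) :
    fderiv ℝ A x = hS.dA x := by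
  ext u
  rw [hS.dA_apply hx, DifferentiableAt.lineDeriv_eq_fderiv]
  exact (hA.differentiableOn one_ne_zero).differentiableAt (hS.isOpen_preimage.mem_nhds hx)

/-- As `A` is continuous into `X`, the restriction of `L` to `X` has a norm-continuous Gateaux
differential, hence a Fréchet one. -/
theorem hasFDerivAt_L {x : X} (hx : ι x ∈ V) :
    HasFDerivAt (fun y => L (ι y)) ((innerSL ℝ (ι (A x))).comp ι) x := by
  refine hasFDerivAt_of_hasLineDerivAt (U := ι ⁻¹' V)
    (g := fun x => (innerSL ℝ (ι (A x))).comp ι) hS.isOpen_preimage ?_ (fun y hy u => ?_) hx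
  · have h1 : Continuous fun a : X => (innerSL ℝ (ι a)).comp ι := by fun_prop
    exact h1.comp_continuousOn hS.continuousOn_A
  · have h1 := (hS.condF1.2.1 (ι y) hy (ι u)).hasLineDerivAt
    rw [hS.condF2.2 y hy u] at h1
    unfold HasLineDerivAt at h1 ⊢
    simpa using h1

theorem eq_zero_of_C1_eq_zero [CompleteSpace X] (h : C1 ι Binf = 0) (x : Xpm ι Binf) : x = 0 := by
  have h1 := hS.norm_symm_le x
  rw [h, zero_mul] at h1
  have h2 := norm_le_zero_iff.1 h1
  simpa using h2

end Setting

namespace IsReduction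

variable {hS : Setting ι V L A B Binf} [CompleteSpace X] {ρ : ℝ≥0∞} {R q : ℝ}
  {h : X0 ι Binf → Xpm ι Binf}

theorem eventually_enorm_le {E : Type*} [NormedAddCommGroup E] {x : E} {ρ : ℝ≥0∞}
    (hx : ‖x‖ₑ < ρ) : ∀ᶠ y in 𝓝 x, ‖y‖ₑ ≤ ρ :=
  (continuous_enorm.continuousAt.eventually_lt continuousAt_const hx).mono fun _ => le_of_lt

/-- Differentiating the contraction inequality at `h z` gives `‖x - S x‖ ≤ q * ‖x‖` for `S = B(∞)⁻¹
(I - P⁰) DA`, so a Neumann series inverts `S`. The strict bound `‖h z‖ < ρ` leaves room for `h z + t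
• x` with small `t`. -/
theorem exists_derivEquiv (hh : IsReduction hS ρ R q h) {z : X0 ι Binf} (hz : R ≤ ‖ι (z : X)‖) :
    ∃ T : Xpm ι Binf ≃L[ℝ] Xpm ι Binf,
      ∀ x : Xpm ι Binf, T x = hS.pm (hS.dA ((z : X) + h z) (x : X)) := by
  set p : X := (z : X) + h z with hp
  have hpV : ι p ∈ V := hh.mem z hz _
  set S : Xpm ι Binf →L[ℝ] Xpm ι Binf :=
    (hS.Bpm.symm : Xpm ι Binf →L[ℝ] Xpm ι Binf).comp
      ((hS.pm.comp (hS.dA p)).comp (Xpm ι Binf).subtypeL) with hSdef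
  have hSa : ∀ x : Xpm ι Binf, S x = hS.Bpm.symm (hS.pm (hS.dA p (x : X))) := fun x => rfl
  have hbound : ∀ x : Xpm ι Binf, ‖x - S x‖ ≤ q * ‖x‖ := by
    intro x
    have h1 : HasDerivAt (fun t : ℝ => A (p + t • (x : X))) (hS.dA p (x : X)) 0 := by
      have := (hS.condF2.1.2.1 p hpV (x : X)).hasLineDerivAt
      rw [← hS.dA_apply hpV] at this
      exact this
    have h2 : HasDerivAt (fun t : ℝ => t • x -
        hS.Bpm.symm (hS.pm (A (p + t • (x : X))) - hS.pm (A p))) (x - S x) 0 := by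
      have a1 := (hS.pm.hasFDerivAt.comp_hasDerivAt (0 : ℝ) h1).sub_const (hS.pm (A p))
      have a2 := (hS.Bpm.symm : Xpm ι Binf →L[ℝ] Xpm ι Binf).hasFDerivAt.comp_hasDerivAt (0 : ℝ) a1
      have a3 := ((hasDerivAt_id (0 : ℝ)).smul_const x).sub a2
      rw [one_smul] at a3
      exact a3
    refine h2.le_of_lip' (mul_nonneg hh.nonneg (norm_nonneg _)) ?_
    have hev : ∀ᶠ t : ℝ in 𝓝 0, ‖h z + t • x‖ₑ ≤ ρ := by
      have hc : ContinuousAt (fun t : ℝ => h z + t • x) 0 := by fun_prop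
      refine hc.eventually (p := fun y => ‖y‖ₑ ≤ ρ) ?_
      simpa using eventually_enorm_le (hh.norm_lt z hz)
    filter_upwards [hev] with t ht
    have h3 := hh.contraction z hz (h z + t • x) (h z) ht (hh.norm_lt z hz).le
    have e : (z : X) + (h z + t • x : Xpm ι Binf) = p + t • (x : X) := by
      rw [hp, Submodule.coe_add, Submodule.coe_smul, add_assoc]
    rw [e, add_sub_cancel_left, norm_smul] at h3
    simp only [zero_smul, add_zero, sub_self, map_zero, sub_zero]
    linarith
  have hnorm : ‖1 - S‖ < 1 :=
    (ContinuousLinearMap.opNorm_le_bound _ hh.nonneg fun x => by simpa using hbound x).trans_lt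
      hh.lt_one
  refine ⟨(ContinuousLinearEquiv.unitsEquiv ℝ _ (Units.oneSub (1 - S) hnorm)).trans hS.Bpm,
    fun x => ?_⟩
  have e : (ContinuousLinearEquiv.unitsEquiv ℝ _ (Units.oneSub (1 - S) hnorm)) x = S x := by
    change ((Units.oneSub (1 - S) hnorm : (Xpm ι Binf →L[ℝ] Xpm ι Binf)ˣ) :
      Xpm ι Binf →L[ℝ] Xpm ι Binf) x = S x
    rw [Units.val_oneSub, sub_sub_cancel]
  rw [ContinuousLinearEquiv.trans_apply, e, hSa, ContinuousLinearEquiv.apply_symm_apply]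

open Classical in
/-- The derivative of the projected gradient in the direction of `X^±`. -/
noncomputable def derivEquiv (hh : IsReduction hS ρ R q h) (z : X0 ι Binf) :
    Xpm ι Binf ≃L[ℝ] Xpm ι Binf :=
  if hz : R ≤ ‖ι (z : X)‖ then (hh.exists_derivEquiv hz).choose
  else ContinuousLinearEquiv.refl ℝ _

theorem derivEquiv_apply (hh : IsReduction hS ρ R q h) {z : X0 ι Binf} (hz : R ≤ ‖ι (z : X)‖)
    (x : Xpm ι Binf) : hh.derivEquiv z x = hS.pm (hS.dA ((z : X) + h z) (x : X)) := by
  rw [derivEquiv, dif_pos hz]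
  exact (hh.exists_derivEquiv hz).choose_spec x

/-- The derivative of the reduction. -/
noncomputable def dh (hh : IsReduction hS ρ R q h) (z : X0 ι Binf) : X0 ι Binf →L[ℝ] Xpm ι Binf :=
  -((hh.derivEquiv z).symm : Xpm ι Binf →L[ℝ] Xpm ι Binf).comp
    ((hS.pm.comp (hS.dA ((z : X) + h z))).comp (X0 ι Binf).subtypeL)

/-- The derivative of `z ↦ z + h z`. -/
noncomputable def dgraph (hh : IsReduction hS ρ R q h) (z : X0 ι Binf) : X0 ι Binf →L[ℝ] X :=
  (X0 ι Binf).subtypeL + (Xpm ι Binf).subtypeL.comp (hh.dh z)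

variable (hh : IsReduction hS ρ R q h)
include hh

theorem dh_apply (z w : X0 ι Binf) : hh.dh z w =
    -(hh.derivEquiv z).symm (hS.pm (hS.dA ((z : X) + h z) (w : X))) := rfl

theorem dgraph_apply (z w : X0 ι Binf) : hh.dgraph z w = (w : X) + hh.dh z w := rfl

theorem pm_dA_dgraph {z : X0 ι Binf} (hz : R ≤ ‖ι (z : X)‖) (w : X0 ι Binf) :
    hS.pm (hS.dA ((z : X) + h z) (hh.dgraph z w)) = 0 := by
  rw [dgraph_apply, map_add, map_add, ← hh.derivEquiv_apply hz, dh_apply, map_neg,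
    ContinuousLinearEquiv.apply_symm_apply, add_neg_cancel]

theorem continuousAt {z : X0 ι Binf} (hz : R < ‖ι (z : X)‖) : ContinuousAt h z :=
  (hh.continuousOn z hz.le).continuousAt
    (mem_of_superset ((isOpen_extBall R).mem_nhds hz) fun y (hy : R < ‖ι (y : X)‖) =>
      (hy.le : R ≤ ‖ι (y : X)‖))

theorem continuousAt_graph {z : X0 ι Binf} (hz : R < ‖ι (z : X)‖) :
    ContinuousAt (fun z : X0 ι Binf => (z : X) + h z) z :=
  continuous_subtype_val.continuousAt.add
    (continuous_subtype_val.continuousAt.comp (hh.continuousAt hz))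

/-- The increments of the linearized graph range over a finite-dimensional space, so `A` is
uniformly differentiable along them, also with base points moving on the graph. -/
theorem eventually_A_graph {z₀ : X0 ι Binf} (hz₀ : R < ‖ι (z₀ : X)‖) {ε : ℝ} (hε : 0 < ε) :
    ∀ᶠ p : X0 ι Binf × X0 ι Binf in 𝓝 (z₀, z₀),
      ‖A ((p.2 : X) + h p.2 + hh.dgraph z₀ (p.1 - p.2)) - A ((p.2 : X) + h p.2) -
        hS.dA ((z₀ : X) + h z₀) (hh.dgraph z₀ (p.1 - p.2))‖ ≤ ε * ‖p.1 - p.2‖ := by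
  have := hS.finiteDimensional_X0
  have hV := hh.mem z₀ hz₀.le (h z₀)
  have h1 := hS.condF2.1.eventually_norm_le hS.isOpen_preimage (hh.dgraph z₀)
    (x₀ := (z₀ : X) + h z₀) hV hε
  have hc : ContinuousAt (fun p : X0 ι Binf × X0 ι Binf =>
      ((p.2 : X) + h p.2, p.1 - p.2)) (z₀, z₀) := by
    have : ContinuousAt (fun p : X0 ι Binf × X0 ι Binf => (p.2 : X) + h p.2) (z₀, z₀) :=
      ContinuousAt.comp (g := fun z : X0 ι Binf => (z : X) + h z)
        (hh.continuousAt_graph hz₀) continuousAt_snd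
    fun_prop
  have h2 := hc.eventually (p := fun p : X × X0 ι Binf =>
      ‖A (p.1 + hh.dgraph z₀ p.2) - A p.1 - lineDeriv ℝ A ((z₀ : X) + h z₀) (hh.dgraph z₀ p.2)‖ ≤
        ε * ‖p.2‖) (by simpa using h1)
  filter_upwards [h2] with p hp
  rw [hS.dA_apply hV]
  exact hp

/-- An implicit function theorem without assuming `A` is `C¹`. The prediction `h z₂ + dh z₀ (z₁ -
z₂)` is a guess for `h z₁`; its residual is `o(‖z₁ - z₂‖)`, because `(I - P⁰) A` vanishes on the
graph and `(I - P⁰) DA` kills the range of `dgraph`. -/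
theorem hasStrictFDerivAt {z₀ : X0 ι Binf} (hz₀ : R < ‖ι (z₀ : X)‖) :
    HasStrictFDerivAt h (hh.dh z₀) z₀ := by
  rw [hasStrictFDerivAt_iff_isLittleO, Asymptotics.isLittleO_iff]
  intro ε hε
  have hq : 0 < 1 - q := by linarith [hh.lt_one]
  have hC : 0 ≤ C1 ι Binf / (1 - q) := div_nonneg Setting.C1_nonneg hq.le
  set C := C1 ι Binf / (1 - q) * ‖hS.pm‖ with hCdef
  have hC0 : 0 ≤ C := by positivity
  have h1 := hh.eventually_A_graph hz₀ (ε := ε / (C + 1)) (by positivity)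
  have hopen := (isOpen_extBall R).mem_nhds hz₀
  have h2 : ∀ᶠ p : X0 ι Binf × X0 ι Binf in 𝓝 (z₀, z₀), R ≤ ‖ι (p.1 : X)‖ :=
    Filter.Eventually.mono ((continuousAt_fst : ContinuousAt (fun p : X0 ι Binf × X0 ι Binf => p.1)
      (z₀, z₀)).preimage_mem_nhds hopen)
      fun p hp => le_of_lt (show R < _ from hp)
  have h3 : ∀ᶠ p : X0 ι Binf × X0 ι Binf in 𝓝 (z₀, z₀), R ≤ ‖ι (p.2 : X)‖ :=
    Filter.Eventually.mono ((continuousAt_snd : ContinuousAt (fun p : X0 ι Binf × X0 ι Binf => p.2)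
      (z₀, z₀)).preimage_mem_nhds hopen)
      fun p hp => le_of_lt (show R < _ from hp)
  have h4 : ∀ᶠ p : X0 ι Binf × X0 ι Binf in 𝓝 (z₀, z₀),
      ‖h p.2 + hh.dh z₀ (p.1 - p.2)‖ₑ ≤ ρ := by
    have : ContinuousAt (fun p : X0 ι Binf × X0 ι Binf => h p.2) (z₀, z₀) :=
      ContinuousAt.comp (g := h) (hh.continuousAt hz₀) continuousAt_snd
    have hc : ContinuousAt (fun p : X0 ι Binf × X0 ι Binf =>
      h p.2 + hh.dh z₀ (p.1 - p.2)) (z₀, z₀) :=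
      this.add ((hh.dh z₀).continuous.comp (continuous_fst.sub continuous_snd)).continuousAt
    refine hc.eventually (p := fun y => ‖y‖ₑ ≤ ρ) ?_
    simpa using eventually_enorm_le (hh.norm_lt z₀ hz₀.le)
  filter_upwards [h1, h2, h3, h4] with p k1 k2 k3 k4
  have a1 := hh.norm_sub_le k2 k4
  have e : (p.1 : X) + (h p.2 + hh.dh z₀ (p.1 - p.2) : Xpm ι Binf) =
      (p.2 : X) + h p.2 + hh.dgraph z₀ (p.1 - p.2) := by
    rw [dgraph_apply, Submodule.coe_add, Submodule.coe_sub]; abel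
  have a2 : hS.pm (A ((p.2 : X) + h p.2 + hh.dgraph z₀ (p.1 - p.2))) =
      hS.pm (A ((p.2 : X) + h p.2 + hh.dgraph z₀ (p.1 - p.2)) - A ((p.2 : X) + h p.2) -
        hS.dA ((z₀ : X) + h z₀) (hh.dgraph z₀ (p.1 - p.2))) := by
    rw [map_sub hS.pm, map_sub hS.pm, hh.pm_dA_dgraph hz₀.le, hh.eq_zero _ k3, sub_zero, sub_zero]
  rw [e, a2] at a1
  have e2 : h p.1 - h p.2 - hh.dh z₀ (p.1 - p.2) =
      -(h p.2 + hh.dh z₀ (p.1 - p.2) - h p.1) := by abel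
  rw [e2, norm_neg]
  refine a1.trans ?_
  calc C1 ι Binf / (1 - q) * ‖hS.pm _‖
      ≤ C1 ι Binf / (1 - q) * (‖hS.pm‖ * (ε / (C + 1) * ‖p.1 - p.2‖)) := by
        gcongr
        exact (hS.pm.le_opNorm _).trans (by gcongr)
    _ = C / (C + 1) * (ε * ‖p.1 - p.2‖) := by rw [hCdef]; ring
    _ ≤ 1 * (ε * ‖p.1 - p.2‖) := by
        gcongr
        rw [div_le_one (by positivity)]
        linarith
    _ = ε * ‖p.1 - p.2‖ := one_mul _

/-- The chain rule is not available for the merely directionally differentiable `A`. The point `z₁ +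
h z₁` is replaced by its linear prediction at a cost controlled by the local Lipschitz constant, and
the prediction is handled by `eventually_A_graph`. -/
theorem hasStrictFDerivAt_A {z₀ : X0 ι Binf} (hz₀ : R < ‖ι (z₀ : X)‖) :
    HasStrictFDerivAt (fun z : X0 ι Binf => A ((z : X) + h z))
      ((hS.dA ((z₀ : X) + h z₀)).comp (hh.dgraph z₀)) z₀ := by
  have hV := hh.mem z₀ hz₀.le (h z₀)
  obtain ⟨K, hK, hlip⟩ := hS.condF2.1.eventually_lipschitz hS.isOpen_preimage
    (x₀ := (z₀ : X) + h z₀) hV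
  have hstrict := hh.hasStrictFDerivAt hz₀
  rw [hasStrictFDerivAt_iff_isLittleO, Asymptotics.isLittleO_iff] at hstrict ⊢
  intro ε hε
  have hcont : ContinuousAt (fun p : X0 ι Binf × X0 ι Binf => ((p.1 : X) + h p.1,
      (p.2 : X) + h p.2 + hh.dgraph z₀ (p.1 - p.2))) (z₀, z₀) := by
    have c1 : ContinuousAt (fun p : X0 ι Binf × X0 ι Binf => (p.2 : X) + h p.2) (z₀, z₀) :=
      ContinuousAt.comp (g := fun z : X0 ι Binf => (z : X) + h z)
        (hh.continuousAt_graph hz₀) continuousAt_snd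
    have c2 : ContinuousAt (fun p : X0 ι Binf × X0 ι Binf => (p.1 : X) + h p.1) (z₀, z₀) :=
      ContinuousAt.comp (g := fun z : X0 ι Binf => (z : X) + h z)
        (hh.continuousAt_graph hz₀) continuousAt_fst
    fun_prop
  have h1 := hcont.eventually (p := fun p : X × X => ‖A p.1 - A p.2‖ ≤ K * ‖p.1 - p.2‖)
    (by simpa using hlip)
  have h2 := hh.eventually_A_graph hz₀ (ε := ε / 2) (by positivity)
  have h3 := hstrict (c := ε / (2 * K)) (by positivity)
  filter_upwards [h1, h2, h3] with p k1 k2 k3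
  have e : ((p.1 : X) + h p.1) - ((p.2 : X) + h p.2 + hh.dgraph z₀ (p.1 - p.2)) =
      ((h p.1 - h p.2 - hh.dh z₀ (p.1 - p.2) : Xpm ι Binf) : X) := by
    rw [dgraph_apply]
    simp only [Submodule.coe_sub]
    abel
  rw [e, ← Submodule.coe_norm] at k1
  have k4 : K * ‖h p.1 - h p.2 - hh.dh z₀ (p.1 - p.2)‖ ≤ ε / 2 * ‖p.1 - p.2‖ := by
    refine (mul_le_mul_of_nonneg_left k3 hK.le).trans (le_of_eq ?_)
    field_simp
  have k5 := norm_add_le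
    (A ((p.1 : X) + h p.1) - A ((p.2 : X) + h p.2 + hh.dgraph z₀ (p.1 - p.2)))
    (A ((p.2 : X) + h p.2 + hh.dgraph z₀ (p.1 - p.2)) - A ((p.2 : X) + h p.2) -
        hS.dA ((z₀ : X) + h z₀) (hh.dgraph z₀ (p.1 - p.2)))
  have e2 : A ((p.1 : X) + h p.1) - A ((p.2 : X) + h p.2) -
      ((hS.dA ((z₀ : X) + h z₀)).comp (hh.dgraph z₀)) (p.1 - p.2) =
    (A ((p.1 : X) + h p.1) - A ((p.2 : X) + h p.2 + hh.dgraph z₀ (p.1 - p.2))) +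
    (A ((p.2 : X) + h p.2 + hh.dgraph z₀ (p.1 - p.2)) - A ((p.2 : X) + h p.2) -
        hS.dA ((z₀ : X) + h z₀) (hh.dgraph z₀ (p.1 - p.2))) := by
    rw [ContinuousLinearMap.comp_apply]; abel
  rw [e2]
  linarith

theorem contDiffOn : ContDiffOn ℝ 1 h (extBall ι Binf R) :=
  contDiffOn_one_of_hasStrictFDerivAt (isOpen_extBall R) fun _ hz => hh.hasStrictFDerivAt hz

/-- On the graph the gradient lies in `H⁰`, so the contribution of `dh`, with values in `H^±`, drops
out of the chain rule. -/
theorem hasFDerivAt_Lred {z : X0 ι Binf} (hz : R < ‖ι (z : X)‖) :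
    HasFDerivAt (Lred ι Binf L h) (formH0 ι Binf (A ((z : X) + h z))) z := by
  have h1 := hS.hasFDerivAt_L (hh.mem z hz.le (h z))
  have h2 : HasFDerivAt (fun z : X0 ι Binf => (z : X) + h z) (hh.dgraph z) z :=
    (X0 ι Binf).subtypeL.hasFDerivAt.add
      ((Xpm ι Binf).subtypeL.hasFDerivAt.comp z (hh.hasStrictFDerivAt hz).hasFDerivAt)
  have h3 := HasFDerivAt.comp (g := fun y => L (ι y)) z h1 h2
  refine h3.congr_fderiv ?_
  ext w
  have h4 : ι (A ((z : X) + h z)) ∈ H0 Binf := hS.pm_eq_zero_iff.1 (hh.eq_zero z hz.le)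
  rw [formH0_apply]
  change ⟪ι (A ((z : X) + h z)), ι (hh.dgraph z w)⟫ = _
  rw [dgraph_apply, map_add, inner_add_right, inner_H0_Hpm h4 (mem_Hpm _), add_zero]

theorem hasFDerivAt_form {z : X0 ι Binf} (hz : R < ‖ι (z : X)‖) :
    HasFDerivAt (fun z : X0 ι Binf => formH0 ι Binf (A ((z : X) + h z)))
      ((formL ι Binf).comp ((hS.dA ((z : X) + h z)).comp (hh.dgraph z))) z :=
  HasFDerivAt.comp (g := fun a => formL ι Binf a) z (formL ι Binf).hasFDerivAt
    (hh.hasStrictFDerivAt_A hz).hasFDerivAt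

theorem contDiffOn_fderiv_Lred :
    ContDiffOn ℝ 1 (fderiv ℝ (Lred ι Binf L h)) (extBall ι Binf R) := by
  have h1 : ContDiffOn ℝ 1 (fun z : X0 ι Binf => A ((z : X) + h z)) (extBall ι Binf R) :=
    contDiffOn_one_of_hasStrictFDerivAt (isOpen_extBall R) fun _ hz => hh.hasStrictFDerivAt_A hz
  have h2 : ContDiffOn ℝ 1 (fun z : X0 ι Binf => formH0 ι Binf (A ((z : X) + h z)))
      (extBall ι Binf R) :=
    ContDiff.comp_contDiffOn (g := fun a => formL ι Binf a)
      (IsBoundedLinearMap.contDiff (ContinuousLinearMap.isBoundedLinearMap _)) h1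
  exact h2.congr fun z hz => (hh.hasFDerivAt_Lred hz).fderiv

theorem contDiffOn_Lred : ContDiffOn ℝ 2 (Lred ι Binf L h) (extBall ι Binf R) := by
  have e : (2 : WithTop ℕ∞) = 1 + 1 := by norm_num
  rw [e, contDiffOn_succ_iff_fderiv_of_isOpen (isOpen_extBall R)]
  exact ⟨fun z hz => (hh.hasFDerivAt_Lred hz).differentiableAt.differentiableWithinAt, by simp,
    hh.contDiffOn_fderiv_Lred⟩

theorem locallyLipschitzOn_fderiv_Lred :
    LocallyLipschitzOn (extBall ι Binf R) (fderiv ℝ (Lred ι Binf L h)) := by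
  intro z hz
  obtain ⟨K, t, ht, hK⟩ := (hh.contDiffOn_fderiv_Lred.contDiffAt
    ((isOpen_extBall R).mem_nhds hz)).exists_lipschitzOnWith
  exact ⟨K, t, mem_nhdsWithin_of_mem_nhds ht, hK⟩

/-- The derivative of the reduction tends to zero at infinity, in the norm of `H`. -/
theorem exists_radius_norm_dh_le {ε : ℝ} (hε : 0 < ε) :
    ∃ R₁ : ℝ, ∀ z : X0 ι Binf, R₁ ≤ ‖ι (z : X)‖ → R ≤ ‖ι (z : X)‖ → ∀ w : X0 ι Binf,
      ‖ι (hh.dh z w : X)‖ ≤ ε * ‖ι (w : X)‖ ∧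
      ∀ u ∈ H0 Binf, ‖B ((z : X) + h z) u‖ ≤ ε * ‖u‖ := by
  have := hS.finiteDimensional_sup
  have : FiniteDimensional ℝ (Hminus Binf) := finiteDimensional_Hminus
  obtain ⟨a, ha, R₁, hgap⟩ := hS.exists_gaps_near_infinity
  -- The factor `a` absorbs the division by the gap in the estimate of `dh`; the factor `1` serves
  -- the direct bound on `H⁰`.
  obtain ⟨R₂, hR₂⟩ := hS.exists_radius_norm_sub_le (ε := ε * min a 1)
    (mul_pos hε (lt_min ha one_pos))
  refine ⟨max R₁ R₂, fun z hz hzR w => ?_⟩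
  set x : X := (z : X) + h z with hx
  have hxV : ι x ∈ V := hh.mem z hzR _
  have hxn : ‖ι (z : X)‖ ≤ ‖ι x‖ := norm_le_norm_add z (h z)
  have hsmall : ∀ u ∈ H0 Binf, ‖B x u‖ ≤ ε * min a 1 * ‖u‖ := by
    intro u hu
    have h1 := hR₂ x hxV (((le_max_right _ _).trans hz).trans hxn) u (Submodule.mem_sup_left hu)
    rwa [apply_of_mem_H0 hu, sub_zero] at h1
  refine ⟨?_, fun u hu => (hsmall u hu).trans ?_⟩
  · obtain ⟨hp, hm⟩ := hgap x hxV (((le_max_left _ _).trans hz).trans hxn)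
    set u : H := ι (hh.dh z w : X) with hu
    have huH : u ∈ Hpm Binf := mem_Hpm _
    -- `B(x)` applied to `w + dh z w` lies in `H⁰`. Testing it with the reflection of `u = dh z w`
    -- bounds `a * ‖u‖ ^ 2` by `‖B(x) w‖ * ‖u‖`, and `B(x) w` is small because `B(∞) w = 0`.
    set v : H := Pplus Binf u - Pminus Binf u with hv
    have hvH : v ∈ Hpm Binf := Submodule.sub_mem _ (Hplus_le_Hpm (Pplus_mem hS.selfAdjoint u))
      (Hminus_le_Hpm hS.selfAdjoint (Pminus_mem u))
    have h1 := mul_norm_sq_le_inner_reflection (hS.condF3.1 x hxV) hS.selfAdjoint hp hm huH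
    have h2 : ι (hS.dA x (hh.dgraph z w)) ∈ H0 Binf :=
      hS.pm_eq_zero_iff.1 (hh.pm_dA_dgraph hzR w)
    rw [hS.apply_dA hxV, dgraph_apply, map_add, map_add] at h2
    have h3 := inner_H0_Hpm h2 hvH
    rw [inner_add_left] at h3
    have h4 := neg_abs_le ⟪B x (ι (w : X)), v⟫
    have h5 := abs_real_inner_le_norm (B x (ι (w : X))) v
    have h6 : ‖v‖ = ‖u‖ := norm_Pplus_sub_Pminus hS.selfAdjoint huH
    have h7 := hsmall _ (mem_H0 w)
    rw [h6] at h5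
    have h8 : a * ‖u‖ ^ 2 ≤ ε * min a 1 * ‖ι (w : X)‖ * ‖u‖ := by
      have : ‖B x (ι (w : X))‖ * ‖u‖ ≤ ε * min a 1 * ‖ι (w : X)‖ * ‖u‖ := by gcongr
      linarith
    have h9 : ε * min a 1 * ‖ι (w : X)‖ ≤ a * (ε * ‖ι (w : X)‖) := by
      have : min a 1 ≤ a := min_le_left _ _
      have : 0 ≤ ε * ‖ι (w : X)‖ := by positivity
      nlinarith
    rcases (norm_nonneg u).eq_or_lt with h0 | h0
    · rw [← h0]; positivity
    · have h10 : a * ‖u‖ * ‖u‖ ≤ a * (ε * ‖ι (w : X)‖) * ‖u‖ := by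
        nlinarith
      exact le_of_mul_le_mul_left (le_of_mul_le_mul_right h10 h0) ha
  · have : ε * min a 1 ≤ ε * 1 := by gcongr; exact min_le_right _ _
    rw [mul_one] at this
    gcongr

theorem hasStrictDerivAtInfinity_H :
    HasStrictDerivAtInfinity (fun z => ι (h z : X)) 0 (extBall ι Binf R) := by
  have := hS.finiteDimensional_X0
  obtain ⟨c, hc, hcn⟩ := hS.exists_norm_le
  have hR : ∀ (z : X0 ι Binf) (s : ℝ), c * s ≤ ‖z‖ → s ≤ ‖ι (z : X)‖ := fun z s hs =>
    le_of_mul_le_mul_left (hs.trans (hcn z)) hc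
  refine hasStrictDerivAtInfinity_zero (R₀ := c * (R + 1))
    (f' := fun z => (ι.comp (Xpm ι Binf).subtypeL).comp (hh.dh z)) (fun z hz => ?_)
    (fun ε hε => ?_) _
  · have h1 := hR z (R + 1) hz
    exact (ι.comp (Xpm ι Binf).subtypeL).hasFDerivAt.comp z
      (hh.hasStrictFDerivAt (by linarith)).hasFDerivAt
  · obtain ⟨R₁, hR₁⟩ := hh.exists_radius_norm_dh_le (ε := ε / (‖ι‖ + 1)) (by positivity)
    refine ⟨c * R₁, fun z hz hz2 => ?_⟩
    have h1 := hR z (R + 1) hz2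
    refine ContinuousLinearMap.opNorm_le_bound _ hε.le fun w => ?_
    refine ((hR₁ z (hR z R₁ hz) (by linarith) w).1).trans ?_
    have h2 := ι.le_opNorm (w : X)
    rw [div_mul_eq_mul_div, div_le_iff₀ (by positivity), mul_assoc]
    refine mul_le_mul_of_nonneg_left ?_ hε.le
    refine h2.trans ?_
    rw [mul_comm, Submodule.coe_norm]
    gcongr
    linarith

/-- The second derivative is `⟪B(x) (w + dh z w), v⟫`. By self-adjointness `B(x)` moves onto `v ∈
H⁰`, where it is small, while `w + dh z w` stays bounded by `2 * ‖w‖` in `H`. -/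
theorem hasStrictDerivAtInfinity_fderiv_Lred :
    HasStrictDerivAtInfinity (fderiv ℝ (Lred ι Binf L h)) 0 (extBall ι Binf R) := by
  have := hS.finiteDimensional_X0
  obtain ⟨c, hc, hcn⟩ := hS.exists_norm_le
  have hR : ∀ (z : X0 ι Binf) (s : ℝ), c * s ≤ ‖z‖ → s ≤ ‖ι (z : X)‖ := fun z s hs =>
    le_of_mul_le_mul_left (hs.trans (hcn z)) hc
  have hmain : HasStrictDerivAtInfinity
      (fun z : X0 ι Binf => formH0 ι Binf (A ((z : X) + h z))) 0 (extBall ι Binf R) := by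
    refine hasStrictDerivAtInfinity_zero (R₀ := c * (R + 1))
      (f' := fun z : X0 ι Binf => (formL ι Binf).comp ((hS.dA ((z : X) + h z)).comp (hh.dgraph z)))
      (fun z hz => ?_) (fun ε hε => ?_) _
    · have h1 := hR z (R + 1) hz
      exact hh.hasFDerivAt_form (by linarith)
    · set δ : ℝ := min 1 (ε / (2 * (‖ι‖ ^ 2 + 1))) with hδ
      have hδ0 : 0 < δ := lt_min one_pos (by positivity)
      obtain ⟨R₁, hR₁⟩ := hh.exists_radius_norm_dh_le hδ0
      refine ⟨c * R₁, fun z hz hz2 => ?_⟩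
      have h1 := hR z (R + 1) hz2
      have hzR : R ≤ ‖ι (z : X)‖ := by linarith
      have hxV := hh.mem z hzR (h z)
      refine ContinuousLinearMap.opNorm_le_bound _ hε.le fun w => ?_
      refine ContinuousLinearMap.opNorm_le_bound _ (by positivity) fun v => ?_
      obtain ⟨k1, k2⟩ := hR₁ z (hR z R₁ hz) hzR w
      have e : (((formL ι Binf).comp ((hS.dA ((z : X) + h z)).comp (hh.dgraph z))) w) v =
          ⟪ι (w : X) + ι (hh.dh z w : X), B ((z : X) + h z) (ι (v : X))⟫ := by
        change ⟪ι (hS.dA ((z : X) + h z) (hh.dgraph z w)), ι (v : X)⟫ = _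
        rw [hS.apply_dA hxV, inner_apply_comm (hS.condF3.1 _ hxV), dgraph_apply, map_add]
      rw [e, Real.norm_eq_abs]
      have k3 := k2 _ (mem_H0 v)
      have k4 : ‖ι (w : X) + ι (hh.dh z w : X)‖ ≤ 2 * ‖ι (w : X)‖ := by
        have a1 : δ * ‖ι (w : X)‖ ≤ 1 * ‖ι (w : X)‖ := by gcongr; exact min_le_left _ _
        have a2 := norm_add_le (ι (w : X)) (ι (hh.dh z w : X))
        linarith
      have w1 : ‖ι (w : X)‖ ≤ ‖ι‖ * ‖w‖ := ι.le_opNorm _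
      have v1 : ‖ι (v : X)‖ ≤ ‖ι‖ * ‖v‖ := ι.le_opNorm _
      have hδ2 : δ * (2 * (‖ι‖ ^ 2 + 1)) ≤ ε :=
        (le_div_iff₀ (by positivity)).1 (min_le_right _ _)
      calc |⟪ι (w : X) + ι (hh.dh z w : X), B ((z : X) + h z) (ι (v : X))⟫|
          ≤ ‖ι (w : X) + ι (hh.dh z w : X)‖ * ‖B ((z : X) + h z) (ι (v : X))‖ :=
            abs_real_inner_le_norm _ _
        _ ≤ (2 * (‖ι‖ * ‖w‖)) * (δ * (‖ι‖ * ‖v‖)) := by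
            gcongr
            · exact k4.trans (by gcongr)
            · exact k3.trans (by gcongr)
        _ = δ * (2 * ‖ι‖ ^ 2) * ‖w‖ * ‖v‖ := by ring
        _ ≤ ε * ‖w‖ * ‖v‖ := by
            gcongr
            refine le_trans ?_ hδ2
            gcongr
            linarith
  intro ε hε
  obtain ⟨R', hR'⟩ := hmain ε hε
  refine ⟨R', fun z₁ hz₁ z₂ hz₂ h1 h2 => ?_⟩
  rw [(hh.hasFDerivAt_Lred hz₁).fderiv, (hh.hasFDerivAt_Lred hz₂).fderiv]
  exact hR' z₁ hz₁ z₂ hz₂ h1 h2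

/-- A Lipschitz bound for the remainder gives one for the reduction. -/
theorem norm_sub_le_of_rem {δ : ℝ} (hδ : C1 ι Binf * δ < 1) {z₁ z₂ : X0 ι Binf}
    (hδ0 : 0 ≤ δ) (hz₁ : R ≤ ‖ι (z₁ : X)‖) (hz₂ : R ≤ ‖ι (z₂ : X)‖)
    (hr : ‖rem ι Binf A z₁ (h z₁) - rem ι Binf A z₂ (h z₂)‖ ≤
      δ * ‖((z₁ : X) + h z₁) - ((z₂ : X) + h z₂)‖) :
    ‖h z₁ - h z₂‖ ≤ C1 ι Binf * δ / (1 - C1 ι Binf * δ) * ‖z₁ - z₂‖ := by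
  -- At a solution the remainder is `-B(∞) (h z)`. Inverting `B(∞)` bounds `h z₁ - h z₂`, and the
  -- part of the right-hand side containing this difference is absorbed, as `C₁ δ < 1`.
  rw [hS.rem_eq, hS.rem_eq, hh.eq_zero z₁ hz₁, hh.eq_zero z₂ hz₂, ← Submodule.coe_sub,
    ← Submodule.coe_norm] at hr
  have h1 := hS.norm_symm_le (0 - hS.Bpm (h z₁) - (0 - hS.Bpm (h z₂)))
  have e : hS.Bpm.symm (0 - hS.Bpm (h z₁) - (0 - hS.Bpm (h z₂))) = -(h z₁ - h z₂) := by
    simp only [zero_sub, map_sub, map_neg, ContinuousLinearEquiv.symm_apply_apply]; abel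
  rw [e, norm_neg] at h1
  have h2 : ‖((z₁ : X) + h z₁) - ((z₂ : X) + h z₂)‖ ≤ ‖z₁ - z₂‖ + ‖h z₁ - h z₂‖ := by
    rw [add_sub_add_comm]
    exact norm_add_le _ _
  have hC : 0 ≤ C1 ι Binf := Setting.C1_nonneg
  have h3 : ‖h z₁ - h z₂‖ ≤ C1 ι Binf * δ * (‖z₁ - z₂‖ + ‖h z₁ - h z₂‖) := by
    rw [mul_assoc]
    refine h1.trans (mul_le_mul_of_nonneg_left (hr.trans ?_) hC)
    gcongr
  rw [div_mul_eq_mul_div, le_div_iff₀ (by linarith)]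
  linarith

end IsReduction

/-! ### The conditions (SE) and (E), and their consequences for the reduction -/

theorem exists_kappa {c : ℝ} (hc : 0 ≤ c) {M ρ : ℝ≥0∞}
    (h : ρ = ∞ ∨ ENNReal.ofReal c * M < ρ) :
    ∃ κ : ℝ, 1 < κ ∧ (ρ = ∞ ∨ ENNReal.ofReal (κ / (κ - 1) * c) * M < ρ) := by
  rcases h with h | h
  · exact ⟨2, one_lt_two, Or.inl h⟩
  rcases hc.eq_or_lt with rfl | hc
  · exact ⟨2, one_lt_two, Or.inr (by simpa using h)⟩
  have hM : M ≠ ∞ := by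
    rintro rfl
    rw [ENNReal.mul_top (by simpa using hc)] at h
    exact not_top_lt h
  -- With `t = 1 / (κ - 1)` the factor `κ / (κ - 1)` is `t + 1`, which tends to `1`; the strict
  -- inequality survives for small `t` since `M` is finite.
  have hlim : Tendsto (fun t : ℝ => ENNReal.ofReal ((t + 1) * c) * M) (𝓝[>] 0)
      (𝓝 (ENNReal.ofReal ((0 + 1) * c) * M)) := by
    refine ENNReal.Tendsto.mul_const (ENNReal.tendsto_ofReal ?_) (Or.inr hM)
    exact ((by fun_prop : Continuous fun t : ℝ => (t + 1) * c).tendsto 0).mono_left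
      nhdsWithin_le_nhds
  rw [zero_add, one_mul] at hlim
  obtain ⟨t, ht, ht0⟩ := ((hlim.eventually_lt_const h).and self_mem_nhdsWithin).exists
  have ht0' : (0 : ℝ) < t := ht0
  refine ⟨1 + 1 / t, by simpa using ht0', Or.inr ?_⟩
  have e : (1 + 1 / t) / (1 + 1 / t - 1) = t + 1 := by field_simp; ring
  rwa [e]

/-- The condition (SE) implies the condition (E) with the same radius. -/
theorem CondSE.condE (hS : Setting ι V L A B Binf) [CompleteSpace X] {ρ : ℝ≥0∞}
    (h : CondSE ι V A Binf ρ) : CondE ι V A Binf ρ := by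
  obtain ⟨hM, h⟩ := h
  obtain ⟨κ, hκ, hM'⟩ := exists_kappa Setting.C1_nonneg hM
  rcases (Setting.C1_nonneg (ι := ι) (Binf := Binf)).eq_or_lt with h0 | h0
  · refine ⟨1, one_pos, κ, hκ, hM', fun z₁ z₂ x₁ x₂ _ _ _ _ _ _ => ?_⟩
    rw [← h0, hS.rem_eq, hS.rem_eq, ← Submodule.coe_sub, hS.eq_zero_of_C1_eq_zero h0.symm (_ - _)]
    simp
  · have hκ0 : 0 < κ := by linarith
    obtain ⟨R₁, hR₁⟩ := h (1 / (κ * C1 ι Binf)) (by positivity)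
    refine ⟨max R₁ 1, lt_max_of_lt_right one_pos, κ, hκ, hM', fun z₁ z₂ x₁ x₂ h1 h2 => ?_⟩
    exact hR₁ z₁ z₂ x₁ x₂ ((le_max_left _ _).trans h1) ((le_max_left _ _).trans h2)

/-- If `A` has the strict derivative `B(∞)` at infinity, then (SE) holds. -/
theorem Setting.condSE_of_hasStrictDerivAtInfinity (hS : Setting ι V L A B Binf)
    [CompleteSpace X] {S : X →L[ℝ] X} (hSB : ∀ x : X, ι (S x) = Binf (ι x))
    (hA : HasStrictDerivAtInfinity A S (ι ⁻¹' V)) {ρ : ℝ≥0∞}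
    (hρ : ρ = ∞ ∨ ENNReal.ofReal (C1 ι Binf) * MA ι Binf A < ρ) : CondSE ι V A Binf ρ := by
  refine ⟨hρ, fun ε hε => ?_⟩
  obtain ⟨R, hR⟩ := hA (ε / (‖hS.pm‖ + 1)) (by positivity)
  refine ⟨‖ι‖ * |R| + 1, fun z₁ z₂ x₁ x₂ hz₁ hz₂ _ _ hV₁ hV₂ => ?_⟩
  have hbig : ∀ (z : X0 ι Binf) (x : Xpm ι Binf), ‖ι‖ * |R| + 1 ≤ ‖ι (z : X)‖ →
      R ≤ ‖(z : X) + x‖ := by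
    intro z x hz
    have h1 := norm_le_norm_add z x
    have h2 := ι.le_opNorm ((z : X) + x)
    have h3 : ‖ι‖ * |R| < ‖ι‖ * ‖(z : X) + x‖ := by linarith
    exact (le_abs_self R).trans (lt_of_mul_lt_mul_left h3 (norm_nonneg _)).le
  have h1 := hR _ hV₁ _ hV₂ (hbig z₁ x₁ hz₁) (hbig z₂ x₂ hz₂)
  have e : hS.pm (A ((z₁ : X) + x₁)) - hS.Bpm x₁ - (hS.pm (A ((z₂ : X) + x₂)) - hS.Bpm x₂) =
      hS.pm (A ((z₁ : X) + x₁) - A ((z₂ : X) + x₂) - S ((z₁ : X) + x₁ - ((z₂ : X) + x₂))) := by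
    have hSx : ∀ (z : X0 ι Binf) (x : Xpm ι Binf), S ((z : X) + x) = hS.Bpm x := fun z x =>
      hS.injective (by
        rw [hSB, hS.apply_Bpm, map_add, map_add, apply_of_mem_H0 (mem_H0 z), zero_add])
    rw [map_sub S, hSx, hSx, map_sub, map_sub, map_sub, hS.pm_of_mem, hS.pm_of_mem]
    abel
  rw [hS.rem_eq, hS.rem_eq, ← Submodule.coe_sub, ← Submodule.coe_norm, e]
  refine (hS.pm.le_opNorm _).trans ?_
  calc ‖hS.pm‖ * _ ≤ ‖hS.pm‖ * (ε / (‖hS.pm‖ + 1) * ‖(z₁ : X) + x₁ - ((z₂ : X) + x₂)‖) := by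
        gcongr
    _ = ‖hS.pm‖ / (‖hS.pm‖ + 1) * (ε * ‖(z₁ : X) + x₁ - ((z₂ : X) + x₂)‖) := by ring
    _ ≤ 1 * (ε * ‖(z₁ : X) + x₁ - ((z₂ : X) + x₂)‖) := by
        gcongr
        rw [div_le_one (by positivity)]
        linarith
    _ = _ := one_mul _

/-- The two radii are unrelated, but far out `h` lies in the smaller ball: if `ρ' ≤ ρ`, uniqueness
identifies `h` with the reduction belonging to `ρ'`. Then (SE) applies along the graph of `h` with
arbitrarily small constant. -/
theorem IsReduction.hasStrictDerivAtInfinity_X {hS : Setting ι V L A B Binf} [CompleteSpace X]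
    {ρ : ℝ≥0∞} {R q : ℝ} {h : X0 ι Binf → Xpm ι Binf} (hh : IsReduction hS ρ R q h)
    {ρ' : ℝ≥0∞} (hSE : CondSE ι V A Binf ρ') :
    HasStrictDerivAtInfinity h 0 (extBall ι Binf R) := by
  obtain ⟨R₀, q', h', hh'⟩ := hS.exists_isReduction (hSE.condE hS).condE'
  obtain ⟨c, hc, hcn⟩ := hS.exists_norm_le
  have hlt : ∀ z : X0 ι Binf, R ≤ ‖ι (z : X)‖ → R₀ ≤ ‖ι (z : X)‖ → ‖h z‖ₑ < ρ' := by
    intro z hz hz'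
    rcases le_total ρ ρ' with hρ | hρ
    · exact (hh.norm_lt z hz).trans_le hρ
    · rw [← hh.unique hz ((hh'.norm_lt z hz').le.trans hρ) (hh'.eq_zero z hz')]
      exact hh'.norm_lt z hz'
  intro ε hε
  have hC : 0 ≤ C1 ι Binf := Setting.C1_nonneg
  -- Chosen so that `C₁ δ ≤ min 1 ε / 2`; then `1 - C₁ δ ≥ 1 / 2` and the Lipschitz constant of `h`
  -- is at most `ε`.
  set δ : ℝ := min 1 ε / (2 * (C1 ι Binf + 1)) with hδ
  have hm : 0 < min 1 ε := lt_min one_pos hε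
  have hδ0 : 0 < δ := by positivity
  have hCδ : C1 ι Binf * δ ≤ min 1 ε / 2 := by
    have : C1 ι Binf * δ = C1 ι Binf / (C1 ι Binf + 1) * (min 1 ε / 2) := by
      rw [hδ]; field_simp
    rw [this]
    refine mul_le_of_le_one_left (by positivity) ?_
    rw [div_le_one (by positivity)]
    linarith
  have hm1 : min 1 ε ≤ 1 := min_le_left _ _
  have hm2 : min 1 ε ≤ ε := min_le_right _ _
  obtain ⟨R₁, hR₁⟩ := hSE.2 δ hδ0
  refine ⟨c * max R₁ R₀, fun z₁ hz₁ z₂ hz₂ k₁ k₂ => ?_⟩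
  have hbig : ∀ z : X0 ι Binf, c * max R₁ R₀ ≤ ‖z‖ → R₁ ≤ ‖ι (z : X)‖ ∧ R₀ ≤ ‖ι (z : X)‖ :=
    fun z hz => by
      have := le_of_mul_le_mul_left (hz.trans (hcn z)) hc
      exact ⟨(le_max_left _ _).trans this, (le_max_right _ _).trans this⟩
  have hz₁' : R ≤ ‖ι (z₁ : X)‖ := le_of_lt hz₁
  have hz₂' : R ≤ ‖ι (z₂ : X)‖ := le_of_lt hz₂
  have h1 := hh.norm_sub_le_of_rem (by linarith) hδ0.le hz₁' hz₂'
    (hR₁ z₁ z₂ (h z₁) (h z₂) (hbig z₁ k₁).1 (hbig z₂ k₂).1 (hlt z₁ hz₁' (hbig z₁ k₁).2)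
      (hlt z₂ hz₂' (hbig z₂ k₂).2) (hh.mem z₁ hz₁' _) (hh.mem z₂ hz₂' _))
  rw [zero_apply, sub_zero]
  refine h1.trans ?_
  gcongr
  rw [div_le_iff₀ (by linarith)]
  nlinarith

theorem IsReduction.lipschitzOnWith {hS : Setting ι V L A B Binf} [CompleteSpace X]
    {ρ : ℝ≥0∞} {R q κ : ℝ} {h : X0 ι Binf → Xpm ι Binf} (hh : IsReduction hS ρ R q h)
    (hκ : 1 < κ)
    (hE : ∀ (z₁ z₂ : X0 ι Binf) (x₁ x₂ : Xpm ι Binf), R ≤ ‖ι (z₁ : X)‖ → R ≤ ‖ι (z₂ : X)‖ →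
      ‖x₁‖ₑ < ρ → ‖x₂‖ₑ < ρ → ι ((z₁ : X) + x₁) ∈ V → ι ((z₂ : X) + x₂) ∈ V →
      ‖rem ι Binf A z₁ x₁ - rem ι Binf A z₂ x₂‖ ≤
        1 / (κ * C1 ι Binf) * ‖((z₁ : X) + x₁) - ((z₂ : X) + x₂)‖) :
    ∃ K : NNReal, LipschitzOnWith K h (closedExtBall ι Binf R) := by
  set δ := 1 / (κ * C1 ι Binf) with hδ
  have hκ0 : 0 < κ := by linarith
  have hC : 0 ≤ C1 ι Binf := Setting.C1_nonneg
  have hδ0 : 0 ≤ δ := by positivity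
  have h1 : C1 ι Binf * δ < 1 :=
    (mul_one_div_le hC hκ).trans_lt ((div_lt_one hκ0).2 hκ)
  refine ⟨(C1 ι Binf * δ / (1 - C1 ι Binf * δ)).toNNReal,
    LipschitzOnWith.of_dist_le_mul fun z₁ hz₁ z₂ hz₂ => ?_⟩
  rw [dist_eq_norm, dist_eq_norm,
    Real.coe_toNNReal _ (div_nonneg (by positivity) (by linarith))]
  exact hh.norm_sub_le_of_rem h1 hδ0 hz₁ hz₂ (hE z₁ z₂ (h z₁) (h z₂) hz₁ hz₂
    (hh.norm_lt z₁ hz₁) (hh.norm_lt z₂ hz₂) (hh.mem z₁ hz₁ _) (hh.mem z₂ hz₂ _))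

end Regularity

end SplitInf

namespace SplitInf

/-! ### The functional along `H⁺` and `H⁻` -/

section Saddle

variable {H X : Type*} [NormedAddCommGroup H] [InnerProductSpace ℝ H] [CompleteSpace H]
  [NormedAddCommGroup X] [NormedSpace ℝ X]
  {ι : X →L[ℝ] H} {V : Set H} {L : H → ℝ} {A : X → X} {B : X → H →L[ℝ] H} {Binf : H →L[ℝ] H}

/-- The derivative of `σ L` in the directions of `W` is strongly monotone, with constant `a`,
over the exterior of the ball of radius `R` in `H⁰`. -/
def MonotoneAlong (L : H → ℝ) (Binf : H →L[ℝ] H) (W : Submodule ℝ H) (σ a R : ℝ) : Prop :=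
  ∀ p : H, R < ‖P0 Binf p‖ → ∀ v ∈ W, ∀ s t : ℝ, s ≤ t →
    a * ‖v‖ ^ 2 * (t - s) ≤ σ * lineDeriv ℝ L (p + t • v) v - σ * lineDeriv ℝ L (p + s • v) v

namespace MonotoneAlong

variable {W : Submodule ℝ H} {σ a R : ℝ}

theorem mono (hM : MonotoneAlong L Binf W σ a R) {R' : ℝ} (hR : R ≤ R') :
    MonotoneAlong L Binf W σ a R' := fun p hp => hM p (hR.trans_lt hp)

theorem hasDerivAt (hF1 : CondF1 V L) (hV : {w | R < ‖P0 Binf w‖} ⊆ V) (hW : W ≤ Hpm Binf)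
    {p : H} (hp : R < ‖P0 Binf p‖) {v : H} (hv : v ∈ W) (t : ℝ) :
    HasDerivAt (fun t : ℝ => σ * L (p + t • v)) (σ * lineDeriv ℝ L (p + t • v) v) t := by
  refine (hasDerivAt_line (hF1.2.1 _ (hV ?_) v)).const_mul σ
  rwa [mem_ofPred_eq, P0_add_of_mem_right (Submodule.smul_mem _ _ (hW hv))]

theorem apply_add_smul_le (hM : MonotoneAlong L Binf W σ a R) (hF1 : CondF1 V L)
    (hV : {w | R < ‖P0 Binf w‖} ⊆ V) (hW : W ≤ Hpm Binf) {p : H} (hp : R < ‖P0 Binf p‖)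
    {v : H} (hv : v ∈ W) {b c : ℝ} (hb : 0 ≤ b) (hc : 0 ≤ c) (hbc : b + c = 1) :
    σ * L (p + c • v) ≤ b * (σ * L p) + c * (σ * L (p + v)) - b * c * (a * ‖v‖ ^ 2 / 2) := by
  have := le_of_deriv_growth (hasDerivAt (σ := σ) hF1 hV hW hp hv) (hM p hp v hv) hb hc hbc
  simpa using this

theorem add_le_apply (hM : MonotoneAlong L Binf W σ a R) (hF1 : CondF1 V L)
    (hV : {w | R < ‖P0 Binf w‖} ⊆ V) (hW : W ≤ Hpm Binf) {p : H} (hp : R < ‖P0 Binf p‖)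
    {v : H} (hv : v ∈ W) (h0 : lineDeriv ℝ L p v = 0) :
    σ * L p + a * ‖v‖ ^ 2 / 2 ≤ σ * L (p + v) := by
  have := add_le_of_deriv_growth (hasDerivAt (σ := σ) hF1 hV hW hp hv) (hM p hp v hv)
    (by simp [h0])
  simpa using this

end MonotoneAlong

namespace Setting

variable (hS : Setting ι V L A B Binf)
include hS

/-- Strong monotonicity, from a bound of the quadratic forms of `B` on the range of a
projection `Pr` that preserves `X`. -/
theorem monotoneAlong_of_forall {σ a R : ℝ} (hV : {w | R < ‖P0 Binf w‖} ⊆ V) (Pr : H →L[ℝ] H)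
    {W : Submodule ℝ H} (hPrX : ∀ y : X, Pr (ι y) ∈ range ι) (hPrW : ∀ u, Pr u ∈ W)
    (hPr : ∀ u ∈ W, Pr u = u) (hW : W ≤ Hpm Binf)
    (hB : ∀ x : X, ι x ∈ V → R ≤ ‖ι x‖ → ∀ u ∈ W, a * ‖u‖ ^ 2 ≤ σ * ⟪B x u, u⟫) :
    MonotoneAlong L Binf W σ a R := by
  intro p hp v hv s t hst
  have hO : ∀ {p : H}, R < ‖P0 Binf p‖ → ∀ (t : ℝ) (v : H), p + t • Pr v ∈ V := by
    intro p hp t v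
    refine hV ?_
    rwa [mem_ofPred_eq, P0_add_of_mem_right (Submodule.smul_mem _ _ (hW (hPrW v)))]
  -- At points and in directions of `X` the derivative of `L` is given by `A`, whose derivative has
  -- the quadratic form of `B`; the bound on the latter integrates over `[s, t]`.
  have key : ∀ x y : X, R < ‖P0 Binf (ι x)‖ → a * ‖Pr (ι y)‖ ^ 2 * (t - s) ≤
      σ * lineDeriv ℝ L (ι x + t • Pr (ι y)) (Pr (ι y)) -
        σ * lineDeriv ℝ L (ι x + s • Pr (ι y)) (Pr (ι y)) := by
    intro x y hx
    have hO' := fun r => hO hx r (ι y)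
    have hyW := hPrW (ι y)
    obtain ⟨u, hu⟩ := hPrX y
    rw [← hu] at hO' hyW ⊢
    simp only [← map_smul, ← map_add] at hO' ⊢
    have hder : ∀ r : ℝ, HasDerivAt (fun r : ℝ => σ * ⟪ι (A (x + r • u)), ι u⟫)
        (σ * ⟪B (x + r • u) (ι u), ι u⟫) r := by
      intro r
      have h1 := hasDerivAt_line (hS.condF2.1.2.1 _ (hO' r) u)
      have h2 := ((ι.hasFDerivAt.comp_hasDerivAt r h1).inner ℝ (hasDerivAt_const r (ι u))).const_mul
        σ
      rw [hS.lineDeriv_apply (hO' r)] at h2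
      simpa using h2
    have := mul_sub_le_image_sub_of_le_deriv (fun r => (hder r).differentiableAt)
      (C := a * ‖ι u‖ ^ 2) (fun r => ?_) hst
    · rw [hS.condF2.2 _ (hO' t) u, hS.condF2.2 _ (hO' s) u]
      exact this
    · rw [(hder r).deriv]
      refine hB _ (hO' r) ?_ _ hyW
      have h3 : R < ‖P0 Binf (ι (x + r • u))‖ := by
        rwa [map_add, map_smul, P0_add_of_mem_right (Submodule.smul_mem _ _ (hW hyW))]
      exact h3.le.trans (norm_P0_le _)
  -- Failure would be an open condition on `(p, v)`, so it would occur at a point of `X × X`.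
  -- Composing with `Pr` keeps the approximating directions in `W`.
  by_contra! hlt
  have hcont : ∀ r : ℝ, ContinuousAt (fun q : H × H =>
      lineDeriv ℝ L (q.1 + r • Pr q.2) (Pr q.2)) (p, v) := by
    intro r
    have h1 := hS.condF1.2.2.continuousAt (x := (p + r • Pr v, Pr v))
      ((hS.isOpen.prod isOpen_univ).mem_nhds ⟨hO hp r v, mem_univ _⟩)
    exact ContinuousAt.comp (g := fun q : H × H => lineDeriv ℝ L q.1 q.2)
      (f := fun q : H × H => (q.1 + r • Pr q.2, Pr q.2)) h1 (by fun_prop)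
  have hF : ContinuousAt (fun q : H × H => σ * lineDeriv ℝ L (q.1 + t • Pr q.2) (Pr q.2) -
      σ * lineDeriv ℝ L (q.1 + s • Pr q.2) (Pr q.2)) (p, v) :=
    ((hcont t).const_mul σ).sub ((hcont s).const_mul σ)
  have hG : ContinuousAt (fun q : H × H => a * ‖Pr q.2‖ ^ 2 * (t - s)) (p, v) := by fun_prop
  have hN : ContinuousAt (fun q : H × H => ‖P0 Binf q.1‖) (p, v) := by fun_prop
  have hev := (hF.eventually_lt hG (by rwa [hPr v hv])).and
    (continuousAt_const.eventually_lt hN hp)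
  obtain ⟨⟨x, y⟩, h1, h2⟩ := (hS.denseRange.prodMap hS.denseRange).mem_nhds hev
  exact absurd (key x y h2) (not_le.2 h1)

theorem lineDeriv_eq_inner {x : X} (hx : ι x ∈ V) (v : H) :
    lineDeriv ℝ L (ι x) v = ⟪ι (A x), v⟫ := by
  have h1 : Continuous fun v : H => lineDeriv ℝ L (ι x) v := by
    rw [← continuousOn_univ]
    exact hS.condF1.2.2.comp (f := fun v : H => (ι x, v)) (by fun_prop) fun v _ => ⟨hx, mem_univ _⟩
  have h2 : Continuous fun v : H => ⟪ι (A x), v⟫ := by fun_prop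
  exact congrFun (hS.denseRange.equalizer h1 h2 (funext fun u => hS.condF2.2 x hx u)) v

theorem mem_range_Pminus [FiniteDimensional ℝ (Hminus Binf)] (u : H) :
    Pminus Binf u ∈ range ι :=
  hS.mem_range_of_mem_sup (Submodule.mem_sup_right (Pminus_mem u))

theorem mem_range_Pplus [FiniteDimensional ℝ (Hminus Binf)] {u : H} (hu : u ∈ range ι) :
    Pplus Binf u ∈ range ι := by
  obtain ⟨x, rfl⟩ := hu
  obtain ⟨y, hy⟩ := hS.mem_range_Pminus (ι x)
  obtain ⟨z, hz⟩ := hS.mem_range_of_mem_sup (Submodule.mem_sup_left (P0_mem (T := Binf) (ι x)))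
  refine ⟨x - z - y, ?_⟩
  rw [Pplus_apply, map_sub, map_sub, hy, hz]

theorem exists_monotoneAlong : ∃ a > 0, ∃ R, {w | R < ‖P0 Binf w‖} ⊆ V ∧
    MonotoneAlong L Binf (Hplus Binf) 1 a R ∧ MonotoneAlong L Binf (Hminus Binf) (-1) a R := by
  have := hS.finiteDimensional_sup
  have : FiniteDimensional ℝ (Hminus Binf) := finiteDimensional_Hminus
  obtain ⟨a, ha, R₁, hgap⟩ := hS.exists_gaps_near_infinity
  obtain ⟨r, hr⟩ := hS.exterior_subset
  have hV : {w | max R₁ r < ‖P0 Binf w‖} ⊆ V := fun w hw =>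
    hr (((le_max_right _ _).trans_lt hw).trans_le (norm_P0_le w))
  refine ⟨a, ha, max R₁ r, hV, ?_, ?_⟩
  · exact hS.monotoneAlong_of_forall hV (Pplus Binf) (fun y => hS.mem_range_Pplus ⟨y, rfl⟩)
      (Pplus_mem hS.selfAdjoint) (fun u => Pplus_of_mem) Hplus_le_Hpm fun x hx hxR u hu => by
        rw [one_mul]
        exact (hgap x hx ((le_max_left _ _).trans hxR)).1 u hu
  · exact hS.monotoneAlong_of_forall hV (Pminus Binf) (fun y => hS.mem_range_Pminus _)
      Pminus_mem (fun u => Pminus_of_mem) (Hminus_le_Hpm hS.selfAdjoint) fun x hx hxR u hu => by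
        have := (hgap x hx ((le_max_left _ _).trans hxR)).2 u hu
        linarith

end Setting

namespace IsReduction

variable {hS : Setting ι V L A B Binf} [CompleteSpace X] {ρ : ℝ≥0∞} {R q a : ℝ}
  {h : X0 ι Binf → Xpm ι Binf}

theorem lineDeriv_eq_zero (hh : IsReduction hS ρ R q h) {z : X0 ι Binf} (hz : R ≤ ‖ι (z : X)‖)
    {v : H} (hv : v ∈ Hpm Binf) : lineDeriv ℝ L (ι ((z : X) + h z)) v = 0 := by
  rw [hS.lineDeriv_eq_inner (hh.mem z hz _)]
  exact inner_H0_Hpm (hS.pm_eq_zero_iff.1 (hh.eq_zero z hz)) hv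

/-- The abstract saddle lemma is applied to the increment of `L` from `z + h z`: monotone
derivatives supply convexity and strong concavity, and the vanishing derivative along `H^±` puts the
saddle point at the origin. -/
theorem exists_saddle_homeomorph (hh : IsReduction hS ρ R q h) (ha : 0 < a)
    (hV : {w | R < ‖P0 Binf w‖} ⊆ V) (hp : MonotoneAlong L Binf (Hplus Binf) 1 a R)
    (hm : MonotoneAlong L Binf (Hminus Binf) (-1) a R) :
    ∃ Θ : (extBall ι Binf R × Hplus Binf) × Hminus Binf ≃ₜ
        (extBall ι Binf R × Hplus Binf) × Hminus Binf, ∀ z u v,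
      (Θ ((z, u), v)).1.1 = z ∧ (∃ t : ℝ, 0 < t ∧ (Θ ((z, u), v)).1.2 = t • u) ∧
      L (ι ((z : X0 ι Binf) + h z : X) + (Θ ((z, u), v)).1.2 + (Θ ((z, u), v)).2) =
        ‖u‖ ^ 2 - ‖v‖ ^ 2 + L (ι ((z : X0 ι Binf) + h z : X)) ∧
      (u = 0 → v = 0 → (Θ ((z, u), v)).2 = 0) := by
  have := hS.finiteDimensional_sup
  have : FiniteDimensional ℝ (Hminus Binf) := finiteDimensional_Hminus
  have hWm := Hminus_le_Hpm hS.selfAdjoint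
  have hWp : Hplus Binf ≤ Hpm Binf := Hplus_le_Hpm
  set b : extBall ι Binf R → H := fun z => ι ((z : X0 ι Binf) + h z : X) with hb
  have hbO : ∀ (z : extBall ι Binf R) (u : Hplus Binf) (v : Hminus Binf),
      R < ‖P0 Binf (b z + u + v)‖ := by
    intro z u v
    rw [P0_add_of_mem_right (hWm v.2), P0_add_of_mem_right (hWp u.2)]
    change R < ‖P0 Binf (ι ((z : X0 ι Binf) + h z : X))‖
    rw [map_add, P0_add_of_mem (mem_H0 _) (mem_Hpm _)]
    exact z.2
  have hb0 : ∀ z : extBall ι Binf R, R < ‖P0 Binf (b z)‖ := fun z => by simpa using hbO z 0 0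
  have hbc : Continuous b := by
    have h1 : Continuous fun z : extBall ι Binf R => h z :=
      (hh.continuousOn.mono fun z (hz : R < _) => hz.le).domRestrict
    exact ι.continuous.comp ((continuous_subtype_val.comp continuous_subtype_val).add
      (continuous_subtype_val.comp h1))
  refine (SplitInf.exists_saddle_homeomorph
    (J := fun (z : extBall ι Binf R) (u : Hplus Binf) (v : Hminus Binf) =>
      L (b z + u + v) - L (b z)) (c := a / 2) (half_pos ha)
    ?_ ?_ ?_ ?_ ?_ ?_).imp fun Θ hΘ z u v => ?_
  · refine Continuous.sub ?_ ?_
    · exact hS.condF1.1.comp_continuous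
        (f := fun p : (extBall ι Binf R × Hplus Binf) × Hminus Binf => b p.1.1 + p.1.2 + p.2)
        (by fun_prop) fun p => hV (hbO _ _ _)
    · exact hS.condF1.1.comp_continuous
        (f := fun p : (extBall ι Binf R × Hplus Binf) × Hminus Binf => b p.1.1)
        (by fun_prop) fun p => hV (hb0 _)
  · refine fun z v => ⟨convex_univ, fun u₁ _ u₂ _ s t hs ht hst => ?_⟩
    have h1 := hp.apply_add_smul_le hS.condF1 hV hWp (hbO z u₁ v) (u₂ - u₁).2 hs ht hst
    have e1 : b z + (u₁ : H) + v + t • ((u₂ - u₁ : Hplus Binf) : H) =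
        b z + ((s • u₁ + t • u₂ : Hplus Binf) : H) + v := by
      rw [← eq_sub_iff_add_eq] at hst
      subst hst
      simp only [Submodule.coe_add, Submodule.coe_smul, Submodule.coe_sub]
      module
    have e2 : b z + (u₁ : H) + v + ((u₂ - u₁ : Hplus Binf) : H) = b z + u₂ + v := by
      rw [Submodule.coe_sub]; abel
    rw [e1, e2, one_mul, one_mul, one_mul] at h1
    have h2 : 0 ≤ s * t * (a * ‖((u₂ - u₁ : Hplus Binf) : H)‖ ^ 2 / 2) := by positivity
    have h3 : L (b z) = s * L (b z) + t * L (b z) := by rw [← add_mul, hst, one_mul]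
    simp only [smul_eq_mul]
    linarith
  · refine fun z u => ⟨convex_univ, fun v₁ _ v₂ _ s t hs ht hst => ?_⟩
    have h1 := hm.apply_add_smul_le hS.condF1 hV hWm (hbO z u v₁) (v₂ - v₁).2 hs ht hst
    have e1 : b z + (u : H) + v₁ + t • ((v₂ - v₁ : Hminus Binf) : H) =
        b z + u + ((s • v₁ + t • v₂ : Hminus Binf) : H) := by
      rw [← eq_sub_iff_add_eq] at hst
      subst hst
      simp only [Submodule.coe_add, Submodule.coe_smul, Submodule.coe_sub]
      module
    have e2 : b z + (u : H) + v₁ + ((v₂ - v₁ : Hminus Binf) : H) = b z + u + v₂ := by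
      rw [Submodule.coe_sub]; abel
    rw [e1, e2] at h1
    have h3 : L (b z) = s * L (b z) + t * L (b z) := by rw [← add_mul, hst, one_mul]
    have h4 : ‖v₁ - v₂‖ = ‖((v₂ - v₁ : Hminus Binf) : H)‖ := norm_sub_rev _ _
    simp only [smul_eq_mul, h4]
    linarith
  · simp
  · intro z u
    have h1 := hp.add_le_apply hS.condF1 hV hWp (hb0 z) u.2
      (hh.lineDeriv_eq_zero (le_of_lt z.2) (hWp u.2))
    simp only [ZeroMemClass.coe_zero, add_zero, Submodule.coe_norm]
    linarith
  · intro z v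
    have h1 := hm.add_le_apply hS.condF1 hV hWm (hb0 z) v.2
      (hh.lineDeriv_eq_zero (le_of_lt z.2) (hWm v.2))
    have h2 : 0 ≤ a * ‖(v : H)‖ ^ 2 / 2 := by positivity
    simp only [ZeroMemClass.coe_zero, add_zero]
    linarith
  · obtain ⟨h1, h2, h3, h4⟩ := hΘ z u v
    exact ⟨h1, h2, by linarith, h4⟩

end IsReduction

end Saddle

end SplitInf

namespace SplitInf

/-! ### The homeomorphism `Φ` -/

section NormalForm

variable {H X : Type*} [NormedAddCommGroup H] [InnerProductSpace ℝ H] [CompleteSpace H]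
  [NormedAddCommGroup X] [NormedSpace ℝ X]
  {ι : X →L[ℝ] H} {V : Set H} {L : H → ℝ} {A : X → X} {B : X → H →L[ℝ] H} {Binf : H →L[ℝ] H}

namespace Setting

variable (hS : Setting ι V L A B Binf) [FiniteDimensional ℝ (Hminus Binf)]

/-- The projection of `H` onto `H⁰ ⊕ H⁻`, with values in `X`. -/
noncomputable def liftSup : H →L[ℝ] X :=
  hS.lift.comp ((P0 Binf + Pminus Binf).codRestrict _ fun w =>
    Submodule.add_mem_sup (P0_mem w) (Pminus_mem w))

include hS

theorem apply_liftSup (w : H) : ι (hS.liftSup w) = P0 Binf w + Pminus Binf w :=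
  hS.apply_lift _

theorem P0_apply_liftSup (w : H) : P0 Binf (ι (hS.liftSup w)) = P0 Binf w := by
  rw [hS.apply_liftSup, P0_add_of_mem (P0_mem w) (Hminus_le_Hpm hS.selfAdjoint (Pminus_mem w))]

theorem apply_pr_liftSup (w : H) : ι (hS.pr (hS.liftSup w) : X) = P0 Binf w := by
  rw [hS.apply_pr, hS.P0_apply_liftSup]

theorem apply_liftSup_of_mem {w : H} (hw : w ∈ H0 Binf ⊔ Hminus Binf) :
    ι (hS.liftSup w) = w := by
  obtain ⟨z, hz, v, hv, rfl⟩ := Submodule.mem_sup.1 hw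
  have h0 := Pminus_add hS.selfAdjoint hz (Submodule.zero_mem (Hplus Binf)) hv
  rw [zero_add] at h0
  rw [hS.apply_liftSup, h0, P0_add_of_mem hz (Hminus_le_Hpm hS.selfAdjoint hv)]

theorem liftSup_apply {x : X} (hx : ι x ∈ H0 Binf ⊔ Hminus Binf) : hS.liftSup (ι x) = x :=
  hS.injective (hS.apply_liftSup_of_mem hx)

theorem pr_liftSup_of_P0_eq {w : H} {z : X0 ι Binf} (hw : P0 Binf w = ι (z : X)) :
    hS.pr (hS.liftSup w) = z :=
  Subtype.ext (hS.injective (by rw [hS.apply_pr_liftSup, hw]))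

/-- The splitting of `B_{H⁰}(∞, R) ⊕ H^±` into its three components. -/
noncomputable def splitHomeomorph (R : ℝ) :
    Omega Binf R ≃ₜ (extBall ι Binf R × Hplus Binf) × Hminus Binf where
  toFun w := ((⟨hS.pr (hS.liftSup w), by
      change R < ‖ι _‖
      rw [hS.apply_pr_liftSup]
      exact w.2⟩, ⟨Pplus Binf w, Pplus_mem hS.selfAdjoint _⟩), ⟨Pminus Binf w, Pminus_mem _⟩)
  invFun p := ⟨ι ((p.1.1 : X0 ι Binf) : X) + ((p.1.2 : H) + p.2), by
    change R < ‖P0 Binf _‖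
    rw [P0_add_of_mem (mem_H0 _) (add_mem_Hpm hS.selfAdjoint p.1.2.2 p.2.2)]
    exact p.1.1.2⟩
  left_inv w := Subtype.ext (by
    change ι (hS.pr (hS.liftSup w) : X) + (Pplus Binf w + Pminus Binf (w : H)) = w
    rw [hS.apply_pr_liftSup, P0_add_Pplus_add_Pminus])
  right_inv p := by
    obtain ⟨⟨z, u⟩, v⟩ := p
    refine Prod.ext (Prod.ext (Subtype.ext ?_) (Subtype.ext ?_)) (Subtype.ext ?_)
    · exact hS.pr_liftSup_of_P0_eq
        (P0_add_of_mem (mem_H0 _) (add_mem_Hpm hS.selfAdjoint u.2 v.2))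
    · exact Pplus_add hS.selfAdjoint (mem_H0 _) u.2 v.2
    · exact Pminus_add hS.selfAdjoint (mem_H0 _) u.2 v.2
  continuous_toFun := by fun_prop
  continuous_invFun := by fun_prop

theorem splitHomeomorph_symm_apply {R : ℝ} (z : extBall ι Binf R) (u : Hplus Binf)
    (v : Hminus Binf) : ((hS.splitHomeomorph R).symm ((z, u), v) : H) =
      ι ((z : X0 ι Binf) : X) + ((u : H) + v) := rfl

theorem splitHomeomorph_apply {R : ℝ} {w : Omega Binf R} {z : X0 ι Binf}
    (hz : z ∈ extBall ι Binf R) {u v : H} (hu : u ∈ Hplus Binf) (hv : v ∈ Hminus Binf)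
    (hw : (w : H) = ι (z : X) + (u + v)) :
    hS.splitHomeomorph R w = ((⟨z, hz⟩, ⟨u, hu⟩), ⟨v, hv⟩) := by
  rw [← Homeomorph.eq_symm_apply]
  exact Subtype.ext hw

theorem pr_liftSup_add (w : H) (x : Xpm ι Binf) :
    hS.pr (hS.liftSup (w + ι (x : X))) = hS.pr (hS.liftSup w) :=
  hS.pr_liftSup_of_P0_eq (by rw [P0_add_of_mem_right (mem_Hpm x), hS.apply_pr_liftSup])

theorem add_mem_Omega {R : ℝ} (w : Omega Binf R) (x : Xpm ι Binf) :
    (w : H) + ι (x : X) ∈ Omega Binf R := by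
  change R < ‖P0 Binf _‖
  rw [P0_add_of_mem_right (mem_Hpm x)]
  exact w.2

theorem continuous_comp_pr_liftSup {R : ℝ} {h : X0 ι Binf → Xpm ι Binf}
    (hc : ContinuousOn h (extBall ι Binf R)) :
    Continuous fun w : Omega Binf R => ι (h (hS.pr (hS.liftSup w)) : X) := by
  have h1 : Continuous fun w : Omega Binf R => h (hS.pr (hS.liftSup w)) :=
    hc.comp_continuous (by fun_prop) fun w => by
      change R < ‖ι _‖
      rw [hS.apply_pr_liftSup]
      exact w.2
  exact ι.continuous.comp (continuous_subtype_val.comp h1)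

/-- The translation by a map from `B_{H⁰}(∞, R)` to `X^±`. -/
noncomputable def shiftHomeomorph {R : ℝ} {h : X0 ι Binf → Xpm ι Binf}
    (hc : ContinuousOn h (extBall ι Binf R)) : Omega Binf R ≃ₜ Omega Binf R where
  toFun w := ⟨w + ι (h (hS.pr (hS.liftSup w)) : X), hS.add_mem_Omega w _⟩
  invFun w := ⟨w + ι ((-h (hS.pr (hS.liftSup w)) : Xpm ι Binf) : X), hS.add_mem_Omega w _⟩
  left_inv w := Subtype.ext (by
    simp only [hS.pr_liftSup_add]
    simp)
  right_inv w := Subtype.ext (by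
    simp only [hS.pr_liftSup_add]
    simp)
  continuous_toFun :=
    (continuous_subtype_val.add (hS.continuous_comp_pr_liftSup hc)).subtype_mk _
  continuous_invFun := by
    simp only [Submodule.coe_neg, map_neg, ← sub_eq_add_neg]
    exact (continuous_subtype_val.sub (hS.continuous_comp_pr_liftSup hc)).subtype_mk _

theorem shiftHomeomorph_apply {R : ℝ} {h : X0 ι Binf → Xpm ι Binf}
    (hc : ContinuousOn h (extBall ι Binf R)) (w : Omega Binf R) :
    (hS.shiftHomeomorph hc w : H) = w + ι (h (hS.pr (hS.liftSup w)) : X) := rfl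

end Setting

namespace IsReduction

variable {hS : Setting ι V L A B Binf} [CompleteSpace X] {ρ : ℝ≥0∞} {R q a : ℝ}
  {h : X0 ι Binf → Xpm ι Binf}

/-- `Φ` is the saddle homeomorphism in the coordinates `(z, u⁺, u⁻)`, followed by the shift by `h
z`. The positive scalar `t` is recorded since it keeps the new `H⁺`-component on the ray of `u`:
this later gives the invariance of `X` and the criterion for `φ` to land in `H⁻`. -/
theorem exists_normalForm (hh : IsReduction hS ρ R q h) (ha : 0 < a)
    (hV : {w | R < ‖P0 Binf w‖} ⊆ V) (hp : MonotoneAlong L Binf (Hplus Binf) 1 a R)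
    (hm : MonotoneAlong L Binf (Hminus Binf) (-1) a R) :
    ∃ Φ : Omega Binf R ≃ₜ Omega Binf R, ∀ w : Omega Binf R, ∀ z : X0 ι Binf, ∀ u ∈ Hplus Binf,
      ∀ v ∈ Hminus Binf, (w : H) = ι (z : X) + (u + v) →
      ∃ t : ℝ, 0 < t ∧ ∃ v' ∈ Hminus Binf, (Φ w : H) = ι (z : X) + ι (h z : X) + (t • u + v') ∧
        L (Φ w) = ‖u‖ ^ 2 - ‖v‖ ^ 2 + L (ι ((z : X) + h z)) ∧ (u = 0 → v = 0 → v' = 0) := by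
  have := hS.finiteDimensional_sup
  have : FiniteDimensional ℝ (Hminus Binf) := finiteDimensional_Hminus
  obtain ⟨Θ, hΘ⟩ := hh.exists_saddle_homeomorph ha hV hp hm
  have hc : ContinuousOn h (extBall ι Binf R) :=
    hh.continuousOn.mono fun z (hz : R < _) => hz.le
  refine ⟨(((hS.splitHomeomorph R).trans Θ).trans (hS.splitHomeomorph R).symm).trans
    (hS.shiftHomeomorph hc), fun w z u hu v hv hw => ?_⟩
  have hz : z ∈ extBall ι Binf R := by
    have h1 : R < ‖P0 Binf (w : H)‖ := w.2
    rwa [hw, P0_add_of_mem (mem_H0 _) (add_mem_Hpm hS.selfAdjoint hu hv)] at h1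
  obtain ⟨h1, ⟨t, ht, h2⟩, h3, h4⟩ := hΘ ⟨z, hz⟩ ⟨u, hu⟩ ⟨v, hv⟩
  rw [← hS.splitHomeomorph_apply hz hu hv hw] at h1 h2 h3 h4
  obtain ⟨⟨⟨z', u'⟩, v'⟩, hΘw⟩ : ∃ p, p = Θ (hS.splitHomeomorph R w) := ⟨_, rfl⟩
  rw [← hΘw] at h1 h2 h3 h4
  simp only at h1 h2 h3 h4
  subst h1 h2
  have e : (((((hS.splitHomeomorph R).trans Θ).trans (hS.splitHomeomorph R).symm).trans
      (hS.shiftHomeomorph hc)) w : H) = ι (z : X) + ι (h z : X) + (t • u + v') := by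
    simp only [Homeomorph.trans_apply]
    rw [hS.shiftHomeomorph_apply, ← hΘw, hS.splitHomeomorph_symm_apply,
      hS.pr_liftSup_of_P0_eq (P0_add_of_mem (mem_H0 _)
        (add_mem_Hpm hS.selfAdjoint (Submodule.coe_mem _) v'.2))]
    simp only [Submodule.coe_smul]
    abel
  refine ⟨t, ht, v', v'.2, e, ?_, fun hu0 hv0 => ?_⟩
  · rw [e, ← map_add, ← add_assoc]
    exact h3
  · rw [h4 (Subtype.ext hu0) (Subtype.ext hv0), ZeroMemClass.coe_zero]

/-- On `B_{H⁰}(∞, R) ⊕ H⁻`, a homeomorphism of the normal form is also one for the topology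
of `X`. -/
theorem exists_homeomorph_minusSet (hh : IsReduction hS ρ R q h)
    (Φ : Omega Binf R ≃ₜ Omega Binf R)
    (hΦ : ∀ w : Omega Binf R, ∀ z : X0 ι Binf, ∀ v ∈ Hminus Binf, (w : H) = ι (z : X) + v →
      ∃ v' ∈ Hminus Binf, (Φ w : H) = ι (z : X) + ι (h z : X) + v') :
    ∃ Ψ : minusSet ι Binf R ≃ₜ minusImage ι Binf R Φ,
      ∀ (x : minusSet ι Binf R) (w : Omega Binf R), (w : H) = ι (x : X) →
        ι (Ψ x : X) = (Φ w : H) := by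
  have := hS.finiteDimensional_sup
  have : FiniteDimensional ℝ (Hminus Binf) := finiteDimensional_Hminus
  have hmem : ∀ x ∈ minusSet ι Binf R, ι x ∈ Omega Binf R ∧ ι x ∈ H0 Binf ⊔ Hminus Binf := by
    rintro x ⟨z, hz, v, hv, hzR, hx⟩
    rw [hx]
    refine ⟨?_, Submodule.add_mem_sup hz hv⟩
    change R < ‖P0 Binf _‖
    rwa [P0_add_of_mem hz (Hminus_le_Hpm hS.selfAdjoint hv)]
  have hmem' : ∀ y ∈ minusImage ι Binf R Φ, ∃ hy : ι y ∈ Omega Binf R,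
      hS.liftSup (Φ.symm ⟨ι y, hy⟩ : H) ∈ minusSet ι Binf R ∧
      ι (hS.liftSup (Φ.symm ⟨ι y, hy⟩ : H)) = (Φ.symm ⟨ι y, hy⟩ : H) := by
    rintro y ⟨w, x, hx, hwx, hy⟩
    have hyO : ι y ∈ Omega Binf R := hy ▸ (Φ w).2
    have e : Φ.symm ⟨ι y, hyO⟩ = w := by
      rw [Homeomorph.symm_apply_eq]
      exact Subtype.ext hy
    refine ⟨hyO, ?_⟩
    rw [e, hwx, hS.liftSup_apply (hmem x hx).2]
    exact ⟨hx, rfl⟩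
  -- Subtracting `h z` leaves a vector of `H⁰ ⊕ H⁻`, which `liftSup` carries continuously into `X`;
  -- then `h z`, continuous into `X`, is added back.
  set F : minusSet ι Binf R → X := fun x =>
    h (hS.pr (x : X)) + hS.liftSup (Φ ⟨ι x, (hmem x x.2).1⟩ - ι (h (hS.pr (x : X)) : X)) with hF
  have hιF : ∀ x : minusSet ι Binf R, ι (F x) = Φ ⟨ι x, (hmem x x.2).1⟩ := by
    intro x
    obtain ⟨z, hz, v, hv, -, hx⟩ := x.2
    have hz' : ι (hS.pr (x : X) : X) = z := by
      rw [hS.apply_pr, hx, P0_add_of_mem hz (Hminus_le_Hpm hS.selfAdjoint hv)]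
    obtain ⟨v', hv', h1⟩ := hΦ ⟨ι x, (hmem x x.2).1⟩ (hS.pr (x : X)) v hv (by rw [hz', ← hx])
    have h2 : (Φ ⟨ι x, (hmem x x.2).1⟩ : H) - ι (h (hS.pr (x : X)) : X) =
        ι (hS.pr (x : X) : X) + v' := by
      rw [h1]; abel
    rw [hF]
    change ι (_ + _) = _
    rw [map_add, hS.apply_liftSup_of_mem, add_sub_cancel]
    rw [h2]
    exact Submodule.add_mem_sup (mem_H0 _) hv'
  have hFc : Continuous F := by
    have h1 : Continuous fun x : minusSet ι Binf R => h (hS.pr (x : X)) :=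
      hh.continuousOn.comp_continuous (by fun_prop) fun x => by
        change R ≤ ‖ι _‖
        rw [hS.apply_pr]
        exact le_of_lt (hmem x x.2).1
    have h2 : Continuous fun x : minusSet ι Binf R => (Φ ⟨ι x, (hmem x x.2).1⟩ : H) := by
      fun_prop
    exact (continuous_subtype_val.comp h1).add
      (hS.liftSup.continuous.comp (h2.sub (ι.continuous.comp (continuous_subtype_val.comp h1))))
  have hFm : ∀ x : minusSet ι Binf R, F x ∈ minusImage ι Binf R Φ := fun x =>
    ⟨⟨ι x, (hmem x x.2).1⟩, x, x.2, rfl, hιF x⟩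
  refine ⟨{ toFun := fun x => ⟨F x, hFm x⟩
            invFun := fun y => ⟨hS.liftSup (Φ.symm ⟨ι y, (hmem' y y.2).1⟩ : H), (hmem' y y.2).2.1⟩
            left_inv := fun x => Subtype.ext ?_
            right_inv := fun y => Subtype.ext (hS.injective ?_)
            continuous_toFun := by fun_prop
            continuous_invFun := by fun_prop }, fun x w hw => ?_⟩
  · have e : Φ.symm ⟨ι (F x), (hmem' _ (hFm x)).1⟩ = ⟨ι x, (hmem x x.2).1⟩ := by
      rw [Homeomorph.symm_apply_eq]
      exact Subtype.ext (hιF x)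
    change hS.liftSup (Φ.symm ⟨ι (F x), _⟩ : H) = x
    rw [e]
    exact hS.liftSup_apply (hmem x x.2).2
  · have e := (hmem' y y.2).2.2
    change ι (F ⟨hS.liftSup (Φ.symm ⟨ι y, (hmem' y y.2).1⟩ : H), _⟩) = ι y
    rw [hιF]
    simp only [e, Subtype.coe_eta, Homeomorph.apply_symm_apply]
  · change ι (F x) = _
    rw [hιF]
    congr 2
    exact Subtype.ext hw.symm

end IsReduction

end NormalForm

end SplitInf

/-! ### Assembly of the theorem -/

theorem theorem1p1
    {H X : Type*} [NormedAddCommGroup H] [InnerProductSpace ℝ H] [CompleteSpace H]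
    [NormedAddCommGroup X] [NormedSpace ℝ X] [CompleteSpace X]
    -- (S): the inclusion of `X` in `H`
    (ι : X →L[ℝ] H) (hι : Function.Injective ι) (hdense : DenseRange ι)
    -- `V` is an open neighborhood of infinity in `H`
    (V : Set H) (hV : IsOpen V) (hVinf : ∃ r : ℝ, {u : H | r < ‖u‖} ⊆ V)
    (L : H → ℝ) (A : X → X) (B : X → H →L[ℝ] H) (Binf : H →L[ℝ] H)
    (hF1 : CondF1 V L) (hF2 : CondF2 ι V L A) (hF3 : CondF3 ι V A B Binf)
    (hC1 : CondC1 Binf) (hC2 : CondC2 ι Binf) (hD : CondD ι V B Binf)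
    -- the nullity is positive
    (hnull : 0 < Module.rank ℝ (H0 Binf))
    (ρ : ℝ≥0∞) (hE' : CondE' ι V A Binf ρ)
    (hquad : (fun u : H => L u - (1 / 2) * ⟪Binf u, u⟫)
      =o[Bornology.cobounded H] (fun u : H => ‖u‖ ^ 2)) :
    ∃ (R : ℝ) (h : X0 ι Binf → Xpm ι Binf) (φ : H → H → H) (Φ : Omega Binf R ≃ₜ Omega Binf R),
      0 < R ∧ {w : H | R ≤ ‖P0 Binf w‖} ⊆ V ∧
      (((H0 Binf ⊔ Hminus Binf : Submodule ℝ H) : Set H) ⊆ range ι) ∧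
      -- the map `h`
      ContinuousOn h (closedExtBall ι Binf R) ∧
      (∀ z ∈ closedExtBall ι Binf R,
        ‖h z‖ₑ ≤ ρ ∧ pmPart ι Binf (A ((z : X) + h z)) = 0 ∧
        ∀ x : Xpm ι Binf, ‖x‖ₑ ≤ ρ → pmPart ι Binf (A ((z : X) + x)) = 0 → x = h z) ∧
      -- the form of `Φ`
      (∀ w : Omega Binf R, ∀ z : X0 ι Binf, ∀ u ∈ Hpm Binf, (w : H) = ι (z : X) + u →
        φ (ι (z : X)) u ∈ Hpm Binf ∧
        (Φ w : H) = ι (z : X) + ι (h z : X) + φ (ι (z : X)) u) ∧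
      (∀ w : Omega Binf R, (w : H) ∈ range ι → (Φ w : H) ∈ range ι) ∧
      -- the normal form of `L`
      (∀ w : Omega Binf R, ∀ z : X0 ι Binf, ∀ up ∈ Hplus Binf, ∀ um ∈ Hminus Binf,
        (w : H) = ι (z : X) + (up + um) →
        L (Φ w : H) = ‖up‖ ^ 2 - ‖um‖ ^ 2 + L (ι ((z : X) + h z))) ∧
      -- (a)
      (∀ w : Omega Binf R, ∀ z : X0 ι Binf, (w : H) = ι (z : X) →
        (Φ w : H) = ι ((z : X) + h z)) ∧
      (∀ z ∈ extBall ι Binf R, ∀ up ∈ Hplus Binf, ∀ um ∈ Hminus Binf,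
        (φ (ι (z : X)) (up + um) ∈ Hminus Binf ↔ up = 0)) ∧
      -- (b)
      (∃ Ψ : minusSet ι Binf R ≃ₜ minusImage ι Binf R Φ,
        ∀ (x : minusSet ι Binf R) (w : Omega Binf R), (w : H) = ι (x : X) →
          ι (Ψ x : X) = (Φ w : H)) ∧
      -- (i)
      (MA ι Binf A = 0 → Tendsto h (Bornology.cobounded (X0 ι Binf)) (𝓝 0)) ∧
      -- (ii)
      (ContDiffOn ℝ 1 A (ι ⁻¹' V) →
        ContDiffOn ℝ 1 h (extBall ι Binf R) ∧
        (∀ z ∈ extBall ι Binf R, ∃ T : Xpm ι Binf ≃L[ℝ] Xpm ι Binf,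
          (∀ x : Xpm ι Binf, (T x : X) = pmPart ι Binf (fderiv ℝ A ((z : X) + h z) (x : X))) ∧
          ∀ (w : X0 ι Binf) (y : Xpm ι Binf),
            (y : X) = pmPart ι Binf (fderiv ℝ A ((z : X) + h z) (w : X)) →
            fderiv ℝ h z w = -(T.symm y)) ∧
        ContDiffOn ℝ 2 (Lred ι Binf L h) (extBall ι Binf R) ∧
        ∀ z ∈ extBall ι Binf R,
          HasFDerivAt (Lred ι Binf L h) (formH0 ι Binf (A ((z : X) + h z))) z) ∧
      -- (iii)
      (ContDiffOn ℝ 2 L V →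
        ContDiffOn ℝ 1 (fun z => ι (h z : X)) (extBall ι Binf R) ∧
        ContDiffOn ℝ 1 h (extBall ι Binf R)) ∧
      (CondE ι V A Binf ρ →
        -- (iv)
        (∃ K : NNReal, LipschitzOnWith K h (closedExtBall ι Binf R)) ∧
        HasStrictDerivAtInfinity (fun z => ι (h z : X)) 0 (extBall ι Binf R) ∧
        ((∃ ρ' : ℝ≥0∞, CondSE ι V A Binf ρ') →
          HasStrictDerivAtInfinity h 0 (extBall ι Binf R)) ∧
        -- (v)
        ContDiffOn ℝ 1 (Lred ι Binf L h) (extBall ι Binf R) ∧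
        (∀ z ∈ extBall ι Binf R,
          HasFDerivAt (Lred ι Binf L h) (formH0 ι Binf (A ((z : X) + h z))) z) ∧
        -- (vi)
        (∀ S : X →L[ℝ] X, (∀ x : X, ι (S x) = Binf (ι x)) →
          HasStrictDerivAtInfinity A S (ι ⁻¹' V) →
          LocallyLipschitzOn (extBall ι Binf R) (fderiv ℝ (Lred ι Binf L h)) ∧
          HasStrictDerivAtInfinity (fderiv ℝ (Lred ι Binf L h)) 0 (extBall ι Binf R) ∧
          ∀ ρ' : ℝ≥0∞, (ρ' = ∞ ∨ ENNReal.ofReal (C1 ι Binf) * MA ι Binf A < ρ') →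
            CondE ι V A Binf ρ')) := by
  have hS : Setting ι V L A B Binf := ⟨hι, hdense, hV, hVinf, hF1, hF2, hF3, hC2, hD, hnull⟩
  have := hS.finiteDimensional_sup
  have : FiniteDimensional ℝ (Hminus Binf) := finiteDimensional_Hminus
  have hsa := hS.selfAdjoint
  obtain ⟨R₀, q, h, hh₀⟩ := hS.exists_isReduction hE'
  obtain ⟨a, ha, R₂, hV₂, hp₂, hm₂⟩ := hS.exists_monotoneAlong
  -- The radius must be fixed before (E) is assumed, yet the Lipschitz bound needs the radius from
  -- (E); a case distinction provides one that works whenever (E) holds.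
  obtain ⟨R₁, hR₁⟩ : ∃ R₁ : ℝ, CondE ι V A Binf ρ → ∃ κ : ℝ, 1 < κ ∧
      ∀ (z₁ z₂ : X0 ι Binf) (x₁ x₂ : Xpm ι Binf), R₁ ≤ ‖ι (z₁ : X)‖ → R₁ ≤ ‖ι (z₂ : X)‖ →
      ‖x₁‖ₑ < ρ → ‖x₂‖ₑ < ρ → ι ((z₁ : X) + x₁) ∈ V → ι ((z₂ : X) + x₂) ∈ V →
      ‖rem ι Binf A z₁ x₁ - rem ι Binf A z₂ x₂‖ ≤
        1 / (κ * C1 ι Binf) * ‖((z₁ : X) + x₁) - ((z₂ : X) + x₂)‖ := by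
    by_cases hE : CondE ι V A Binf ρ
    · obtain ⟨R₁, -, κ, hκ, -, hr⟩ := hE
      exact ⟨R₁, fun _ => ⟨κ, hκ, hr⟩⟩
    · exact ⟨0, fun h => absurd h hE⟩
  -- `R₂ + 1` rather than `R₂`: the closed exterior of radius `R` must lie in `V`, while only the
  -- open one of radius `R₂` is known to.
  set R := max (max R₀ (R₂ + 1)) R₁ with hR
  have hR0 : R₀ ≤ R := (le_max_left _ _).trans (le_max_left _ _)
  have hR2 : R₂ < R := (lt_add_one R₂).trans_le ((le_max_right _ _).trans (le_max_left _ _))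
  have hR1 : R₁ ≤ R := le_max_right _ _
  have hh := hh₀.mono hR0
  have hVR : {w | R < ‖P0 Binf w‖} ⊆ V := fun w hw => hV₂ (hR2.trans hw)
  obtain ⟨Φ, hΦ⟩ := hh.exists_normalForm ha hVR (hp₂.mono hR2.le) (hm₂.mono hR2.le)
  have hpr : ∀ z : X0 ι Binf, hS.pr (hS.liftSup (ι (z : X))) = z := fun z =>
    hS.pr_liftSup_of_P0_eq (P0_of_mem_H0 (mem_H0 z))
  have hO : ∀ z ∈ extBall ι Binf R, ∀ u ∈ Hpm Binf, ι (z : X) + u ∈ Omega Binf R := by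
    intro z hz u hu
    change R < ‖P0 Binf _‖
    rwa [P0_add_of_mem (mem_H0 z) hu]
  classical
  -- `φ` is read off from `Φ`; the default `0` occurs only outside the domain of `Φ`.
  set φ : H → H → H := fun p u =>
    if hp : p + u ∈ Omega Binf R then Φ ⟨p + u, hp⟩ - p - ι (h (hS.pr (hS.liftSup p)) : X) else 0
    with hφ
  have hφΦ : ∀ w : Omega Binf R, ∀ z : X0 ι Binf, ∀ u : H, (w : H) = ι (z : X) + u →
      φ (ι (z : X)) u = Φ w - ι (z : X) - ι (h z : X) := by
    rintro ⟨w, hw⟩ z u rfl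
    rw [hφ]
    simp only [dif_pos hw, hpr]
  have hφ' : ∀ w : Omega Binf R, ∀ z : X0 ι Binf, ∀ up ∈ Hplus Binf, ∀ um ∈ Hminus Binf,
      (w : H) = ι (z : X) + (up + um) →
      ∃ t : ℝ, 0 < t ∧ ∃ v' ∈ Hminus Binf, φ (ι (z : X)) (up + um) = t • up + v' := by
    intro w z up hup um hum hw
    obtain ⟨t, ht, v', hv', h1, -⟩ := hΦ w z up hup um hum hw
    refine ⟨t, ht, v', hv', ?_⟩
    rw [hφΦ w z _ hw, h1]
    abel
  have hLred := fun z (hz : z ∈ extBall ι Binf R) => hh.hasFDerivAt_Lred hz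
  refine ⟨R, h, φ, Φ, hh.pos, fun w hw => hV₂ (hR2.trans_le hw),
    fun w hw => hS.mem_range_of_mem_sup hw, hh.continuousOn, fun z hz => ⟨(hh.norm_lt z hz).le, ?_,
      fun x hx hAx => hh.unique hz hx ?_⟩, fun w z u hu hw => ⟨?_, ?_⟩, fun w hw => ?_,
    fun w z up hup um hum hw => ?_, fun w z hw => ?_, fun z hz up hup um hum => ?_,
    hh.exists_homeomorph_minusSet Φ fun w z v hv hw => ?_, hh.tendsto_zero, fun hA =>
    ⟨hh.contDiffOn, fun z hz => ⟨hh.derivEquiv z, fun x => ?_, fun w y hy => ?_⟩,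
      hh.contDiffOn_Lred, hLred⟩,
    fun _ => ⟨?_, hh.contDiffOn⟩, fun hE => ⟨?_, hh.hasStrictDerivAtInfinity_H,
      fun ⟨ρ', hSE⟩ => hh.hasStrictDerivAtInfinity_X hSE,
      hh.contDiffOn_Lred.of_le one_le_two, hLred, fun S hSB hAS =>
      ⟨hh.locallyLipschitzOn_fderiv_Lred, hh.hasStrictDerivAtInfinity_fderiv_Lred,
        fun ρ' hρ' => (hS.condSE_of_hasStrictDerivAtInfinity hSB hAS hρ').condE hS⟩⟩⟩
  · rw [hS.pmPart_eq, hh.eq_zero z hz, ZeroMemClass.coe_zero]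
  · rw [hS.pmPart_eq] at hAx
    exact Subtype.ext hAx
  · have e := Pplus_add_Pminus_of_mem (T := Binf) hu
    rw [← e] at hw ⊢
    obtain ⟨t, -, v', hv', h1⟩ := hφ' w z _ (Pplus_mem hsa u) _ (Pminus_mem u) hw
    rw [h1]
    exact add_mem_Hpm hsa (Submodule.smul_mem _ _ (Pplus_mem hsa u)) hv'
  · rw [hφΦ w z u hw]
    abel
  · obtain ⟨z, hz⟩ := hS.mem_range_of_mem_sup (Submodule.mem_sup_left (P0_mem (T := Binf) (w : H)))
    have hzX : z ∈ X0 ι Binf := by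
      change ι z ∈ H0 Binf
      rw [hz]
      exact P0_mem _
    obtain ⟨t, -, v', hv', h1, -⟩ := hΦ w ⟨z, hzX⟩ _ (Pplus_mem hsa (w : H)) _
      (Pminus_mem (w : H)) (by
        change (w : H) = ι z + _
        rw [hz, P0_add_Pplus_add_Pminus])
    obtain ⟨u, hu⟩ := hS.mem_range_Pplus hw
    obtain ⟨v, hv⟩ := hS.mem_range_of_mem_sup (Submodule.mem_sup_right hv')
    refine ⟨z + h ⟨z, hzX⟩ + (t • u + v), ?_⟩
    rw [h1, map_add, map_add, map_add, map_smul, hu, hv]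
  · obtain ⟨-, -, -, -, -, h1, -⟩ := hΦ w z up hup um hum hw
    exact h1
  · obtain ⟨t, -, v', -, h1, -, h2⟩ := hΦ w z 0 (Submodule.zero_mem _) 0 (Submodule.zero_mem _)
      (by rw [hw, add_zero, add_zero])
    rw [h1, h2 rfl rfl, smul_zero, add_zero, add_zero, map_add]
  · obtain ⟨t, ht, v', hv', h1⟩ := hφ' ⟨_, hO z hz _ (add_mem_Hpm hsa hup hum)⟩ z up hup um hum rfl
    rw [h1, Submodule.add_mem_iff_left _ hv', Submodule.smul_mem_iff _ ht.ne']
    -- What remains is `u⁺ ∈ H⁻`, and `H⁺ ⊥ H⁻` forces `u⁺ = 0`.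
    refine ⟨fun hm => ?_, fun h0 => h0 ▸ Submodule.zero_mem _⟩
    exact inner_self_eq_zero.1 (inner_Hminus_Hplus hm hup)
  · obtain ⟨t, -, v', hv', h1, -⟩ := hΦ w z 0 (Submodule.zero_mem _) v hv (by rw [hw, zero_add])
    exact ⟨v', hv', by rw [h1, smul_zero, zero_add]⟩
  · rw [hS.fderiv_A hA (hh.mem z (le_of_lt hz) _), hS.pmPart_eq,
      hh.derivEquiv_apply (le_of_lt hz)]
  · rw [hS.fderiv_A hA (hh.mem z (le_of_lt hz) _), hS.pmPart_eq] at hy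
    rw [(hh.hasStrictFDerivAt hz).hasFDerivAt.fderiv, hh.dh_apply, Subtype.ext hy]
  · exact (ι.comp (Xpm ι Binf).subtypeL).contDiff.comp_contDiffOn hh.contDiffOn
  · obtain ⟨κ, hκ, hr⟩ := hR₁ hE
    exact hh.lipschitzOnWith hκ fun z₁ z₂ x₁ x₂ h₁ h₂ =>
      hr z₁ z₂ x₁ x₂ (hR1.trans h₁) (hR1.trans h₂)
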